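/- **Setting.** Fix a relational signature $\sigma$: a non-empty finite set of unary and binary predicate symbols; everything below is over $\sigma$. Fix a countably infinite set of individual names. A *structure* interprets the predicates of $\sigma$ on a domain that contains all individual names, distinct names denoting distinct elements. An *ontology* $\mathcal O$ is a finite set of first-order sentences (with equality, without constants) over $\sigma$; an *ontology language* $\mathcal L$ is a set of ontologies. A *data instance* $\mathcal A$ is a non-empty finite set of atoms $\top(a)$, $A(a)$, $P(a,b)$ over individual names; $\mathrm{ind}(\mathcal A)$ is the set of names in $\mathcal A$; a *pointed* data instance is a pair $(\mathcal A,a)$ with $a\in\mathrm{ind}(\mathcal A)$. *Domain queries* are conjunctive queries (CQs) $q(x)$ with one answer variable $x$, which occurs in $q$, and the query $\bot(x)$, which is never true. $\mathcal O,\mathcal A\models q(a)$ means that $q(a)$ holds in every model of $\mathcal O$ and $\mathcal A$, so $\mathcal O,\mathcal A\models\bot(a)$ iff $\mathcal O,\mathcal A$ are inconsistent. We write $q_1\models_{\mathcal O}q_2$ if $\mathcal O,\mathcal A\models q_1(a)$ implies $\mathcal O,\mathcal A\models q_2(a)$ for all pointed data instances $(\mathcal A,a)$. A domain query is *satisfiable*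 wrt $\mathcal O$ if it holds of some element in some model of $\mathcal O$. Sizes (of sets of queries, data instances, etc.) are numbers of symbols. $\mathcal O$ *admits containment reduction* if for every CQ $q(x)$ there is a pointed data instance $(\hat q,a)$ such that (1) $q$ is satisfiable wrt $\mathcal O$ iff $\mathcal O,\hat q$ are satisfiable; (2) there is a homomorphism from $q$ to $\hat q$ that maps $x$ to $a$ and maps the variables of $q$ onto $\mathrm{ind}(\hat q)$; (3) if $q$ is satisfiable wrt $\mathcal O$, then, for every CQ $q'(x)$, $q\models_{\mathcal O}q'$ iff $\mathcal O,\hat q\models q'(a)$. Let $\mathcal Q^\sigma$ be a class of domain queries with $\bot\in\mathcal Q^\sigma$. A *split-partner* of a finite set $Q\subseteq\mathcal Q^\sigma$ wrt $\mathcal O$ within $\mathcal Q^\sigma$ is a finite set $\mathcal S$ of pointed data instances such that, for all $q'\in\mathcal Q^\sigma$: $\mathcal O,\mathcal A\models q'(a)$ for some $(\mathcal A,a)\in\mathcal S$ iff $q'\not\models_{\mathcal O}q$ for all $q\in Q$. $\mathcal L$ *has general split-partners within* $\mathcal Q^\sigma$ if every non-empty finite $Q\subseteq\mathcal Q^\sigma$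 has a split-partner wrt every $\mathcal O\in\mathcal L$ within $\mathcal Q^\sigma$. A *temporal data instance* is a sequence $\mathcal D=\mathcal A_0,\dots,\mathcal A_k$ of data instances with the same individuals; put $\mathcal A_\ell=\{\top(a)\mid a\in\mathrm{ind}(\mathcal D)\}$ for $\ell>k$. $\mathcal O,\mathcal D$ are satisfiable if $\mathcal O,\mathcal A_i$ are satisfiable for all $i\le k$. $\mathrm{LTL}^{\mathsf U}_p(\mathcal Q^\sigma)$ is the class of queries $$\mathbf q=r_0\wedge(l_1\,\mathsf U\,(r_1\wedge(l_2\,\mathsf U\,(\dots(l_n\,\mathsf U\,r_n)\dots)))),\qquad n\ge 0,\ r_i\in\mathcal Q^\sigma,\ l_i\in\mathcal Q^\sigma\cup\{\bot\}.$$ If $\mathcal O,\mathcal D$ are satisfiable, $\mathcal O,\mathcal D,\ell,a\models\mathbf q$ is defined inductively: a domain query $q$ holds at $\ell$ iff $\mathcal O,\mathcal A_\ell\models q(a)$, and $\mathbf q_1\mathsf U\mathbf q_2$ holds at $\ell$ iff $\mathbf q_2$ holds at some $m>\ell$ and $\mathbf q_1$ holds at all $k$ with $\ell<k<m$. If $\mathcal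 O,\mathcal D$ are not satisfiable, everything is entailed. Queries are evaluated at time $0$: two queries are equivalent wrt $\mathcal O$ if they are entailed at time $0$ by the same pairs $(\mathcal D,a)$, $a\in\mathrm{ind}(\mathcal D)$, and $\mathbf q$ is *satisfiable wrt* $\mathcal O$ if $\mathcal O,\mathcal D,0,a\models\mathbf q$ for some $\mathcal D$ satisfiable with $\mathcal O$ and some $a\in\mathrm{ind}(\mathcal D)$. The query $\mathbf q$ is *$\mathcal O$-peerless* if, for each $i=1,\dots,n$, either $l_i=\bot$, or $r_i\not\models_{\mathcal O}l_i$ and $l_i\not\models_{\mathcal O}r_i$; $\mathrm{LTL}^{\mathsf U}_{pp}(\mathcal Q^\sigma)$ is the class of $\mathcal O$-peerless queries in $\mathrm{LTL}^{\mathsf U}_p(\mathcal Q^\sigma)$. A pair $E=(E^+,E^-)$ of finite sets of pointed temporal data instances *uniquely characterises* $\mathbf q$ wrt $\mathcal O$ within a class $\mathcal C$ if $\mathbf q$ *fits* $E$ (it is entailed wrt $\mathcal O$ at time $0$ by all members of $E^+$ and by no member of $E^-$) and every $\mathbf q'\in\mathcal C$ that fits $E$ is equivalent to $\mathbf q$ wrt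 $\mathcal O$. **Theorem.** Let $\mathcal L$ have general split-partners within $\mathcal Q^\sigma$ and let $\mathcal O\in\mathcal L$ admit containment reduction. Then: 1. Every $\mathbf q\in\mathrm{LTL}^{\mathsf U}_{pp}(\mathcal Q^\sigma)$ that is satisfiable wrt $\mathcal O$ has a unique characterisation wrt $\mathcal O$ within $\mathrm{LTL}^{\mathsf U}_{p}(\mathcal Q^\sigma)$. 2. If there is a polynomial $f$ such that every non-empty finite $Q\subseteq\mathcal Q^\sigma$ has a split-partner wrt $\mathcal O$ within $\mathcal Q^\sigma$ of size at most $2^{f(|Q|)}$, then there is a polynomial $g$ such that every such $\mathbf q$ has a unique characterisation as in 1 of size at most $2^{g(|\mathbf q|)}$. 3. If there is a polynomial $f$ such that every non-empty finite $Q\subseteq\mathcal Q^\sigma$ has a split-partner wrt $\mathcal O$ within $\mathcal Q^\sigma$ of size at most $f(|Q|)$, and $\{\bot\}$ has a split-partner wrt $\mathcal O$ within $\mathcal Q^\sigma$ that is a singleton, then there is a polynomial $g$ such that every such $\mathbf q$ has a unique characterisation as in 1 of size at most $g(|\mathbf q|)$. -/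

import Mathlib

open scoped FirstOrder

/-! ## Signatures, structures, ontologies

A relational signature is given by a type `U` of unary and a type `B` of binary predicate symbols
(finite, and not both empty, in the theorem).  All notions below are relative to this signature.
Individual names are natural numbers. -/

/-- The first-order language (with equality, without function symbols and constants) over
the unary predicates `U` and the binary predicates `B`. -/
def sigLang (U B : Type) : FirstOrder.Language.{0, 0} where
  Functions := fun _ => Empty
  Relations
    | 1 => U
    | 2 => B
    | _ => Empty

/-- An ontology: a finite set of first-order sentences over the signature. -/
abbrev Ontology (U B : Type) := Finset (sigLang U B).Sentence

/-- A structure interpreting the predicates of the signature and all individual names;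
distinct names denote distinct elements. -/
structure Interp (U B : Type) where
  Dom : Type
  str : (sigLang U B).Structure Dom
  name : ℕ ↪ Dom

attribute [instance] Interp.str

/-- `A` is true of `d`. -/
def Interp.un {U B : Type} (I : Interp U B) (A : U) (d : I.Dom) : Prop :=
  FirstOrder.Language.Structure.RelMap (L := sigLang U B) (n := 1) A ![d]

/-- `P` is true of `(d, e)`. -/
def Interp.bin {U B : Type} (I : Interp U B) (P : B) (d e : I.Dom) : Prop :=
  FirstOrder.Language.Structure.RelMap (L := sigLang U B) (n := 2) P ![d, e]

/-- All sentences of the ontology are true in `I`. -/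
def Interp.ModelsOnt {U B : Type} (I : Interp U B) (O : Ontology U B) : Prop :=
  ∀ φ ∈ O, I.Dom ⊨ φ

/-! ## Atoms, data instances, domain queries -/

/-- Atoms `⊤(t)`, `A(t)`, `P(s,t)`. The terms are numbers: individual names in data instances,
variables in queries. -/
inductive Atom (U B : Type) where
  | top (t : ℕ)
  | un (A : U) (t : ℕ)
  | bin (P : B) (s t : ℕ)

namespace Atom

variable {U B : Type}

def terms : Atom U B → Finset ℕ
  | top t => {t}
  | un _ t => {t}
  | bin _ s t => {s, t}

/-- Number of symbols. -/
def size : Atom U B → ℕ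
  | top _ => 2
  | un _ _ => 2
  | bin _ _ _ => 3

/-- Truth of an atom under an assignment of its terms. -/
def Holds (I : Interp U B) (v : ℕ → I.Dom) : Atom U B → Prop
  | top _ => True
  | un A t => I.un A (v t)
  | bin P s t => I.bin P (v s) (v t)

theorem terms_nonempty (α : Atom U B) : α.terms.Nonempty := by
  cases α <;> simp [terms]

end Atom

/-- A data instance: a non-empty finite set of atoms over individual names. -/
structure DataInstance (U B : Type) where
  atoms : Finset (Atom U B)
  nonempty : atoms.Nonempty

namespace DataInstance

variable {U B : Type}

/-- The individual names occurring in the instance. -/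
def ind (A : DataInstance U B) : Finset ℕ := A.atoms.biUnion Atom.terms

def size (A : DataInstance U B) : ℕ := ∑ α ∈ A.atoms, α.size

theorem ind_nonempty (A : DataInstance U B) : A.ind.Nonempty := by
  obtain ⟨α, hα⟩ := A.nonempty
  obtain ⟨t, ht⟩ := α.terms_nonempty
  exact ⟨t, Finset.mem_biUnion.2 ⟨α, hα, ht⟩⟩

/-- The instance `{⊤(a) | a ∈ N}`. -/
def tops (N : Finset ℕ) (hN : N.Nonempty) : DataInstance U B where
  atoms := N.map ⟨Atom.top, fun _ _ h => Atom.top.inj h⟩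
  nonempty := hN.map

end DataInstance

structure PointedInstance (U B : Type) where
  inst : DataInstance U B
  pt : ℕ
  pt_mem : pt ∈ inst.ind

/-- A conjunctive query, as the finite set of its atoms; the answer variable is the variable `0`,
all other variables are existentially quantified. -/
structure CQ (U B : Type) where
  atoms : Finset (Atom U B)
  answer_mem : 0 ∈ atoms.biUnion Atom.terms

namespace CQ

variable {U B : Type}

def vars (q : CQ U B) : Finset ℕ := q.atoms.biUnion Atom.terms

/-- Number of symbols in the atoms of the query. -/
def size (q : CQ U B) : ℕ := ∑ α ∈ q.atoms, α.size

def Holds (I : Interp U B) (q : CQ U B) (d : I.Dom) : Prop :=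
  ∃ v : ℕ → I.Dom, v 0 = d ∧ ∀ α ∈ q.atoms, α.Holds I v

end CQ

/-- Domain queries: conjunctive queries and the inconsistency query `⊥(x)`. -/
inductive DomainQuery (U B : Type) where
  | cq (q : CQ U B)
  | bot

namespace DomainQuery

variable {U B : Type}

def size : DomainQuery U B → ℕ
  | cq q => q.size
  | bot => 2

def Holds (I : Interp U B) : DomainQuery U B → I.Dom → Prop
  | cq q, d => q.Holds I d
  | bot, _ => False

end DomainQuery

section Entailment

variable {U B : Type}

/-- `I` is a model of `O` and `A`. -/
def Interp.IsModel (I : Interp U B) (O : Ontology U B) (A : DataInstance U B) : Prop :=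
  I.ModelsOnt O ∧ ∀ α ∈ A.atoms, α.Holds I I.name

/-- `O` and `A` are satisfiable. -/
def InstSatisfiable (O : Ontology U B) (A : DataInstance U B) : Prop :=
  ∃ I : Interp U B, I.IsModel O A

/-- `O, A ⊨ q(a)`: certain answers. In particular, `O, A ⊨ ⊥(a)` iff `O` and `A` are
inconsistent. -/
def Entails (O : Ontology U B) (A : DataInstance U B) (q : DomainQuery U B) (a : ℕ) : Prop :=
  ∀ I : Interp U B, I.IsModel O A → q.Holds I (I.name a)

/-- `q₁ ⊨_O q₂`: containment with respect to `O`. -/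
def Contained (O : Ontology U B) (q₁ q₂ : DomainQuery U B) : Prop :=
  ∀ (A : DataInstance U B) (a : ℕ), a ∈ A.ind → Entails O A q₁ a → Entails O A q₂ a

/-- The query is satisfiable with respect to `O`. -/
def DomainQuery.SatisfiableWrt (O : Ontology U B) (q : DomainQuery U B) : Prop :=
  ∃ I : Interp U B, I.ModelsOnt O ∧ ∃ d : I.Dom, q.Holds I d

/-- There is a homomorphism from `q` to `A` that maps the answer variable to `a` and the variables
of `q` onto the individuals of `A`. -/
def SurjHom (q : CQ U B) (A : DataInstance U B) (a : ℕ) : Prop :=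
  ∃ h : ℕ → ℕ, h 0 = a ∧ q.vars.image h = A.ind ∧
    (∀ C y, Atom.un C y ∈ q.atoms → Atom.un C (h y) ∈ A.atoms) ∧
    (∀ P y z, Atom.bin P y z ∈ q.atoms → Atom.bin P (h y) (h z) ∈ A.atoms)

/-- `O` admits containment reduction. -/
def AdmitsContainmentReduction (O : Ontology U B) : Prop :=
  ∀ q : CQ U B, ∃ p : PointedInstance U B,
    ((DomainQuery.cq q).SatisfiableWrt O ↔ InstSatisfiable O p.inst) ∧
    SurjHom q p.inst p.pt ∧
    ((DomainQuery.cq q).SatisfiableWrt O → ∀ q' : CQ U B,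
      (Contained O (.cq q) (.cq q') ↔ Entails O p.inst (.cq q') p.pt))

/-! ## Split-partners -/

/-- The finite set `S` of pointed data instances is a split-partner for `Q` with respect to `O`
within the class `𝒬`. -/
def IsSplitPartner (O : Ontology U B) (𝒬 : Set (DomainQuery U B)) (Q : Finset (DomainQuery U B))
    (S : Finset (PointedInstance U B)) : Prop :=
  ∀ q' ∈ 𝒬, (∃ p ∈ S, Entails O p.inst q' p.pt) ↔ ∀ q ∈ Q, ¬ Contained O q' q

/-- The ontology language `ℒ` has general split-partners within `𝒬`. -/
def HasGeneralSplitPartners (ℒ : Set (Ontology U B)) (𝒬 : Set (DomainQuery U B)) : Prop :=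
  ∀ O ∈ ℒ, ∀ Q : Finset (DomainQuery U B), Q.Nonempty → (∀ q ∈ Q, q ∈ 𝒬) →
    ∃ S, IsSplitPartner O 𝒬 Q S

def queriesSize (Q : Finset (DomainQuery U B)) : ℕ := ∑ q ∈ Q, q.size

def pointedSize (S : Finset (PointedInstance U B)) : ℕ := ∑ p ∈ S, p.inst.size

/-- Every non-empty finite set of `𝒬`-queries has a split-partner with respect to `O` whose size is
at most `bound` of the size of the set. -/
def SplitPartnersBounded (O : Ontology U B) (𝒬 : Set (DomainQuery U B)) (bound : ℕ → ℕ) : Prop :=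
  ∀ Q : Finset (DomainQuery U B), Q.Nonempty → (∀ q ∈ Q, q ∈ 𝒬) →
    ∃ S, IsSplitPartner O 𝒬 Q S ∧ pointedSize S ≤ bound (queriesSize Q)

/-! ## Temporal data instances and until-path queries -/

/-- A temporal data instance `A₀, …, Aₙ` with `n = last`; all `Aᵢ` have the same individuals. -/
structure TemporalInstance (U B : Type) where
  last : ℕ
  snap : Fin (last + 1) → DataInstance U B
  ind_eq : ∀ i j, (snap i).ind = (snap j).ind

namespace TemporalInstance

def ind (D : TemporalInstance U B) : Finset ℕ := (D.snap 0).ind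

def size (D : TemporalInstance U B) : ℕ := ∑ i, (D.snap i).size

/-- `A_ℓ` for every time point `ℓ`; beyond the end of `D` it is `{⊤(a) | a ∈ ind(D)}`. -/
def at' (D : TemporalInstance U B) (ℓ : ℕ) : DataInstance U B :=
  if h : ℓ < D.last + 1 then D.snap ⟨ℓ, h⟩
  else DataInstance.tops D.ind (DataInstance.ind_nonempty _)

/-- `O` and `D` are satisfiable. -/
def SatisfiableWrt (O : Ontology U B) (D : TemporalInstance U B) : Prop :=
  ∀ i, InstSatisfiable O (D.snap i)

end TemporalInstance

end Entailment

/-- Until-path queries `r₀ ∧ (l₁ U (r₁ ∧ (l₂ U (… (lₙ U rₙ) …))))`: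
`last r` is the query `r`, and `step r l q` is the query `r ∧ (l U q)`. -/
inductive UPath (U B : Type) where
  | last (r : DomainQuery U B)
  | step (r l : DomainQuery U B) (q : UPath U B)

namespace UPath

variable {U B : Type}

/-- The first conjunct `r₀`. -/
def head : UPath U B → DomainQuery U B
  | last r => r
  | step r _ _ => r

/-- Number of symbols. -/
def size : UPath U B → ℕ
  | last r => r.size
  | step r l q => r.size + l.size + q.size + 2

/-- The query is built from the class `𝒬`: each `rᵢ` is in `𝒬` and each `lᵢ` is in `𝒬`
or is `⊥`. -/
def BuiltFrom (𝒬 : Set (DomainQuery U B)) : UPath U B → Prop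
  | last r => r ∈ 𝒬
  | step r l q => r ∈ 𝒬 ∧ (l ∈ 𝒬 ∨ l = .bot) ∧ q.BuiltFrom 𝒬

/-- For each `i ≥ 1`, either `lᵢ` is `⊥`, or `rᵢ` and `lᵢ` are incomparable with respect to
containment. -/
def Peerless (O : Ontology U B) : UPath U B → Prop
  | last _ => True
  | step _ l q =>
      (l = .bot ∨ (¬ Contained O q.head l ∧ ¬ Contained O l q.head)) ∧ q.Peerless O

/-- Truth at time `ℓ` by induction on the query, with strict until. -/
def TrueAt (O : Ontology U B) (D : TemporalInstance U B) (a : ℕ) : UPath U B → ℕ → Prop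
  | last r, ℓ => Entails O (D.at' ℓ) r a
  | step r l q, ℓ => Entails O (D.at' ℓ) r a ∧
      ∃ m, ℓ < m ∧ q.TrueAt O D a m ∧ ∀ k, ℓ < k → k < m → Entails O (D.at' k) l a

/-- `O, D, ℓ, a ⊨ q`; everything is entailed if `O` and `D` are not satisfiable. -/
def EntailedAt (O : Ontology U B) (D : TemporalInstance U B) (ℓ a : ℕ) (q : UPath U B) : Prop :=
  D.SatisfiableWrt O → q.TrueAt O D a ℓ

/-- Equivalence with respect to `O` (queries are evaluated at time `0`). -/
def EquivWrt (O : Ontology U B) (q q' : UPath U B) : Prop :=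
  ∀ (D : TemporalInstance U B) (a : ℕ), a ∈ D.ind →
    (q.EntailedAt O D 0 a ↔ q'.EntailedAt O D 0 a)

/-- The query holds at time `0` in some temporal data instance that is satisfiable together with
`O`. -/
def SatisfiableWrt (O : Ontology U B) (q : UPath U B) : Prop :=
  ∃ (D : TemporalInstance U B) (a : ℕ), a ∈ D.ind ∧ D.SatisfiableWrt O ∧ q.EntailedAt O D 0 a

end UPath

/-- `LTL_p^U(𝒬)`. -/
def untilPathQueries {U B : Type} (𝒬 : Set (DomainQuery U B)) : Set (UPath U B) :=
  {q | q.BuiltFrom 𝒬}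

/-- `LTL_pp^U(𝒬)`: the `O`-peerless queries in `LTL_p^U(𝒬)`. -/
def peerlessQueries {U B : Type} (O : Ontology U B) (𝒬 : Set (DomainQuery U B)) :
    Set (UPath U B) :=
  {q | q ∈ untilPathQueries 𝒬 ∧ q.Peerless O}

/-! ## Unique characterisations -/

structure PointedTemporal (U B : Type) where
  inst : TemporalInstance U B
  pt : ℕ
  pt_mem : pt ∈ inst.ind

/-- An example set `(E⁺, E⁻)`. -/
structure ExampleSet (U B : Type) where
  pos : Finset (PointedTemporal U B)
  neg : Finset (PointedTemporal U B)

namespace ExampleSet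

variable {U B : Type}

def size (E : ExampleSet U B) : ℕ :=
  ∑ e ∈ E.pos, e.inst.size + ∑ e ∈ E.neg, e.inst.size

/-- `q` fits `E` with respect to `O`. -/
def Fits (E : ExampleSet U B) (O : Ontology U B) (q : UPath U B) : Prop :=
  (∀ e ∈ E.pos, q.EntailedAt O e.inst 0 e.pt) ∧ ∀ e ∈ E.neg, ¬ q.EntailedAt O e.inst 0 e.pt

/-- `E` uniquely characterises `q` with respect to `O` within the class `𝒞`. -/
def UniquelyCharacterises (E : ExampleSet U B) (O : Ontology U B) (𝒞 : Set (UPath U B))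
    (q : UPath U B) : Prop :=
  E.Fits O q ∧ ∀ q' ∈ 𝒞, E.Fits O q' → q'.EquivWrt O q

end ExampleSet

/-! Domain queries are preordered by containment, with `⊥` least. Pointed data instances satisfiable
with `O` are letters, temporal instances are words, and an until-path query is an automaton: in
state `j` a letter is matched with `r j` or skipped by `l j`. Containment reduction gives each
satisfiable query `z` a canonical letter `h z` satisfying exactly the queries above `z`. A
split-partner of `Q` is a finite set of letters that satisfy no member of `Q`, while every query
below no member of `Q` is satisfied by one of them. The examples are finitely many test words
classified by the query itself, so it fits trivially; what has to be shown is that a rival agreeing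
with it on the test words is equivalent to it. Trailing valid conjuncts are trimmed first, because
after the end of a word exactly the valid queries hold.

Conjuncts (`SameTests.conj`): the canonical word of `r 0, …, r n`, words over the partner of `{⊥}`,
and such words with one letter from the partner of `{r i}` force the rival to have the same length
and equivalent conjuncts. These words are the only source of exponential growth, and it disappears
if the partner of `{⊥}` is a singleton.

Guards: they are not determined one by one. If `r s, …, r (i - 1)` are all equivalent to some `ρ`
and `l i ≤ ρ`, a guard `ρ` at `s` can do the work of `l i`. By peerlessness a canonical prefix can
only be read letter by letter, so inserted letters probe single positions. Up to three insertions
show that this is the only way in which `l i ≤ l' i` can fail (`Rival.exists_block`), and then truth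
with `l` implies truth with `l'` (`wait_of_shifts`). Conversely, `l' e` is below `l e` or below `r
e` (`Rival.guard_le`). In the second case a letter skipped by `l' e` can instead be matched with `r
e`, provided the query accepts `A, r e, w` from state `e` for a letter `A` of the partner of `{l e}`
and all canonical tails `w` (`wait_of_guards`). If a tail fails, a short failing one depends on the
query and `A` only, so it can be tested in advance; the rival accepts that word
(`Rival.accepts_insert`), a contradiction. `Rival.wait_iff` combines the two directions. -/

namespace UntilWords

/-! ### Until-path queries as automata on words -/

section Automaton

variable {α Λ : Type}

/-- Acceptance of a word by the until-path query with conjuncts `r` and guards `l`, where the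
conjunct `r j` is to be matched next: a letter either matches `r j` or is skipped by `l j`. -/
inductive Accepts (sat : Λ → α → Prop) (n : ℕ) (r l : ℕ → α) : ℕ → List Λ → Prop
  | done {j : ℕ} {w : List Λ} : n < j → Accepts sat n r l j w
  | hit {j : ℕ} {c : Λ} {w : List Λ} :
      sat c (r j) → Accepts sat n r l (j + 1) w → Accepts sat n r l j (c :: w)
  | skip {j : ℕ} {c : Λ} {w : List Λ} :
      sat c (l j) → Accepts sat n r l j w → Accepts sat n r l j (c :: w)

variable {sat : Λ → α → Prop} {n : ℕ} {r l : ℕ → α}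

theorem Accepts.cases_cons {j : ℕ} {c : Λ} {w : List Λ} (hj : j ≤ n)
    (H : Accepts sat n r l j (c :: w)) :
    (sat c (r j) ∧ Accepts sat n r l (j + 1) w) ∨ (sat c (l j) ∧ Accepts sat n r l j w) := by
  cases H with
  | done h => omega
  | hit h1 h2 => exact .inl ⟨h1, h2⟩
  | skip h1 h2 => exact .inr ⟨h1, h2⟩

theorem Accepts.length_le {j : ℕ} {w : List Λ} (H : Accepts sat n r l j w) :
    n + 1 ≤ j + w.length := by
  induction H with
  | done h => omega
  | hit _ _ ih => simp only [List.length_cons]; omega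
  | skip _ _ ih => simp only [List.length_cons]; omega

theorem Accepts.hit_of_exact {j : ℕ} {c : Λ} {w : List Λ}
    (H : Accepts sat n r l j (c :: w)) (hlen : n = j + w.length) :
    sat c (r j) ∧ Accepts sat n r l (j + 1) w := by
  rcases H.cases_cons (by omega) with h | ⟨-, h⟩
  · exact h
  · have := h.length_le
    omega

theorem Accepts.append_congr {u v v' : List Λ}
    (hv : ∀ j, Accepts sat n r l j v → Accepts sat n r l j v') {j : ℕ}
    (H : Accepts sat n r l j (u ++ v)) : Accepts sat n r l j (u ++ v') := by
  induction u generalizing j with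
  | nil => exact hv j H
  | cons c u ih =>
    cases H with
    | done h => exact .done h
    | hit h1 h2 => exact .hit h1 (ih h2)
    | skip h1 h2 => exact .skip h1 (ih h2)

/-- Pigeonhole: at most `k` conjuncts are pending, so a run on `k` copies of `c` either matches all
of them or skips some copy, and a skipped copy can be doubled. -/
theorem Accepts.replicate_succ {j k : ℕ} {c : Λ} {v : List Λ} (hk : n + 1 ≤ j + k)
    (H : Accepts sat n r l j (List.replicate k c ++ v)) :
    Accepts sat n r l j (List.replicate (k + 1) c ++ v) := by
  induction k generalizing j with
  | zero => exact .done (by omega)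
  | succ k ih =>
    rw [List.replicate_succ, List.cons_append] at H ⊢
    cases H with
    | done h => exact .done h
    | hit h1 h2 => exact .hit h1 (ih (by omega) h2)
    | skip h1 h2 => exact .skip h1 (.skip h1 h2)

theorem Accepts.replicate_mono {j k k' : ℕ} {c : Λ} {v : List Λ} (hk : n + 1 ≤ j + k)
    (hkk : k ≤ k') (H : Accepts sat n r l j (List.replicate k c ++ v)) :
    Accepts sat n r l j (List.replicate k' c ++ v) := by
  induction k', hkk using Nat.le_induction with
  | base => exact H
  | succ m hm ih => exact ih.replicate_succ (by omega)

/-- The word of the canonical letters for `r a, …, r (b - 1)`. -/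
def conjWord (h : α → Λ) (r : ℕ → α) (a b : ℕ) : List Λ := (List.Ico a b).map fun j => h (r j)

theorem conjWord_self (h : α → Λ) (r : ℕ → α) (a : ℕ) : conjWord h r a a = [] := by
  simp [conjWord]

theorem conjWord_cons (h : α → Λ) (r : ℕ → α) {a b : ℕ} (hab : a < b) :
    conjWord h r a b = h (r a) :: conjWord h r (a + 1) b := by
  simp [conjWord, List.Ico.eq_cons hab]

theorem conjWord_append (h : α → Λ) (r : ℕ → α) {a b c : ℕ} (hab : a ≤ b) (hbc : b ≤ c) :
    conjWord h r a b ++ conjWord h r b c = conjWord h r a c := by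
  rw [conjWord, conjWord, ← List.map_append, List.Ico.append_consecutive hab hbc, conjWord]

theorem length_conjWord (h : α → Λ) (r : ℕ → α) (a b : ℕ) :
    (conjWord h r a b).length = b - a := by
  simp [conjWord]

/-- Words that arise from `w` by a number of insertions of letters from `S`. -/
inductive Insertion (S : Set Λ) (w : List Λ) : ℕ → List Λ → Prop
  | base : Insertion S w 0 w
  | ins {k : ℕ} {u v : List Λ} {c : Λ} :
      Insertion S w k (u ++ v) → c ∈ S → Insertion S w (k + 1) (u ++ c :: v)

theorem insertion_one {h : α → Λ} {S : Set Λ} {i : ℕ} {c : Λ} (hi : 1 ≤ i) (hn : i ≤ n + 1)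
    (hc : c ∈ S) :
    Insertion S (conjWord h r 1 (n + 1)) 1
      (conjWord h r 1 i ++ c :: conjWord h r i (n + 1)) := by
  refine .ins ?_ hc
  rw [conjWord_append h r hi hn]
  exact .base

theorem insertion_two {h : α → Λ} {S : Set Λ}
    {i j : ℕ} {c d : Λ} (hi : 1 ≤ i) (hij : i ≤ j)
    (hn : j ≤ n + 1) (hc : c ∈ S) (hd : d ∈ S) :
    Insertion S (conjWord h r 1 (n + 1)) 2
      (conjWord h r 1 i ++ c :: (conjWord h r i j ++ d :: conjWord h r j (n + 1))) := by
  refine .ins ?_ hc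
  rw [← List.append_assoc, conjWord_append h r hi hij]
  exact insertion_one (by omega) hn hd

theorem insertion_three {h : α → Λ} {S : Set Λ}
    {i j k : ℕ} {c d e : Λ} (hi : 1 ≤ i)
    (hij : i ≤ j) (hjk : j ≤ k) (hn : k ≤ n + 1) (hc : c ∈ S) (hd : d ∈ S) (he : e ∈ S) :
    Insertion S (conjWord h r 1 (n + 1)) 3
      (conjWord h r 1 i ++ c :: (conjWord h r i j ++ d ::
        (conjWord h r j k ++ e :: conjWord h r k (n + 1)))) := by
  refine .ins ?_ hc
  rw [← List.append_assoc, conjWord_append h r hi hij]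
  exact insertion_two (by omega) hjk hn hd he

end Automaton

/-! ### Peerless queries and rivals with the same conjuncts -/

section Setting

variable {α Λ : Type} [Preorder α] [OrderBot α]

/-- Queries are ordered by containment; `h z` is the canonical letter of a satisfiable query `z`,
and the query with conjuncts `r` and guards `l` is peerless. -/
structure Setting (sat : Λ → α → Prop) (h : α → Λ) (n : ℕ) (r l : ℕ → α) : Prop where
  mono {c : Λ} {z z' : α} : sat c z → z ≤ z' → sat c z'
  hat {z u : α} : ¬ z ≤ ⊥ → (sat (h z) u ↔ z ≤ u)
  r_sat {j : ℕ} : j ≤ n → ¬ r j ≤ ⊥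
  peer {j : ℕ} : 1 ≤ j → j ≤ n → l j ≤ ⊥ ∨ (¬ r j ≤ l j ∧ ¬ l j ≤ r j)

/-- The guards `l'` are such that the queries with conjuncts `r` and guards `l` and `l'` agree on
all words with at most three inserted letters from `S`. -/
structure Rival (sat : Λ → α → Prop) (h : α → Λ) (n : ℕ) (r l l' : ℕ → α) (S : Set Λ) : Prop
    extends Setting sat h n r l where
  agree {k : ℕ} {w : List Λ} : k ≤ 3 → Insertion S (conjWord h r 1 (n + 1)) k w →
    (Accepts sat n r l' 1 w ↔ Accepts sat n r l 1 w)
  r_mem {j : ℕ} : j ≤ n → h (r j) ∈ S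
  l_mem {j : ℕ} : 1 ≤ j → j ≤ n → ¬ l j ≤ ⊥ → h (l j) ∈ S
  split_r {i j : ℕ} : 1 ≤ i → i ≤ n → j ≤ n → ¬ r j ≤ l i → ¬ r j ≤ r i →
    ∃ A ∈ S, sat A (r j) ∧ ¬ sat A (l i) ∧ ¬ sat A (r i)
  split_l {i : ℕ} : 1 ≤ i → i ≤ n → ¬ l' i ≤ l i → ¬ l' i ≤ r i →
    ∃ A ∈ S, sat A (l' i) ∧ ¬ sat A (l i) ∧ ¬ sat A (r i)

variable {sat : Λ → α → Prop} {h : α → Λ} {n : ℕ} {r l l' : ℕ → α} {S : Set Λ}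

namespace Setting

theorem r_not_le_l (H : Setting sat h n r l) {j : ℕ} (h1 : 1 ≤ j) (hn : j ≤ n) :
    ¬ r j ≤ l j := by
  rcases H.peer h1 hn with h | h
  · exact fun h' => H.r_sat hn (h'.trans h)
  · exact h.1

theorem l_not_le_r (H : Setting sat h n r l) {j : ℕ} (h1 : 1 ≤ j) (hn : j ≤ n)
    (hl : ¬ l j ≤ ⊥) : ¬ l j ≤ r j :=
  ((H.peer h1 hn).resolve_left hl).2

theorem sat_r (H : Setting sat h n r l) {j : ℕ} (hn : j ≤ n) {u : α} :
    sat (h (r j)) u ↔ r j ≤ u := H.hat (H.r_sat hn)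

/-- Matching the letters of `r (j + d), …, r (k + d - 1)` with `r j, …, r (k - 1)`. -/
theorem accepts_run (H : Setting sat h n r l) {g : ℕ → α} {j k d : ℕ} {v : List Λ} (hjk : j ≤ k)
    (hk : k + d ≤ n + 1) (hle : ∀ t, j ≤ t → t < k → r (t + d) ≤ r t)
    (hv : Accepts sat n r g k v) :
    Accepts sat n r g j (conjWord h r (j + d) (k + d) ++ v) := by
  induction hjk using Nat.decreasingInduction with
  | self => simpa [conjWord_self]
  | of_succ j hj ih =>
    rw [conjWord_cons h r (by omega : j + d < k + d), List.cons_append]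
    refine .hit ((H.sat_r (by omega)).2 (hle j le_rfl hj)) ?_
    rw [show j + d + 1 = j + 1 + d by omega]
    exact ih fun t ht => hle t (by omega)

theorem accepts_prefix (H : Setting sat h n r l) {g : ℕ → α} {j k : ℕ} {v : List Λ} (hjk : j ≤ k)
    (hk : k ≤ n + 1) (hv : Accepts sat n r g k v) :
    Accepts sat n r g j (conjWord h r j k ++ v) :=
  H.accepts_run (d := 0) hjk hk (fun _ _ _ => le_rfl) hv

theorem accepts_conjWord (H : Setting sat h n r l) {g : ℕ → α} {j : ℕ} (hj : j ≤ n + 1) :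
    Accepts sat n r g j (conjWord h r j (n + 1)) := by
  have := H.accepts_prefix (g := g) (v := []) hj le_rfl (.done (Nat.lt_succ_self n))
  simpa using this

/-- When no letter can be skipped, acceptance matches all letters. -/
theorem run_of_exact (H : Setting sat h n r l) {g : ℕ → α} {j k d : ℕ} {v : List Λ} (hjk : j ≤ k)
    (hk : k + d ≤ n + 1) (hlen : n + 1 = k + v.length)
    (hv : Accepts sat n r g j (conjWord h r (j + d) (k + d) ++ v)) :
    (∀ t, j ≤ t → t < k → r (t + d) ≤ r t) ∧ Accepts sat n r g k v := by
  induction hjk using Nat.decreasingInduction with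
  | self => exact ⟨fun t h1 h2 => by omega, by simpa [conjWord_self] using hv⟩
  | of_succ j hj ih =>
    rw [conjWord_cons h r (by omega : j + d < k + d), List.cons_append] at hv
    obtain ⟨h1, h2⟩ := hv.hit_of_exact
      (by rw [List.length_append, length_conjWord]; omega)
    rw [show j + d + 1 = j + 1 + d by omega] at h2
    obtain ⟨h3, h4⟩ := ih h2
    refine ⟨fun t ht htk => ?_, h4⟩
    rcases ht.eq_or_lt with rfl | ht
    · exact (H.sat_r (by omega)).1 h1
    · exact h3 t ht htk

/-- Letters that cannot be skipped are matched. -/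
theorem run_of_not_le (H : Setting sat h n r l) {j k d : ℕ} {v : List Λ} (hjk : j ≤ k)
    (hk : k + d ≤ n + 1) (hle : ∀ t, j ≤ t → t < k → ¬ r t ≤ l (t + d))
    (hv : Accepts sat n r l (j + d) (conjWord h r j k ++ v)) :
    (∀ t, j ≤ t → t < k → r t ≤ r (t + d)) ∧ Accepts sat n r l (k + d) v := by
  induction hjk using Nat.decreasingInduction with
  | self => exact ⟨fun t h1 h2 => by omega, by simpa [conjWord_self] using hv⟩
  | of_succ j hj ih =>
    rw [conjWord_cons h r hj, List.cons_append] at hv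
    rcases hv.cases_cons (by omega) with ⟨h1, h2⟩ | ⟨h1, -⟩
    · rw [show j + d + 1 = j + 1 + d by omega] at h2
      obtain ⟨h3, h4⟩ := ih (fun t ht => hle t (by omega)) h2
      refine ⟨fun t ht htk => ?_, h4⟩
      rcases ht.eq_or_lt with rfl | ht
      · exact (H.sat_r (by omega)).1 h1
      · exact h3 t ht htk
    · exact absurd ((H.sat_r (by omega)).1 h1) (hle j le_rfl hj)

/-- Peerlessness forbids skipping the letter of `r t` by `l t`, so the canonical prefix is matched
letter by letter. This is what makes an inserted letter meet a known state of the query. -/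
theorem accepts_of_prefix (H : Setting sat h n r l) {j : ℕ} {v : List Λ} (hj : 1 ≤ j)
    (hn : j ≤ n + 1) (hv : Accepts sat n r l 1 (conjWord h r 1 j ++ v)) :
    Accepts sat n r l j v :=
  (H.run_of_not_le (d := 0) hj hn (fun t h1 h2 => H.r_not_le_l h1 (by omega)) hv).2

end Setting

namespace Rival

/-- Otherwise a partner letter of `{l e, r e}` satisfying `l' e`, inserted before the letter of `r
e`, is skipped by the rival but can be neither matched nor skipped by the query. -/
theorem guard_le (H : Rival sat h n r l l' S) {e : ℕ} (h1 : 1 ≤ e) (hn : e ≤ n) :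
    l' e ≤ l e ∨ l' e ≤ r e := by
  by_contra! hne
  obtain ⟨A, hA, hs, hl, hr⟩ := H.split_l h1 hn hne.1 hne.2
  have h2 : Accepts sat n r l' 1 (conjWord h r 1 e ++ A :: conjWord h r e (n + 1)) :=
    H.accepts_prefix h1 (by omega) (.skip hs (H.accepts_conjWord (by omega)))
  rw [H.agree (by omega) (insertion_one h1 (by omega) hA)] at h2
  rcases (H.accepts_of_prefix h1 (by omega) h2).cases_cons hn with h | h
  · exact hr h.1
  · exact hl h.1

/-- The word has one letter more than there are pending conjuncts, so only one skip is possible. The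
inserted letter can be neither matched with `r i` nor skipped by `l' i`; hence the skip comes
earlier, and every later letter is matched one conjunct late. -/
theorem exists_skip (H : Rival sat h n r l l' S) {j i : ℕ} (h1 : 1 ≤ j) (hji : j ≤ i)
    (hn : i ≤ n) (hl : ¬ l i ≤ ⊥) (hl' : ¬ l i ≤ l' i)
    (hacc : Accepts sat n r l' j (conjWord h r j i ++ h (l i) :: conjWord h r i (n + 1))) :
    ∃ s, j ≤ s ∧ s < i ∧ r s ≤ l' s ∧ (∀ t, s ≤ t → t + 1 < i → r (t + 1) ≤ r t) ∧
      l i ≤ r (i - 1) := by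
  induction hji using Nat.decreasingInduction with
  | self =>
    rw [conjWord_self, List.nil_append] at hacc
    rcases hacc.cases_cons hn with h | h
    · exact absurd ((H.hat hl).1 h.1) (H.l_not_le_r h1 hn hl)
    · exact absurd ((H.hat hl).1 h.1) hl'
  | of_succ j hj ih =>
    rw [conjWord_cons h r hj, List.cons_append] at hacc
    rcases hacc.cases_cons (by omega) with ⟨-, h⟩ | ⟨hs, h⟩
    · obtain ⟨s, hs, h'⟩ := ih (by omega) h
      exact ⟨s, by omega, h'⟩
    · obtain ⟨k, rfl⟩ : ∃ k, i = k + 1 := ⟨i - 1, by omega⟩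
      obtain ⟨h2, h3⟩ := H.run_of_exact (d := 1) (by omega : j ≤ k) (by omega)
        (by rw [List.length_cons, length_conjWord]; omega) h
      refine ⟨j, le_rfl, hj, (H.sat_r (by omega)).1 hs, fun t ht htk => h2 t ht (by omega), ?_⟩
      exact (H.hat hl).1 (h3.hit_of_exact (by rw [length_conjWord]; omega)).1

/-- If the letter of `r s` can be skipped by `l' s`, then a descending chain of conjuncts from `s`
on can only be left upwards. -/
theorem le_of_chain (H : Rival sat h n r l l' S) {s t : ℕ} (h1 : 1 ≤ s) (hst : s ≤ t)
    (hn : t + 1 ≤ n) (hs : r s ≤ l' s) (hch : ∀ u, s ≤ u → u < t → r (u + 1) ≤ r u) :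
    r t ≤ l (t + 1) ∨ r t ≤ r (t + 1) := by
  by_contra! hne
  obtain ⟨A, hA, hsat, hl, hr⟩ := H.split_r (by omega) hn (by omega : t ≤ n) hne.1 hne.2
  have h2 : Accepts sat n r l' 1
      (conjWord h r 1 (t + 1) ++ A :: conjWord h r (t + 1) (n + 1)) := by
    rw [← conjWord_append h r h1 (by omega : s ≤ t + 1), conjWord_cons h r (by omega : s < t + 1),
      List.append_assoc, List.cons_append]
    -- The rival skips the letter of `r s`, matches each letter of `r (u + 1)` with `r u`, and then
    -- `A` with `r t`.
    refine H.accepts_prefix h1 (by omega) (.skip ((H.sat_r (by omega)).2 hs) ?_)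
    exact H.accepts_run (d := 1) hst (by omega) hch
      (.hit hsat (H.accepts_conjWord (by omega)))
  rw [H.agree (by omega) (insertion_one (by omega) (by omega) hA)] at h2
  rcases (H.accepts_of_prefix (by omega) (by omega) h2).cases_cons hn with h | h
  · exact hr h.1
  · exact hl h.1

/-- The other outcome of `le_of_chain`, `r t ≤ l (t + 1)`, would give `r (t + 1) ≤ l (t + 1)`
against peerlessness. -/
theorem le_succ_of_chain (H : Rival sat h n r l l' S) {s t : ℕ} (h1 : 1 ≤ s) (hst : s ≤ t)
    (hn : t + 1 ≤ n) (hs : r s ≤ l' s) (hch : ∀ u, s ≤ u → u < t + 1 → r (u + 1) ≤ r u) :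
    r t ≤ r (t + 1) := by
  rcases H.le_of_chain h1 hst hn hs fun u h2 h3 => hch u h2 (by omega) with h | h
  · exact absurd ((hch t hst (by omega)).trans h) (H.r_not_le_l (by omega) hn)
  · exact h

/-- In such a descending chain all conjuncts are equivalent. -/
theorem equiv_of_chain (H : Rival sat h n r l l' S) {s x : ℕ} (h1 : 1 ≤ s)
    (hn : x ≤ n) (hs : r s ≤ l' s) (hch : ∀ u, s ≤ u → u < x → r (u + 1) ≤ r u) {u v : ℕ}
    (hsu : s ≤ u) (hux : u ≤ x) (hsv : s ≤ v) (hvx : v ≤ x) : r u ≤ r v := by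
  have down : ∀ a b, s ≤ a → a ≤ b → b ≤ x → r b ≤ r a := by
    intro a b ha hab hb
    induction b, hab using Nat.le_induction with
    | base => exact le_rfl
    | succ b hab ih => exact (hch b (by omega) (by omega)).trans (ih (by omega))
  have up : ∀ a b, s ≤ a → a ≤ b → b ≤ x → r a ≤ r b := by
    intro a b ha hab hb
    induction b, hab using Nat.le_induction with
    | base => exact le_rfl
    | succ b hab ih =>
      exact (ih (by omega)).trans (H.le_succ_of_chain h1 (by omega) (by omega) hs
        fun u h2 h3 => hch u h2 (by omega))
  rcases le_total u v with h | h
  · exact up u v hsu h hvx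
  · exact down v u hsv h hux

end Rival

end Setting

/-! ### Guards that are lost by the rival end blocks of equivalent conjuncts -/

section Blocks

variable {α Λ : Type} [Preorder α] [OrderBot α]
variable {sat : Λ → α → Prop} {h : α → Λ} {n : ℕ} {r l l' : ℕ → α} {S : Set Λ}

/-- Here `d` is the number of letters by which the run already lags; applying this with `d = 0` and
then `d = 1` locates the first and the second skip. -/
theorem Setting.first_skip (H : Setting sat h n r l) {g : ℕ → α} {j k d : ℕ} {w : List Λ}
    (hjk : j ≤ k) (hk : k + d ≤ n + 1)
    (hacc : Accepts sat n r g j (conjWord h r (j + d) (k + d) ++ w)) :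
    Accepts sat n r g k w ∨
      ∃ x, j ≤ x ∧ x < k ∧ (∀ u, j ≤ u → u < x → r (u + d) ≤ r u) ∧ r (x + d) ≤ g x ∧
        Accepts sat n r g x (conjWord h r (x + d + 1) (k + d) ++ w) := by
  induction hjk using Nat.decreasingInduction with
  | self => exact .inl (by simpa [conjWord_self] using hacc)
  | of_succ j hj ih =>
    rw [conjWord_cons h r (by omega : j + d < k + d), List.cons_append] at hacc
    rcases hacc.cases_cons (by omega) with ⟨h1, h2⟩ | ⟨h1, h2⟩
    · rw [show j + d + 1 = j + 1 + d by omega] at h2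
      rcases ih h2 with h3 | ⟨x, hx1, hx2, hx3, hx4⟩
      · exact .inl h3
      · refine .inr ⟨x, by omega, hx2, fun u hu hux => ?_, hx4⟩
        rcases hu.eq_or_lt with rfl | hu
        · exact (H.sat_r (by omega)).1 h1
        · exact hx3 u hu hux
    · exact .inr ⟨j, le_rfl, hj, fun u _ _ => by omega, (H.sat_r (by omega)).1 h1, h2⟩

/-- The conjuncts `r s, …, r (i - 1)` and the guard `l i` are equivalent, there are no guards in
between, and `l' s` can take over the role of `l i`. -/
structure Block (r l l' : ℕ → α) (s i : ℕ) : Prop where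
  one_le : 1 ≤ s
  lt : s < i
  skip : r s ≤ l' s
  equiv {u v : ℕ} : s ≤ u → u < i → s ≤ v → v < i → r u ≤ r v
  guard_le : l i ≤ r s
  inner {t : ℕ} : s < t → t < i → l t ≤ ⊥

namespace Rival

theorem guard_le_of_skip (H : Rival sat h n r l l' S) {s : ℕ} (h1 : 1 ≤ s) (hn : s ≤ n)
    (hs : r s ≤ l' s) : l' s ≤ r s :=
  (H.guard_le h1 hn).resolve_left fun h' => H.r_not_le_l h1 hn (hs.trans h')

/-- Acceptance of the words that repeat `r p`, when `l' p` can skip `r p`. -/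
theorem accepts_repeat (H : Rival sat h n r l l' S) {p x k : ℕ} {v : List Λ} (h1 : 1 ≤ p)
    (hpx : p ≤ x) (hn : x ≤ n) (hp : r p ≤ l' p)
    (hch : ∀ u, p ≤ u → u < x → r (u + 1) ≤ r u) (hk : k ≤ 3)
    (hins : Insertion S (conjWord h r 1 (n + 1)) k
      (conjWord h r 1 p ++ h (r p) :: (conjWord h r p x ++ v)))
    (hv : Accepts sat n r l' x v) : Accepts sat n r l (x + 1) v := by
  have h2 : Accepts sat n r l' 1 (conjWord h r 1 p ++ h (r p) :: (conjWord h r p x ++ v)) :=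
    H.accepts_prefix h1 (by omega)
      (.skip ((H.sat_r (by omega)).2 hp) (H.accepts_prefix hpx (by omega) hv))
  rw [H.agree hk hins] at h2
  have h3 := H.accepts_of_prefix h1 (by omega) h2
  rcases h3.cases_cons (by omega) with h | h
  · refine (H.run_of_not_le (d := 1) hpx (by omega) (fun t ht htx hle => ?_) h.2).2
    exact H.r_not_le_l (by omega) (by omega) ((hch t ht htx).trans hle)
  · exact absurd ((H.sat_r (by omega)).1 h.1) (H.r_not_le_l h1 (by omega))

/-- This excludes the case of `exists_block` in which the rival skips at `p` and at `x` before
reaching the inserted letter of `l (s + 1)`. The two skips make `l x` a satisfiable guard with `l x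
≤ l' x`; words with up to three insertions propagate this property from `x` to `s`, where `l' s ≤ r
s` makes it impossible. -/
theorem not_two_skips (H : Rival sat h n r l l' S) {p x s : ℕ}
    (ih : ∀ i, 1 ≤ i → i ≤ s → ¬ l i ≤ ⊥ → ¬ l i ≤ l' i → ∃ s', Block r l l' s' i)
    (h1 : 1 ≤ p) (hpx : p ≤ x) (hxs : x + 1 ≤ s) (hn : s < n) (hp : r p ≤ l' p)
    (hch : ∀ u, p ≤ u → u < x → r (u + 1) ≤ r u) (hx : r (x + 1) ≤ l' x)
    (hx2 : ∀ k, x ≤ k → k + 2 ≤ s → r (k + 2) ≤ r k) (hs : r s ≤ l' s)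
    (hls : l (s + 1) ≤ r (s - 1)) (hls' : ¬ l (s + 1) ≤ r s) : False := by
  -- Otherwise the descending chain from `p` extends to `s`, its members are equivalent, and `l (s +
  -- 1) ≤ r (s - 1)` yields `l (s + 1) ≤ r s`.
  have hnr : ¬ r (x + 1) ≤ r x := by
    intro hle
    have key : ∀ k, x ≤ k → k + 1 ≤ s → ∀ u, p ≤ u → u < k + 1 → r (u + 1) ≤ r u := by
      intro k hk
      induction k, hk using Nat.le_induction with
      | base =>
        intro _ u hu hux
        rcases Nat.lt_succ_iff_lt_or_eq.1 hux with h | rfl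
        · exact hch u hu h
        · exact hle
      | succ k hk ihk =>
        intro hks u hu huk
        rcases Nat.lt_succ_iff_lt_or_eq.1 huk with h | rfl
        · exact ihk (by omega) u hu h
        · exact (hx2 k hk hks).trans (H.equiv_of_chain h1 (by omega : k + 1 ≤ n) hp
            (ihk (by omega)) (by omega) (by omega) (by omega) le_rfl)
    obtain ⟨k, rfl⟩ : ∃ k, s = k + 1 := ⟨s - 1, by omega⟩
    refine hls' (hls.trans (H.equiv_of_chain h1 (by omega : k + 1 ≤ n) hp
      (key k (by omega) le_rfl) ?_ ?_ ?_ ?_)) <;> omega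
  have hlx : l' x ≤ l x := (H.guard_le (by omega) (by omega)).resolve_right
    fun h' => hnr (hx.trans h')
  have hpx' : p < x := by
    rcases hpx.eq_or_lt with rfl | h'
    · exact absurd (hp.trans hlx) (H.r_not_le_l h1 (by omega))
    · exact h'
  have hrm : r (x + 1) ≤ l x := hx.trans hlx
  have hm : ¬ l x ≤ ⊥ := fun h' => H.r_sat (by omega) (hrm.trans h')
  have hmr : ¬ l x ≤ r x := H.l_not_le_r (by omega) (by omega) hm
  -- A block ending at `x` would put `l x` below the chain of equivalent conjuncts and so below `r
  -- x`.
  have hm' : l x ≤ l' x := by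
    by_contra hne
    obtain ⟨s', hB⟩ := ih x (by omega) (by omega) hm hne
    have h2 := hB.lt
    refine hmr (hB.guard_le.trans ((hB.equiv le_rfl hB.lt (by omega : s' ≤ x - 1)
      (by omega)).trans (H.equiv_of_chain h1 (by omega : x ≤ n) hp hch ?_ ?_ ?_ ?_))) <;> omega
  have hmS := H.l_mem (by omega : 1 ≤ x) (by omega) hm
  have hpS := H.r_mem (by omega : p ≤ n)
  have rep := fun {k v} => H.accepts_repeat (k := k) (v := v) h1 hpx (by omega) hp hch
  -- After one repetition of `r p` the query meets the letter of `r x` in state `x + 1`; matching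
  -- would give `r x ≤ r (x + 1) ≤ l x`, so `l (x + 1)` has to skip it.
  have hl1 : ¬ l (x + 1) ≤ ⊥ := by
    have h2 : Accepts sat n r l (x + 1) (conjWord h r x (n + 1)) := by
      refine rep (k := 1) (by omega) ?_ (H.accepts_conjWord (by omega))
      rw [conjWord_append h r hpx (by omega)]
      exact insertion_one h1 (by omega) hpS
    rw [conjWord_cons h r (by omega : x < n + 1)] at h2
    rcases h2.cases_cons (by omega) with ⟨h3, -⟩ | ⟨h3, -⟩ <;>
      rw [H.sat_r (by omega)] at h3
    · exact absurd (h3.trans hrm) (H.r_not_le_l (by omega) (by omega))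
    · exact fun h' => H.r_sat (by omega : x ≤ n) (h3.trans h')
  have hml1 : ¬ l x ≤ l (x + 1) := fun h' =>
    H.r_not_le_l (by omega : 1 ≤ x + 1) (by omega) (hrm.trans h')
  -- If this failed, a block would end at `b + 1`. Starting at `b` it forces `l b ≤ l' b ≤ r b`;
  -- starting earlier it forces `l b ≤ ⊥`.
  have hstep : ∀ b, x ≤ b → b + 1 ≤ s → ¬ l b ≤ ⊥ → l b ≤ l' b → ¬ l (b + 1) ≤ ⊥ →
      l (b + 1) ≤ l' (b + 1) := by
    intro b hb hbs hlb hlb' hlb1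
    by_contra hne
    obtain ⟨s', hB⟩ := ih (b + 1) (by omega) hbs hlb1 hne
    rcases (Nat.lt_succ_iff.1 hB.lt).eq_or_lt with rfl | h'
    · exact H.l_not_le_r hB.one_le (by omega) hlb
        (hlb'.trans (H.guard_le_of_skip hB.one_le (by omega) hB.skip))
    · exact hlb (hB.inner h' (by omega))
  have hend : ¬ (¬ l s ≤ ⊥ ∧ l s ≤ l' s) := fun ⟨h2, h3⟩ =>
    H.l_not_le_r (by omega) (by omega) h2
      (h3.trans (H.guard_le_of_skip (by omega) (by omega) hs))
  have hx1' := hstep x le_rfl hxs hm hm' hl1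
  have hx2s : x + 2 ≤ s := by
    rcases hxs.eq_or_lt with rfl | h'
    · exact absurd ⟨hl1, hx1'⟩ hend
    · exact h'
  -- Of two inserted copies of the letter of `l x`, the first must be matched with `r (x + 1)`, and
  -- only `l (x + 2)` can take the second.
  have hl2 : ¬ l (x + 2) ≤ ⊥ := by
    have h2 : Accepts sat n r l (x + 1) (h (l x) :: h (l x) :: conjWord h r x (n + 1)) := by
      refine rep (k := 3) (by omega) ?_ ?_
      · have := insertion_three (h := h) (r := r) h1 hpx le_rfl (by omega : x ≤ n + 1) hpS hmS hmS
        rwa [conjWord_self, List.nil_append] at this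
      · exact .skip ((H.hat hm).2 hm') (.skip ((H.hat hm).2 hm') (H.accepts_conjWord (by omega)))
    rcases h2.cases_cons (by omega) with ⟨-, h3⟩ | ⟨h3, -⟩
    · rcases h3.cases_cons (by omega) with ⟨h3, -⟩ | ⟨h3, -⟩ <;> rw [H.hat hm] at h3
      · exact absurd (h3.trans (hx2 x le_rfl hx2s)) hmr
      · exact fun h' => hm (h3.trans h')
    · exact absurd ((H.hat hm).1 h3) hml1
  -- Inserting the letters of `r p`, `l x` and `l b` makes the query run two conjuncts ahead, so the
  -- letter of `l b` meets state `b + 2`; matching it would give `l b ≤ r (b + 2) ≤ r b`, so it is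
  -- skipped by `l (b + 2)`.
  have hall : ∀ b, x + 1 ≤ b → b + 1 ≤ s →
      (¬ l b ≤ ⊥ ∧ l b ≤ l' b) ∧ ¬ l (b + 1) ≤ ⊥ ∧ l (b + 1) ≤ l' (b + 1) := by
    intro b hb
    induction b, hb using Nat.le_induction with
    | base => exact fun _ => ⟨⟨hl1, hx1'⟩, hl2, hstep (x + 1) (by omega) hx2s hl1 hx1' hl2⟩
    | succ b hb ihb =>
      intro hbs
      obtain ⟨⟨h2, h3⟩, h4, h5⟩ := ihb (by omega)
      have h6 : ¬ l (b + 2) ≤ ⊥ := by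
        have h7 : Accepts sat n r l (x + 1)
            (h (l x) :: (conjWord h r x b ++ h (l b) :: conjWord h r b (n + 1))) := by
          refine rep (k := 3) (by omega) ?_ ?_
          · exact insertion_three h1 hpx (by omega) (by omega) hpS hmS
              (H.l_mem (by omega) (by omega) h2)
          · exact .skip ((H.hat hm).2 hm') (H.accepts_prefix (by omega) (by omega)
              (.skip ((H.hat h2).2 h3) (H.accepts_conjWord (by omega))))
        rcases h7.cases_cons (by omega) with ⟨-, h8⟩ | ⟨h8, -⟩
        · have h9 := (H.run_of_not_le (d := 2) (by omega : x ≤ b) (by omega)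
            (fun t ht htb hle => H.r_not_le_l (by omega : 1 ≤ t + 2) (by omega)
              ((hx2 t ht (by omega)).trans hle)) h8).2
          rcases h9.cases_cons (by omega) with ⟨h10, -⟩ | ⟨h10, -⟩ <;> rw [H.hat h2] at h10
          · exact absurd (h10.trans (hx2 b (by omega) (by omega)))
              (H.l_not_le_r (by omega) (by omega) h2)
          · exact fun h' => h2 (h10.trans h')
        · exact absurd ((H.hat hm).1 h8) hml1
      exact ⟨⟨h4, h5⟩, h6, hstep (b + 1) (by omega) hbs h4 h5 h6⟩
  obtain ⟨k, rfl⟩ : ∃ k, s = k + 1 := ⟨s - 1, by omega⟩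
  exact hend (hall k (by omega) le_rfl).2

/-- A guard `l i` that is not below `l' i` ends a block. -/
theorem exists_block (H : Rival sat h n r l l' S) (i : ℕ) (h1 : 1 ≤ i) (hn : i ≤ n)
    (hl : ¬ l i ≤ ⊥) (hl' : ¬ l i ≤ l' i) : ∃ s, Block r l l' s i := by
  induction i using Nat.strong_induction_on with
  | _ i ih =>
  have hliS := H.l_mem h1 hn hl
  let P : ℕ → Prop := fun s => 1 ≤ s ∧ s < i ∧ r s ≤ l' s ∧
    (∀ t, s ≤ t → t + 1 < i → r (t + 1) ≤ r t) ∧ l i ≤ r (i - 1)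
  -- The last possible start is taken, so that any skip found later contradicts maximality.
  obtain ⟨s, hP, hmax⟩ : ∃ s, P s ∧ ∀ s', s < s' → ¬ P s' := by
    have h2 : Accepts sat n r l 1 (conjWord h r 1 i ++ h (l i) :: conjWord h r i (n + 1)) :=
      H.accepts_prefix h1 (by omega) (.skip ((H.hat hl).2 le_rfl) (H.accepts_conjWord (by omega)))
    rw [← H.agree (by omega) (insertion_one h1 (by omega) hliS)] at h2
    obtain ⟨s0, hs0⟩ := H.exists_skip le_rfl h1 hn hl hl' h2
    classical
    refine ⟨Nat.findGreatest P i, Nat.findGreatest_spec (m := s0) (by omega) hs0,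
      fun s' hs' hP' => ?_⟩
    exact absurd (Nat.le_findGreatest hP'.2.1.le hP') (by omega)
  obtain ⟨hs1, hsi, hs, hch, hli⟩ := hP
  have heq : ∀ {u v : ℕ}, s ≤ u → u < i → s ≤ v → v < i → r u ≤ r v := fun h2 h3 h4 h5 =>
    H.equiv_of_chain hs1 (by omega : i - 1 ≤ n) hs (fun u h6 h7 => hch u h6 (by omega)) h2
      (by omega) h4 (by omega)
  refine ⟨s, hs1, hsi, hs, heq, hli.trans (heq (by omega) (by omega) le_rfl hsi), ?_⟩
  by_contra hinner
  have hinner : ∃ t, s < t ∧ t < i ∧ ¬ l t ≤ ⊥ := by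
    push Not at hinner
    exact hinner
  classical
  obtain ⟨t, ⟨hst, hti, hlt⟩, hmin⟩ :
      ∃ t, (s < t ∧ t < i ∧ ¬ l t ≤ ⊥) ∧ ∀ t' < t, ¬ (s < t' ∧ t' < i ∧ ¬ l t' ≤ ⊥) :=
    ⟨Nat.find hinner, Nat.find_spec hinner, fun _ => Nat.find_min hinner⟩
  have hltr : ∀ u, s ≤ u → u < i → ¬ l t ≤ r u := fun u h2 h3 h4 =>
    H.l_not_le_r (by omega) (by omega) hlt (h4.trans (heq h2 h3 (by omega) hti))
  have hltS := H.l_mem (by omega : 1 ≤ t) (by omega) hlt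
  obtain ⟨k, rfl⟩ : ∃ k, t = k + 1 := ⟨t - 1, by omega⟩
  -- With both guard letters inserted, the word leaves room for two skips. The cases below count the
  -- rival's skips before the letter of `l t`, where `t = k + 1`: none, one or two.
  have hacc : Accepts sat n r l 1 (conjWord h r 1 (k + 1) ++ h (l (k + 1)) ::
      (conjWord h r (k + 1) i ++ h (l i) :: conjWord h r i (n + 1))) :=
    H.accepts_prefix (by omega) (by omega) (.skip ((H.hat hlt).2 le_rfl)
      (H.accepts_prefix hti.le (by omega)
        (.skip ((H.hat hl).2 le_rfl) (H.accepts_conjWord (by omega)))))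
  rw [← H.agree (by omega) (insertion_two (by omega) hti.le (by omega) hltS hliS)] at hacc
  rcases H.first_skip (d := 0) (by omega) (by omega) hacc with hacc | ⟨p, hp1, hpt, -, hp, hacc⟩
  · rcases hacc.cases_cons (by omega) with ⟨h2, -⟩ | ⟨-, h2⟩
    · exact hltr _ (by omega) hti ((H.hat hlt).1 h2)
    · obtain ⟨s', h3, h4, h5⟩ := H.exists_skip (by omega) hti.le hn hl hl' h2
      exact hmax s' (by omega) ⟨by omega, h4, h5⟩
  · rcases H.first_skip (d := 1) (by omega : p ≤ k) (by omega) hacc with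
      hacc | ⟨x, hpx, hxk, hchp, hx, hacc⟩
    · rcases hacc.cases_cons (by omega) with ⟨h2, -⟩ | ⟨h2, -⟩ <;> rw [H.hat hlt] at h2
      · exact hltr k (by omega) (by omega) h2
      · rcases Nat.lt_or_ge s k with hsk | hsk
        · rcases H.guard_le (by omega : 1 ≤ k) (by omega) with h3 | h3
          · exact hmin k (by omega) ⟨hsk, by omega, fun h4 => hlt ((h2.trans h3).trans h4)⟩
          · exact hltr k (by omega) (by omega) (h2.trans h3)
        · obtain rfl : k = s := by omega
          exact hltr k le_rfl hsi (h2.trans (H.guard_le_of_skip hs1 (by omega) hs))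
    · obtain ⟨k', rfl⟩ : ∃ k', k = k' + 1 := ⟨k - 1, by omega⟩
      obtain ⟨h2, h3⟩ := H.run_of_exact (d := 2) (by omega : x ≤ k') (by omega)
        (by simp only [List.length_cons, List.length_append, length_conjWord]; omega) hacc
      have h4 := (H.hat hlt).1 (h3.hit_of_exact
        (by simp only [List.length_cons, List.length_append, length_conjWord]; omega)).1
      -- After two skips the letter of `l t` is matched with `r (t - 2)`, which must therefore lie
      -- outside the block. This leaves only `t = s + 1`, the situation of `not_two_skips`.
      have hks : k' < s := by
        by_contra hks
        exact hltr k' (by omega) (by omega) h4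
      obtain rfl : s = k' + 1 := by omega
      refine H.not_two_skips (p := p) (x := x) (s := k' + 1)
        (fun i' h5 h6 h7 h8 => ih i' (by omega) h5 (by omega) h7 h8) hp1 hpx (by omega) (by omega)
        hp hchp hx (fun u hu hus => h2 u hu (by omega)) hs h4 (hltr _ le_rfl (by omega))

end Rival

end Blocks

/-! ### From words to timelines -/

section Timeline

variable {α Λ : Type}

/-- Truth of `l j U (r j ∧ (l (j + 1) U …))` on a timeline, with a non-strict until. -/
inductive Wait (T : ℕ → α → Prop) (n : ℕ) (r l : ℕ → α) : ℕ → ℕ → Prop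
  | done {j x : ℕ} : n < j → Wait T n r l j x
  | hit {j x : ℕ} : T x (r j) → Wait T n r l (j + 1) (x + 1) → Wait T n r l j x
  | skip {j x : ℕ} : T x (l j) → Wait T n r l j (x + 1) → Wait T n r l j x

/-- From time `x` on, the timeline satisfies what the letters of the word satisfy. -/
def Matches (sat : Λ → α → Prop) (T : ℕ → α → Prop) : ℕ → List Λ → Prop
  | _, [] => True
  | x, c :: w => (∀ z, sat c z → T x z) ∧ Matches sat T (x + 1) w

/-- From time `x` on, the letters of the word satisfy what the timeline satisfies. -/
def MatchedBy (sat : Λ → α → Prop) (T : ℕ → α → Prop) : ℕ → List Λ → Prop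
  | _, [] => True
  | x, c :: w => (∀ z, T x z → sat c z) ∧ MatchedBy sat T (x + 1) w

variable {sat : Λ → α → Prop} {T : ℕ → α → Prop} {n : ℕ} {r l : ℕ → α}

theorem Accepts.wait {j x : ℕ} {w : List Λ} (H : Accepts sat n r l j w) (hw : Matches sat T x w) :
    Wait T n r l j x := by
  induction H generalizing x with
  | done h => exact .done h
  | hit h1 _ ih => exact .hit (hw.1 _ h1) (ih hw.2)
  | skip h1 _ ih => exact .skip (hw.1 _ h1) (ih hw.2)

theorem Wait.exists_conj {j x i : ℕ} (H : Wait T n r l j x) (hj : j ≤ i) (hi : i ≤ n) :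
    ∃ y, x ≤ y ∧ T y (r i) := by
  induction H with
  | done h => omega
  | @hit j x h1 _ ih =>
    rcases hj.eq_or_lt with rfl | hj
    · exact ⟨x, le_rfl, h1⟩
    · obtain ⟨y, h2, h3⟩ := ih hj
      exact ⟨y, by omega, h3⟩
  | skip h1 _ ih =>
    obtain ⟨y, h2, h3⟩ := ih hj
    exact ⟨y, by omega, h3⟩

/-- A run leaving the word with conjuncts pending would still have to find `r n` after its end. -/
theorem Wait.accepts {j x : ℕ} {w : List Λ} (H : Wait T n r l j x) (hw : MatchedBy sat T x w)
    (hend : ∀ y, x + w.length ≤ y → ¬ T y (r n)) : Accepts sat n r l j w := by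
  induction H generalizing w with
  | done h => exact .done h
  | @hit j x h1 h2 ih =>
    cases w with
    | nil =>
      by_contra hne
      obtain ⟨y, h3, h4⟩ := (Wait.hit h1 h2).exists_conj (i := n) (by
        by_contra h'; exact hne (.done (by omega))) le_rfl
      exact hend y (by simpa using h3) h4
    | cons c w =>
      exact .hit (hw.1 _ h1) (ih hw.2 fun y hy => hend y (by simp only [List.length_cons]; omega))
  | @skip j x h1 h2 ih =>
    cases w with
    | nil =>
      by_contra hne
      obtain ⟨y, h3, h4⟩ := (Wait.skip h1 h2).exists_conj (i := n) (by
        by_contra h'; exact hne (.done (by omega))) le_rfl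
      exact hend y (by simpa using h3) h4
    | cons c w =>
      exact .skip (hw.1 _ h1) (ih hw.2 fun y hy => hend y (by simp only [List.length_cons]; omega))

/-- The timeline of a word. -/
def wordTimeline (sat : Λ → α → Prop) : List Λ → ℕ → α → Prop
  | [], _, _ => False
  | c :: _, 0, z => sat c z
  | _ :: w, x + 1, z => wordTimeline sat w x z

theorem matches_shift {x : ℕ} {w : List Λ} (h : Matches sat (fun y => T (y + 1)) x w) :
    Matches sat T (x + 1) w := by
  induction w generalizing x with
  | nil => trivial
  | cons c w ih => exact ⟨h.1, ih h.2⟩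

theorem matchedBy_shift {x : ℕ} {w : List Λ} (h : MatchedBy sat (fun y => T (y + 1)) x w) :
    MatchedBy sat T (x + 1) w := by
  induction w generalizing x with
  | nil => trivial
  | cons c w ih => exact ⟨h.1, ih h.2⟩

theorem matches_wordTimeline (w : List Λ) : Matches sat (wordTimeline sat w) 0 w := by
  induction w with
  | nil => trivial
  | cons c w ih => exact ⟨fun z h => h, matches_shift (T := wordTimeline sat (c :: w)) ih⟩

theorem matchedBy_wordTimeline (w : List Λ) : MatchedBy sat (wordTimeline sat w) 0 w := by
  induction w with
  | nil => trivial
  | cons c w ih => exact ⟨fun z h => h, matchedBy_shift (T := wordTimeline sat (c :: w)) ih⟩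

theorem wordTimeline_of_length_le {w : List Λ} {y : ℕ} (hy : w.length ≤ y) (z : α) :
    ¬ wordTimeline sat w y z := by
  induction w generalizing y with
  | nil => exact fun h => h
  | cons c w ih =>
    obtain ⟨y, rfl⟩ : ∃ y', y = y' + 1 := ⟨y - 1, by simp at hy; omega⟩
    exact ih (by simpa using hy)

theorem wait_wordTimeline_iff {j : ℕ} {w : List Λ} :
    Wait (wordTimeline sat w) n r l j 0 ↔ Accepts sat n r l j w :=
  ⟨fun H => H.accepts (matchedBy_wordTimeline w)
    fun _ hy => wordTimeline_of_length_le (by simpa using hy) _,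
    fun H => H.wait (matches_wordTimeline w)⟩

theorem Wait.of_run {s d y : ℕ} (h : ∀ u, u < d → T (y + u) (r (s + u)))
    (H : Wait T n r l (s + d) (y + d)) : Wait T n r l s y := by
  induction d with
  | zero => exact H
  | succ d ih => exact ih (fun u hu => h u (by omega)) (.hit (h d (by omega)) H)

end Timeline

/-! ### Transferring truth between the two sequences of guards -/

section Order

variable {α Λ : Type} [Preorder α]
variable {sat : Λ → α → Prop} {h : α → Λ} {T : ℕ → α → Prop} {n : ℕ} {r l l' g : ℕ → α} {S : Set Λ}

/-- In the block from `s` to `i`, the guard `l' s` takes over the role of the guard `g i`. -/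
structure Shift (n : ℕ) (r g l' : ℕ → α) (s i : ℕ) : Prop where
  one_le : 1 ≤ s
  lt : s < i
  le : i ≤ n
  skip : r s ≤ l' s
  equiv {u v : ℕ} : s ≤ u → u < i → s ≤ v → v < i → r u ≤ r v
  guard_le : g i ≤ r s
  not_le : ¬ g i ≤ l' i
  inner_r {t : ℕ} : s < t → t < i → g t ≤ r s
  inner_l {t : ℕ} : s < t → t < i → g t ≤ l' t

/-- The run with guards `g` is simulated with a lag. Outside blocks both runs are in the same state.
Inside a block from `s` to `i`, the `g`-run in state `j` at time `x` corresponds to the `l'`-run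
waiting in state `s` at time `y = x - (j - s)`, with `r s` true throughout the window from `y` to
`x`. A skip of the `g`-run moves the window on, with `l' s` skipping time `y`; when `r i` is found,
the window is matched with `r s, …, r (i - 1)`. -/
theorem wait_of_shifts (hT : ∀ {x z z'}, T x z → z ≤ z' → T x z')
    (hg : ∀ j, 1 ≤ j → j ≤ n → g j ≤ l' j ∨ ∃ s, Shift n r g l' s j) {j x : ℕ}
    (H : Wait T n r g j x) (hj : 1 ≤ j) :
    ((∀ s i, Shift n r g l' s i → s < j → ¬ j ≤ i) → Wait T n r l' j x) ∧
    ∀ s i, Shift n r g l' s i → s < j → j ≤ i → ∀ y, y + (j - s) = x →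
      (∀ z, y ≤ z → z < x → T z (r s)) → Wait T n r l' s y := by
  induction H with
  | done h => exact ⟨fun _ => .done h, fun s i hB _ h2 => absurd hB.le (by omega)⟩
  | @hit j x hr _ ih =>
    obtain ⟨ih1, ih2⟩ := ih (by omega)
    have key : (∀ s i, Shift n r g l' s i → s < j → ¬ j < i) → Wait T n r l' j x := by
      intro hj'
      by_cases hB : ∃ i, Shift n r g l' j i
      · obtain ⟨i, hB⟩ := hB
        refine ih2 j i hB (by omega) hB.lt x (by omega) fun z h1 h2 => ?_
        obtain rfl : z = x := by omega
        exact hr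
      · refine .hit hr (ih1 fun s i hB' h1 h2 => ?_)
        rcases (Nat.lt_succ_iff.1 h1).eq_or_lt with rfl | h1
        · exact hB ⟨i, hB'⟩
        · exact hj' s i hB' h1 h2
    refine ⟨fun hj' => key fun s i hB h1 h2 => hj' s i hB h1 h2.le, ?_⟩
    intro s i hB h1 h2 y hy hz
    rcases h2.eq_or_lt with rfl | h2
    -- The end of a block is never strictly inside another block, as this would give `g i ≤ l' i`.
    · have hw : Wait T n r l' j x := key fun s' i' hB' h3 h4 => hB.not_le (hB'.inner_l h3 h4)
      refine Wait.of_run (d := j - s) (fun u hu => ?_) ?_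
      · exact hT (hz _ (by omega) (by omega))
          (hB.equiv le_rfl hB.lt (by omega) (by omega))
      · rwa [hy, show s + (j - s) = j by omega]
    · refine ih2 s i hB (by omega) h2 y (by omega) fun z h3 h4 => ?_
      rcases (Nat.lt_succ_iff.1 h4).eq_or_lt with rfl | h4
      · exact hT hr (hB.equiv h1.le h2 le_rfl hB.lt)
      · exact hz z h3 h4
  | @skip j x hg' hw ih =>
    obtain ⟨ih1, ih2⟩ := ih hj
    constructor
    · intro hj'
      by_cases hjn : j ≤ n
      · rcases hg j hj hjn with h1 | ⟨s, hB⟩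
        · exact .skip (hT hg' h1) (ih1 hj')
        · exact absurd le_rfl (hj' s j hB hB.lt)
      · exact .done (by omega)
    · intro s i hB h1 h2 y hy hz
      have hx : T x (r s) := by
        rcases h2.eq_or_lt with rfl | h2
        · exact hT hg' hB.guard_le
        · exact hT hg' (hB.inner_r h1 h2)
      refine .skip (hT (hz y le_rfl (by omega)) hB.skip)
        (ih2 s i hB h1 h2 (y + 1) (by omega) fun z h3 h4 => ?_)
      rcases (Nat.lt_succ_iff.1 h4).eq_or_lt with rfl | h4
      · exact hx
      · exact hz z (by omega) h4

theorem wait_of_guards (hT : ∀ {x z z'}, T x z → z ≤ z' → T x z')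
    (hg : ∀ j, 1 ≤ j → j ≤ n → l' j ≤ l j ∨ (l' j ≤ r j ∧ ∀ x, T x (l' j) → T (x + 1) (r j) →
      Wait T n r l (j + 1) (x + 2) → Wait T n r l (j + 1) (x + 1))) {j x : ℕ}
    (H : Wait T n r l' j x) (hj : 1 ≤ j) :
    Wait T n r l j x ∧
      (¬ l' j ≤ l j → j ≤ n → T x (r j) ∧ Wait T n r l (j + 1) (x + 1)) := by
  induction H with
  | done h => exact ⟨.done h, fun _ h' => by omega⟩
  | hit hr _ ih => exact ⟨.hit hr (ih (by omega)).1, fun _ _ => ⟨hr, (ih (by omega)).1⟩⟩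
  | @skip j x hl' _ ih =>
    obtain ⟨ih1, ih2⟩ := ih hj
    by_cases hjn : j ≤ n
    · rcases hg j hj hjn with h1 | ⟨h1, h2⟩
      · exact ⟨.skip (hT hl' h1) ih1, fun h' => absurd h1 h'⟩
      · by_cases h3 : l' j ≤ l j
        · exact ⟨.skip (hT hl' h3) ih1, fun h' => absurd h3 h'⟩
        · have h4 : T x (r j) ∧ Wait T n r l (j + 1) (x + 1) :=
            ⟨hT hl' h1, h2 x hl' (ih2 h3 hjn).1 (ih2 h3 hjn).2⟩
          exact ⟨.hit h4.1 h4.2, fun _ _ => h4⟩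
    · exact ⟨.done (by omega), fun _ h' => absurd h' hjn⟩

variable [OrderBot α]

/-- Words of canonical letters of the shape `l j ^ * r j l (j + 1) ^ * r (j + 1) … r n`. -/
inductive GuardedWord (h : α → Λ) (n : ℕ) (r l : ℕ → α) : ℕ → List Λ → Prop
  | done : GuardedWord h n r l (n + 1) []
  | hit {j : ℕ} {w : List Λ} :
      GuardedWord h n r l (j + 1) w → GuardedWord h n r l j (h (r j) :: w)
  | skip {j : ℕ} {w : List Λ} :
      j ≤ n → ¬ l j ≤ ⊥ → GuardedWord h n r l j w → GuardedWord h n r l j (h (l j) :: w)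

theorem GuardedWord.le {j : ℕ} {w : List Λ} (H : GuardedWord h n r l j w) : j ≤ n + 1 := by
  induction H with
  | done => exact le_rfl
  | hit _ ih => omega
  | skip _ _ _ ih => exact ih

theorem GuardedWord.letters {j : ℕ} {w : List Λ} (H : GuardedWord h n r l j w) :
    ∀ c ∈ w, (∃ i, j ≤ i ∧ i ≤ n ∧ c = h (r i)) ∨
      ∃ i, j ≤ i ∧ i ≤ n ∧ ¬ l i ≤ ⊥ ∧ c = h (l i) := by
  induction H with
  | done => simp
  | @hit j w hw ih =>
    intro c hc
    rcases List.mem_cons.1 hc with rfl | hc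
    · exact .inl ⟨j, le_rfl, by have := hw.le; omega, rfl⟩
    · rcases ih c hc with ⟨i, h1, h2⟩ | ⟨i, h1, h2⟩
      · exact .inl ⟨i, by omega, h2⟩
      · exact .inr ⟨i, by omega, h2⟩
  | @skip j w hj hl _ ih =>
    intro c hc
    rcases List.mem_cons.1 hc with rfl | hc
    · exact .inr ⟨j, le_rfl, hj, hl, rfl⟩
    · exact ih c hc

theorem Setting.accepts_of_guardedWord (H : Setting sat h n r l) {j : ℕ} {w : List Λ}
    (hw : GuardedWord h n r l j w) (hg : ∀ i, j ≤ i → i ≤ n → l i ≤ g i) :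
    Accepts sat n r g j w := by
  induction hw with
  | done => exact .done (Nat.lt_succ_self n)
  | hit hw ih =>
    have := hw.le
    exact .hit ((H.sat_r (by omega)).2 le_rfl) (ih fun i hi => hg i (by omega))
  | skip hj hl _ ih => exact .skip ((H.hat hl).2 (hg _ le_rfl hj)) (ih hg)

/-- Every run leaves a trace of canonical letters that the timeline satisfies, so acceptance of
guarded words transfers to arbitrary timelines. Since `⊥` is never true, a guard used for skipping
does have a canonical letter. -/
theorem Setting.exists_guardedWord (H : Setting sat h n r l)
    (hT : ∀ {x z z'}, T x z → z ≤ z' → T x z') (hbot : ∀ x, ¬ T x ⊥) {j x : ℕ}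
    (hw : Wait T n r l j x) (hj : j ≤ n + 1) :
    ∃ w, GuardedWord h n r l j w ∧ Matches sat T x w := by
  induction hw with
  | done h =>
    obtain rfl := le_antisymm hj h
    exact ⟨[], .done, trivial⟩
  | @hit j x hr _ ih =>
    rcases hj.eq_or_lt with rfl | hj
    · exact ⟨[], .done, trivial⟩
    · obtain ⟨w, h1, h2⟩ := ih hj
      exact ⟨_, .hit h1, fun z hz => hT hr ((H.sat_r (by omega)).1 hz), h2⟩
  | @skip j x hl _ ih =>
    rcases hj.eq_or_lt with rfl | hj'
    · exact ⟨[], .done, trivial⟩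
    · obtain ⟨w, h1, h2⟩ := ih hj
      have hne : ¬ l j ≤ ⊥ := fun h' => hbot x (hT hl h')
      exact ⟨_, .skip (by omega) hne h1, fun z hz => hT hl ((H.hat hne).1 hz), h2⟩

theorem GuardedWord.exists_replicate {j : ℕ} {w : List Λ} (H : GuardedWord h n r l j w)
    (hj : j ≤ n) : ∃ k w', w = List.replicate k (h (l j)) ++ h (r j) :: w' ∧
      GuardedWord h n r l (j + 1) w' ∧ (k = 0 ∨ ¬ l j ≤ ⊥) := by
  induction H with
  | done => omega
  | hit hw _ => exact ⟨0, _, rfl, hw, .inl rfl⟩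
  | skip _ hl _ ih =>
    obtain ⟨k, w', rfl, h2, -⟩ := ih hj
    exact ⟨k + 1, w', by rw [List.replicate_succ, List.cons_append], h2, .inr hl⟩

theorem GuardedWord.of_replicate {j k : ℕ} {w : List Λ} (hj : j ≤ n) (hk : k = 0 ∨ ¬ l j ≤ ⊥)
    (H : GuardedWord h n r l (j + 1) w) :
    GuardedWord h n r l j (List.replicate k (h (l j)) ++ h (r j) :: w) := by
  induction k with
  | zero => exact .hit H
  | succ k ih =>
    rw [List.replicate_succ, List.cons_append]
    have hl := hk.resolve_left (by omega)
    exact .skip hj hl (ih (.inr hl))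

/-- Long repetitions of guards can be shortened without making the word easier to reject. -/
theorem GuardedWord.exists_short {j : ℕ} {w : List Λ} (H : GuardedWord h n r l j w) :
    ∃ w', GuardedWord h n r l j w' ∧ w'.length ≤ (n + 2) * (n + 1 - j) ∧
      ∀ i, Accepts sat n r l i w' → Accepts sat n r l i w := by
  obtain ⟨d, hd⟩ : ∃ d, d = n + 1 - j := ⟨_, rfl⟩
  induction d generalizing j w with
  | zero =>
    obtain rfl : j = n + 1 := by have := H.le; omega
    refine ⟨[], .done, by simp, fun i hi => ?_⟩
    have := hi.length_le
    exact .done (by simpa using this)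
  | succ d ih =>
    obtain ⟨k, w1, rfl, h1, hk⟩ := H.exists_replicate (by omega)
    obtain ⟨w2, h2, h3, h4⟩ := ih h1 (by omega)
    -- At most `n + 1` conjuncts are pending in any state `i`, so acceptance after `n + 1` copies
    -- persists under further copies.
    refine ⟨_, .of_replicate (k := min k (n + 1)) (by omega) ?_ h2, ?_, fun i hi => ?_⟩
    · rcases hk with rfl | hk
      · exact .inl (by simp)
      · exact .inr hk
    · rw [List.length_append, List.length_replicate, List.length_cons, ← hd, Nat.mul_succ]
      rw [show n + 1 - (j + 1) = d by omega] at h3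
      have := min_le_right k (n + 1)
      omega
    · have h5 : Accepts sat n r l i (List.replicate (min k (n + 1)) (h (l j)) ++ h (r j) :: w1) := by
        refine Accepts.append_congr (fun i' hi' => ?_) hi
        cases hi' with
        | done h => exact .done h
        | hit h6 h7 => exact .hit h6 (h4 _ h7)
        | skip h6 h7 => exact .skip h6 (h4 _ h7)
      rcases le_total k (n + 1) with h6 | h6
      · rwa [min_eq_left h6] at h5
      · rw [min_eq_right h6] at h5
        exact h5.replicate_mono (by omega) h6

namespace Rival

/-- The guards `l` with `l e` replaced by `l' e` accept the word, and `wait_of_shifts` turns this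
into a run with `l'`. The blocks survive the replacement because `l' e ≤ r e` by `guard_le`, which
is all that is needed when `e` is interior to a block. -/
theorem accepts_insert (H : Rival sat h n r l l' S) {e : ℕ} {A : Λ} {w : List Λ} (h1 : 1 ≤ e)
    (hn : e ≤ n) (he : ¬ l' e ≤ l e) (hA : sat A (l' e)) (hw : GuardedWord h n r l (e + 1) w) :
    Accepts sat n r l' 1 (conjWord h r 1 e ++ A :: h (r e) :: w) := by
  have hacc : Accepts sat n r (Function.update l e (l' e)) 1
      (conjWord h r 1 e ++ A :: h (r e) :: w) := by
    refine H.accepts_prefix h1 (by omega) (.skip (by simpa using hA)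
      (.hit ((H.sat_r hn).2 le_rfl) (H.accepts_of_guardedWord hw fun i hi _ => ?_)))
    rw [Function.update_of_ne (by omega)]
  rw [← wait_wordTimeline_iff] at hacc ⊢
  refine (wait_of_shifts ?_ (fun j hj hjn => ?_) hacc le_rfl).1
    fun s i hB hs => absurd hB.one_le (by omega)
  · intro x z z'
    generalize conjWord h r 1 e ++ A :: h (r e) :: w = v
    induction v generalizing x with
    | nil => exact fun h => h.elim
    | cons c v ih =>
      cases x with
      | zero => exact H.mono
      | succ x => exact ih
  · by_cases hje : j = e
    · subst hje
      exact .inl (by simp)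
    · rw [Function.update_of_ne hje]
      by_cases h2 : l j ≤ l' j
      · exact .inl h2
      · have h3 : ¬ l j ≤ ⊥ := fun h' => h2 (h'.trans bot_le)
        obtain ⟨s, hB⟩ := H.exists_block j hj hjn h3 h2
        refine .inr ⟨s, hB.one_le, hB.lt, hjn, hB.skip, hB.equiv, ?_, ?_, ?_, ?_⟩
        · rw [Function.update_of_ne hje]
          exact hB.guard_le
        · rwa [Function.update_of_ne hje]
        · intro t hst htj
          by_cases hte : t = e
          · subst hte
            rw [Function.update_self]
            exact ((H.guard_le h1 hn).resolve_left he).trans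
              (hB.equiv hst.le htj le_rfl hB.lt)
          · rw [Function.update_of_ne hte]
            exact (hB.inner hst htj).trans bot_le
        · intro t hst htj
          by_cases hte : t = e
          · subst hte
            rw [Function.update_self]
          · rw [Function.update_of_ne hte]
            exact (hB.inner hst htj).trans bot_le

/-- From `l` to `l'` the blocks suffice. For the converse, `accepts_insert` and the tested tail of
`hsel` show that the query accepts `A, r e, w` from state `e` for every guarded `w`. As `l e` cannot
skip `A`, the word `r e, w` is accepted from state `e + 1`, which is the exchange property of
`wait_of_guards`. One rejected tail per `e` is enough for the contradiction. -/
theorem wait_iff (H : Rival sat h n r l l' S)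
    (hsel : ∀ e, 1 ≤ e → e ≤ n → ¬ l' e ≤ l e → ∃ A, sat A (l' e) ∧ ¬ sat A (l e) ∧
      ((∃ w, GuardedWord h n r l (e + 1) w ∧ ¬ Accepts sat n r l e (A :: h (r e) :: w)) →
        ∃ w, GuardedWord h n r l (e + 1) w ∧ ¬ Accepts sat n r l e (A :: h (r e) :: w) ∧
          (Accepts sat n r l' 1 (conjWord h r 1 e ++ A :: h (r e) :: w) →
            Accepts sat n r l 1 (conjWord h r 1 e ++ A :: h (r e) :: w))))
    (hT : ∀ {x z z'}, T x z → z ≤ z' → T x z') (hbot : ∀ x, ¬ T x ⊥) {x : ℕ} :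
    Wait T n r l' 1 x ↔ Wait T n r l 1 x := by
  constructor
  · intro hw
    refine (wait_of_guards (T := T) hT (fun e h1 hn => ?_) hw le_rfl).1
    by_cases he : l' e ≤ l e
    · exact .inl he
    refine .inr ⟨(H.guard_le h1 hn).resolve_left he, fun x hx hx1 hx2 => ?_⟩
    obtain ⟨A, hA, hAl, hex⟩ := hsel e h1 hn he
    have hall : ∀ w, GuardedWord h n r l (e + 1) w →
        Accepts sat n r l e (A :: h (r e) :: w) := by
      by_contra hne
      push Not at hne
      obtain ⟨w, hw1, hw2, hw3⟩ := hex hne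
      exact hw2 (H.accepts_of_prefix h1 (by omega) (hw3 (H.accepts_insert h1 hn he hA hw1)))
    obtain ⟨w, hw1, hw2⟩ := H.exists_guardedWord (T := T) hT hbot hx2 (by omega)
    rcases (hall w hw1).cases_cons hn with ⟨-, h2⟩ | ⟨h2, -⟩
    · exact h2.wait ⟨fun z hz => hT hx1 ((H.sat_r hn).1 hz), hw2⟩
    · exact absurd h2 hAl
  · intro hw
    refine (wait_of_shifts (T := T) hT (fun j hj hjn => ?_) hw le_rfl).1
      fun s i hB hs => absurd hB.one_le (by omega)
    by_cases h2 : l j ≤ l' j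
    · exact .inl h2
    · have h3 : ¬ l j ≤ ⊥ := fun h' => h2 (h'.trans bot_le)
      obtain ⟨s, hB⟩ := H.exists_block j hj hjn h3 h2
      exact .inr ⟨s, hB.one_le, hB.lt, hjn, hB.skip, hB.equiv, hB.guard_le, h2,
        fun h4 h5 => (hB.inner h4 h5).trans bot_le, fun h4 h5 => (hB.inner h4 h5).trans bot_le⟩

end Rival

end Order

/-! ### Letters and words as data instances -/

section Realization

variable {U B : Type}

/-- Domain queries, ordered by containment with respect to `O`. -/
def QueryOver (_ : Ontology U B) : Type := DomainQuery U B

instance (O : Ontology U B) : Preorder (QueryOver O) where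
  le z u := Contained O z u
  le_refl _ _ _ _ h := h
  le_trans _ _ _ h1 h2 A a ha h := h2 A a ha (h1 A a ha h)

instance (O : Ontology U B) : OrderBot (QueryOver O) where
  bot := DomainQuery.bot
  bot_le _ _ _ _ h I hI := (h I hI).elim

/-- Pointed data instances that are satisfiable with `O`. -/
abbrev Letter (O : Ontology U B) : Type := {p : PointedInstance U B // InstSatisfiable O p.inst}

/-- The queries entailed by a letter. -/
def Letter.Sat {O : Ontology U B} (c : Letter O) (z : QueryOver O) : Prop :=
  Entails O c.1.inst z c.1.pt

variable {O : Ontology U B}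

theorem Letter.Sat.mono {c : Letter O} {z z' : QueryOver O} (h : c.Sat z) (hz : z ≤ z') :
    c.Sat z' := hz _ _ c.1.pt_mem h

theorem not_entails_bot {A : DataInstance U B} {a : ℕ} (hA : InstSatisfiable O A) :
    ¬ Entails O A .bot a := fun h => by
  obtain ⟨I, hI⟩ := hA
  exact h I hI

theorem not_le_bot_of_entails {A : DataInstance U B} {a : ℕ} (hA : InstSatisfiable O A)
    (ha : a ∈ A.ind) {z : QueryOver O} (hz : Entails O A z a) : ¬ z ≤ ⊥ :=
  fun h => not_entails_bot hA (h A a ha hz)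

theorem satisfiableWrt_of_not_le_bot {z : QueryOver O} (h : ¬ z ≤ ⊥) :
    DomainQuery.SatisfiableWrt O z := by
  by_contra hne
  refine h fun A a _ hz I hI => ?_
  exact hne ⟨I, hI.1, I.name a, hz I hI⟩

/-- True of all elements denoted by names in all models of the ontology. -/
def Valid (O : Ontology U B) (z : DomainQuery U B) : Prop :=
  ∀ I : Interp U B, I.ModelsOnt O → ∀ a, z.Holds I (I.name a)

theorem Valid.entails {z : DomainQuery U B} (h : Valid O z) (A : DataInstance U B) (a : ℕ) :
    Entails O A z a := fun I hI => h I hI.1 a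

/-- The interpretation with permuted names. -/
def renameInterp (I : Interp U B) (σ : Equiv.Perm ℕ) : Interp U B where
  Dom := I.Dom
  str := I.str
  name := σ.toEmbedding.trans I.name

theorem holds_renameInterp {I : Interp U B} {σ : Equiv.Perm ℕ} {z : DomainQuery U B} {d : I.Dom} :
    z.Holds (renameInterp I σ) d ↔ z.Holds I d := by
  cases z with
  | bot => exact Iff.rfl
  | cq q =>
    refine exists_congr fun v => and_congr Iff.rfl (forall₂_congr fun α _ => ?_)
    cases α <;> exact Iff.rfl

/-- Ontologies have no constants, so swapping two names in a model of `O` gives a model of `O`, and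
atoms `⊤(t)` are always true. -/
theorem valid_of_entails_tops {N : Finset ℕ} {hN : N.Nonempty} {z : DomainQuery U B} {a : ℕ}
    (h : Entails O (.tops N hN) z a) : Valid O z := by
  intro I hI b
  have h1 := h (renameInterp I (Equiv.swap a b)) ⟨hI, ?_⟩
  · have h2 : (renameInterp I (Equiv.swap a b)).name a = I.name b := by
      change I.name (Equiv.swap a b a) = _
      rw [Equiv.swap_apply_left]
    rw [h2] at h1
    exact holds_renameInterp.1 h1
  · intro α hα
    obtain ⟨t, -, rfl⟩ := Finset.mem_map.1 hα
    trivial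

/-! ### Renaming and padding of data instances -/

/-- Renaming the terms of an atom. -/
def renameAtom (σ : Equiv.Perm ℕ) : Atom U B → Atom U B
  | .top t => .top (σ t)
  | .un A t => .un A (σ t)
  | .bin P s t => .bin P (σ s) (σ t)

theorem renameAtom_injective (σ : Equiv.Perm ℕ) :
    Function.Injective (renameAtom (U := U) (B := B) σ) := by
  intro α β h
  cases α <;> cases β <;> simp_all [renameAtom]

theorem size_renameAtom (σ : Equiv.Perm ℕ) (α : Atom U B) : (renameAtom σ α).size = α.size := by
  cases α <;> rfl

theorem terms_renameAtom (σ : Equiv.Perm ℕ) (α : Atom U B) :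
    (renameAtom σ α).terms = α.terms.image σ := by
  cases α <;> simp [renameAtom, Atom.terms, Finset.image_insert]

theorem holds_renameAtom (I : Interp U B) (σ : Equiv.Perm ℕ) (α : Atom U B) :
    (renameAtom σ α).Holds I I.name ↔
      α.Holds (renameInterp I σ) (renameInterp I σ).name := by
  cases α <;> exact Iff.rfl

/-- Renaming the individuals of a data instance. -/
def renameInst (σ : Equiv.Perm ℕ) (A : DataInstance U B) : DataInstance U B where
  atoms := A.atoms.map ⟨renameAtom σ, renameAtom_injective σ⟩
  nonempty := A.nonempty.map

theorem size_renameInst (σ : Equiv.Perm ℕ) (A : DataInstance U B) :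
    (renameInst σ A).size = A.size := by
  simp [DataInstance.size, renameInst, size_renameAtom]

theorem ind_renameInst (σ : Equiv.Perm ℕ) (A : DataInstance U B) :
    (renameInst σ A).ind = A.ind.image σ := by
  ext x
  simp only [DataInstance.ind, renameInst, Finset.mem_biUnion, Finset.mem_map,
    Function.Embedding.coeFn_mk, Finset.mem_image]
  constructor
  · rintro ⟨_, ⟨α, hα, rfl⟩, hx⟩
    rw [terms_renameAtom, Finset.mem_image] at hx
    obtain ⟨y, hy, rfl⟩ := hx
    exact ⟨y, ⟨α, hα, hy⟩, rfl⟩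
  · rintro ⟨y, ⟨α, hα, hy⟩, rfl⟩
    exact ⟨_, ⟨α, hα, rfl⟩, by rw [terms_renameAtom]; exact Finset.mem_image_of_mem _ hy⟩

theorem isModel_renameInst {I : Interp U B} {σ : Equiv.Perm ℕ} {A : DataInstance U B} :
    I.IsModel O (renameInst σ A) ↔ (renameInterp I σ).IsModel O A := by
  refine and_congr Iff.rfl ?_
  simp only [renameInst, Finset.mem_map, Function.Embedding.coeFn_mk, forall_exists_index, and_imp,
    forall_apply_eq_imp_iff₂, holds_renameAtom]

theorem renameInterp_symm (I : Interp U B) (σ : Equiv.Perm ℕ) :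
    renameInterp (renameInterp I σ.symm) σ = I := by
  have : σ.toEmbedding.trans (σ.symm.toEmbedding.trans I.name) = I.name := by
    ext x
    simp
  rw [renameInterp, renameInterp]
  simp only [this]

theorem entails_renameInst {σ : Equiv.Perm ℕ} {A : DataInstance U B} {z : DomainQuery U B}
    {a : ℕ} : Entails O (renameInst σ A) z (σ a) ↔ Entails O A z a := by
  constructor
  · intro h I hI
    have h1 := h (renameInterp I σ.symm)
      (isModel_renameInst.2 (by rwa [renameInterp_symm]))
    have h2 : (renameInterp I σ.symm).name (σ a) = I.name a := by
      change I.name (σ.symm (σ a)) = _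
      rw [Equiv.symm_apply_apply]
    rw [h2] at h1
    exact holds_renameInterp.1 h1
  · exact fun h I hI => holds_renameInterp.1 (h (renameInterp I σ) (isModel_renameInst.1 hI))

theorem instSatisfiable_renameInst {σ : Equiv.Perm ℕ} {A : DataInstance U B}
    (h : InstSatisfiable O A) : InstSatisfiable O (renameInst σ A) := by
  obtain ⟨I, hI⟩ := h
  exact ⟨renameInterp I σ.symm, isModel_renameInst.2 (by rwa [renameInterp_symm])⟩

open Classical in
/-- Adding the atoms `⊤(b)` for `b ∈ N`. -/
noncomputable def padInst (A : DataInstance U B) (N : Finset ℕ) : DataInstance U B where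
  atoms := A.atoms ∪ N.image Atom.top
  nonempty := A.nonempty.inl

theorem ind_padInst (A : DataInstance U B) (N : Finset ℕ) : (padInst A N).ind = A.ind ∪ N := by
  classical
  ext x
  simp only [DataInstance.ind, padInst, Finset.mem_biUnion, Finset.mem_union, Finset.mem_image]
  constructor
  · rintro ⟨α, h | ⟨t, ht, rfl⟩, hx⟩
    · exact .inl ⟨α, h, hx⟩
    · rw [Atom.terms, Finset.mem_singleton] at hx
      exact .inr (hx ▸ ht)
  · rintro (⟨α, h, hx⟩ | h)
    · exact ⟨α, .inl h, hx⟩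
    · exact ⟨_, .inr ⟨x, h, rfl⟩, by simp [Atom.terms]⟩

theorem size_padInst_le (A : DataInstance U B) (N : Finset ℕ) :
    (padInst A N).size ≤ A.size + 2 * N.card := by
  classical
  rw [DataInstance.size, padInst]
  refine (Nat.le_of_add_right_le (Finset.sum_union_inter).le).trans
    (Nat.add_le_add_left ?_ _)
  rw [Finset.sum_image fun _ _ _ _ h => Atom.top.inj h, mul_comm, ← smul_eq_mul]
  exact Finset.sum_le_card_nsmul _ _ _ fun _ _ => le_rfl

theorem isModel_padInst {I : Interp U B} {A : DataInstance U B} {N : Finset ℕ} :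
    I.IsModel O (padInst A N) ↔ I.IsModel O A := by
  classical
  refine and_congr Iff.rfl ⟨fun h α hα => h α (Finset.mem_union_left _ hα), fun h α hα => ?_⟩
  rcases Finset.mem_union.1 hα with hα | hα
  · exact h α hα
  · obtain ⟨t, -, rfl⟩ := Finset.mem_image.1 hα
    trivial

theorem card_ind_le (A : DataInstance U B) : A.ind.card ≤ A.size := by
  refine Finset.card_biUnion_le.trans (Finset.sum_le_sum fun α _ => ?_)
  cases α with
  | top t => simp [Atom.terms, Atom.size]
  | un A t => simp [Atom.terms, Atom.size]
  | bin P s t => exact Finset.card_le_two.trans (by simp [Atom.size])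

/-! ### Temporal data instances from words -/

/-- The instance of a letter with the distinguished individual renamed to `0`. -/
def Letter.based (c : Letter O) : DataInstance U B := renameInst (Equiv.swap c.1.pt 0) c.1.inst

theorem Letter.zero_mem_based (c : Letter O) : 0 ∈ c.based.ind := by
  rw [based, ind_renameInst, Finset.mem_image]
  exact ⟨c.1.pt, c.1.pt_mem, Equiv.swap_apply_left _ _⟩

theorem Letter.entails_based {c : Letter O} {z : DomainQuery U B} :
    Entails O c.based z 0 ↔ c.Sat z := by
  have := entails_renameInst (O := O) (σ := Equiv.swap c.1.pt 0) (A := c.1.inst) (z := z)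
    (a := c.1.pt)
  rwa [Equiv.swap_apply_left] at this

/-- All individuals of the letters of a word. -/
def wordInd (w : List (Letter O)) : Finset ℕ := w.foldr (fun c N => c.based.ind ∪ N) ∅

theorem subset_wordInd {w : List (Letter O)} {c : Letter O} (hc : c ∈ w) :
    c.based.ind ⊆ wordInd w := by
  induction w with
  | nil => simp at hc
  | cons d w ih =>
    rcases List.mem_cons.1 hc with rfl | hc
    · exact Finset.subset_union_left
    · exact (ih hc).trans Finset.subset_union_right

theorem card_wordInd_le {w : List (Letter O)} {M : ℕ} (hM : ∀ c ∈ w, c.1.inst.size ≤ M) :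
    (wordInd w).card ≤ w.length * M := by
  induction w with
  | nil => simp [wordInd]
  | cons d w ih =>
    have h1 := ih fun c hc => hM c (List.mem_cons_of_mem _ hc)
    have h2 := (card_ind_le d.based).trans
      ((size_renameInst _ _).le.trans (hM d List.mem_cons_self))
    have h3 := Finset.card_union_le d.based.ind (wordInd w)
    rw [List.length_cons, Nat.succ_mul]
    exact h3.trans (by omega)

/-- The temporal data instance of a word. -/
noncomputable def realize (c : Letter O) (w : List (Letter O)) : TemporalInstance U B where
  last := w.length
  snap i := padInst ((c :: w)[i.1]'i.2).based (wordInd (c :: w))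
  ind_eq i j := by
    simp only [ind_padInst]
    rw [Finset.union_eq_right.2 (subset_wordInd (List.getElem_mem _)),
      Finset.union_eq_right.2 (subset_wordInd (List.getElem_mem _))]

theorem zero_mem_realize (c : Letter O) (w : List (Letter O)) : 0 ∈ (realize c w).ind := by
  rw [TemporalInstance.ind, realize]
  simp only [ind_padInst]
  exact Finset.mem_union_left _ (Letter.zero_mem_based _)

theorem satisfiable_realize (c : Letter O) (w : List (Letter O)) :
    (realize c w).SatisfiableWrt O := by
  intro i
  obtain ⟨I, hI⟩ := instSatisfiable_renameInst (σ := Equiv.swap ((c :: w)[i.1]'i.2).1.pt 0)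
    ((c :: w)[i.1]'i.2).2
  exact ⟨I, isModel_padInst.2 hI⟩

theorem size_realize_le {c : Letter O} {w : List (Letter O)} {L M : ℕ}
    (hL : w.length + 1 ≤ L) (hM : ∀ d ∈ c :: w, d.1.inst.size ≤ M) :
    (realize c w).size ≤ L * (M + 2 * (L * M)) := by
  have h1 : ∀ i, ((realize c w).snap i).size ≤ M + 2 * (L * M) := by
    intro i
    refine (size_padInst_le _ _).trans (Nat.add_le_add ?_ (Nat.mul_le_mul_left _ ?_))
    · exact (size_renameInst _ _).le.trans (hM _ (List.getElem_mem _))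
    · exact (card_wordInd_le hM).trans (Nat.mul_le_mul_right _ hL)
  refine (Finset.sum_le_card_nsmul _ _ _ fun i _ => h1 i).trans ?_
  rw [Finset.card_univ, Fintype.card_fin, smul_eq_mul]
  exact Nat.mul_le_mul_right _ hL

/-- The queries that hold of `a` over time. -/
def timeline (O : Ontology U B) (D : TemporalInstance U B) (a : ℕ) (x : ℕ) (z : QueryOver O) :
    Prop := Entails O (D.at' x) z a

theorem timeline_realize_of_lt {c : Letter O} {w : List (Letter O)} {x : ℕ}
    (hx : x < (c :: w).length) {z : QueryOver O} :
    timeline O (realize c w) 0 x z ↔ ((c :: w)[x]).Sat z := by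
  have key : Entails O (padInst ((c :: w)[x]).based (wordInd (c :: w))) z 0 ↔
      ((c :: w)[x]).Sat z :=
    (forall_congr' fun I => by rw [isModel_padInst]).trans Letter.entails_based
  rw [timeline, TemporalInstance.at', dif_pos (show x < (realize c w).last + 1 from hx)]
  exact key

theorem timeline_realize_of_le {c : Letter O} {w : List (Letter O)} {x : ℕ}
    (hx : (c :: w).length ≤ x) {z : QueryOver O} (h : timeline O (realize c w) 0 x z) :
    Valid O z := by
  rw [timeline, TemporalInstance.at',
    dif_neg (show ¬ x < (realize c w).last + 1 from not_lt.2 hx)] at h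
  exact valid_of_entails_tops h

theorem matches_of_getElem {α Λ : Type} {sat : Λ → α → Prop} {T : ℕ → α → Prop} {w : List Λ}
    {x : ℕ} (h : ∀ (i : ℕ) (hi : i < w.length) (z : α), sat w[i] z → T (x + i) z) :
    Matches sat T x w := by
  induction w generalizing x with
  | nil => trivial
  | cons c w ih =>
    refine ⟨fun z => h 0 (by simp) z, ih fun i hi z hz => ?_⟩
    have := h (i + 1) (by simpa using hi) z (by simpa using hz)
    rwa [show x + 1 + i = x + (i + 1) by omega]

theorem matchedBy_of_getElem {α Λ : Type} {sat : Λ → α → Prop} {T : ℕ → α → Prop} {w : List Λ}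
    {x : ℕ} (h : ∀ (i : ℕ) (hi : i < w.length) (z : α), T (x + i) z → sat w[i] z) :
    MatchedBy sat T x w := by
  induction w generalizing x with
  | nil => trivial
  | cons c w ih =>
    refine ⟨fun z => h 0 (by simp) z, ih fun i hi z hz => ?_⟩
    have := h (i + 1) (by simpa using hi) z (by rwa [show x + (i + 1) = x + 1 + i by omega])
    simpa using this

/-- After the end of the word only valid queries hold, so a last conjunct that is not valid must be
matched inside it. For `n = 0` nothing is pending in state `1`. -/
theorem wait_realize_iff {c : Letter O} {w : List (Letter O)} {n : ℕ} {r l : ℕ → QueryOver O}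
    (hn : n = 0 ∨ ¬ Valid O (r n)) :
    Wait (timeline O (realize c w) 0) n r l 1 1 ↔ Accepts Letter.Sat n r l 1 w := by
  rcases hn with rfl | hn
  · exact ⟨fun _ => .done one_pos, fun _ => .done one_pos⟩
  constructor
  · refine fun H => H.accepts (matchedBy_of_getElem fun i hi z hz => ?_) fun y hy h => hn ?_
    · rw [timeline_realize_of_lt (by rw [List.length_cons]; omega)] at hz
      simpa [add_comm 1 i] using hz
    · exact timeline_realize_of_le (by simp only [List.length_cons]; omega) h
  · refine fun H => H.wait (matches_of_getElem fun i hi z hz => ?_)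
    rw [timeline_realize_of_lt (by rw [List.length_cons]; omega)]
    simpa [add_comm 1 i] using hz

theorem timeline_mono {D : TemporalInstance U B} {a : ℕ} (ha : a ∈ D.ind) {x : ℕ}
    {z z' : QueryOver O} (h : timeline O D a x z) (hz : z ≤ z') : timeline O D a x z' := by
  refine hz _ _ ?_ h
  rw [TemporalInstance.at']
  split_ifs with hx
  · rwa [D.ind_eq ⟨x, hx⟩ 0]
  · rw [DataInstance.ind, Finset.mem_biUnion]
    exact ⟨.top a, Finset.mem_map.2 ⟨a, ha, rfl⟩, Finset.mem_singleton_self a⟩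

theorem timeline_bot {D : TemporalInstance U B} {a : ℕ} (hD : D.SatisfiableWrt O) (x : ℕ) :
    ¬ timeline O D a x ⊥ := by
  refine not_entails_bot ?_
  rw [TemporalInstance.at']
  split_ifs with hx
  · exact hD _
  · obtain ⟨I, hI⟩ := hD 0
    refine ⟨I, hI.1, fun α hα => ?_⟩
    obtain ⟨t, -, rfl⟩ := Finset.mem_map.1 hα
    trivial

theorem not_le_bot_of_timeline {D : TemporalInstance U B} {a : ℕ} (hD : D.SatisfiableWrt O)
    (ha : a ∈ D.ind) {x : ℕ} {z : QueryOver O} (h : timeline O D a x z) : ¬ z ≤ ⊥ :=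
  fun hz => timeline_bot hD x (timeline_mono ha h hz)

/-! ### Canonical letters -/

open Classical in
theorem size_le_of_ind [Fintype U] [Fintype B] (A : DataInstance U B) {N : ℕ}
    (hN : A.ind.card ≤ N) :
    A.size ≤ 3 * (N + Fintype.card U * N + Fintype.card B * (N * N)) := by
  have hsub : A.atoms ⊆ A.ind.image Atom.top ∪
      (Finset.univ ×ˢ A.ind).image (fun p : U × ℕ => Atom.un p.1 p.2) ∪
      (Finset.univ ×ˢ (A.ind ×ˢ A.ind)).image
        (fun p : B × (ℕ × ℕ) => Atom.bin p.1 p.2.1 p.2.2) := by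
    intro α hα
    have hterms : ∀ t ∈ α.terms, t ∈ A.ind := fun t ht => Finset.mem_biUnion.2 ⟨α, hα, ht⟩
    cases α with
    | top t =>
      have := hterms t (by simp [Atom.terms])
      simp [this]
    | un C t =>
      have := hterms t (by simp [Atom.terms])
      simp [this]
    | bin P s t =>
      have h1 := hterms s (by simp [Atom.terms])
      have h2 := hterms t (by simp [Atom.terms])
      simp [h1, h2]
  have hcard : A.atoms.card ≤ N + Fintype.card U * N + Fintype.card B * (N * N) := by
    refine (Finset.card_le_card hsub).trans ((Finset.card_union_le _ _).trans
      (Nat.add_le_add ((Finset.card_union_le _ _).trans (Nat.add_le_add ?_ ?_)) ?_))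
    · exact Finset.card_image_le.trans hN
    · refine Finset.card_image_le.trans ?_
      rw [Finset.card_product, Finset.card_univ]
      exact Nat.mul_le_mul_left _ hN
    · refine Finset.card_image_le.trans ?_
      rw [Finset.card_product, Finset.card_product, Finset.card_univ]
      exact Nat.mul_le_mul_left _ (Nat.mul_le_mul hN hN)
  refine (Finset.sum_le_card_nsmul _ _ 3 fun α _ => ?_).trans ?_
  · cases α <;> simp [Atom.size]
  · rw [smul_eq_mul, mul_comm]
    exact Nat.mul_le_mul_left _ hcard

theorem card_vars_le (q : CQ U B) : q.vars.card ≤ q.size := by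
  refine Finset.card_biUnion_le.trans (Finset.sum_le_sum fun α _ => ?_)
  cases α with
  | top t => simp [Atom.terms, Atom.size]
  | un A t => simp [Atom.terms, Atom.size]
  | bin P s t => exact Finset.card_le_two.trans (by simp [Atom.size])

/-- The size bound comes from surjectivity of the homomorphism: the individuals are images of query
variables, and over a finite signature the number of atoms is at most quadratic in the number of
individuals. -/
theorem exists_hat [Fintype U] [Fintype B] (hcr : AdmitsContainmentReduction O)
    (z : QueryOver O) (hz : ¬ z ≤ ⊥) : ∃ c : Letter O, (∀ u : QueryOver O, c.Sat u ↔ z ≤ u) ∧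
      c.1.inst.size ≤ 3 * (DomainQuery.size z + Fintype.card U * DomainQuery.size z +
        Fintype.card B * (DomainQuery.size z * DomainQuery.size z)) := by
  cases z with
  | bot => exact absurd le_rfl hz
  | cq q =>
    obtain ⟨p, h1, ⟨f, -, h2, -⟩, h3⟩ := hcr q
    have hq := satisfiableWrt_of_not_le_bot hz
    refine ⟨⟨p, h1.1 hq⟩, fun u => ?_, size_le_of_ind _ ?_⟩
    · cases u with
      | cq q' => exact (h3 hq q').symm
      | bot => exact ⟨fun h => absurd h (not_entails_bot (h1.1 hq)), fun h => absurd h hz⟩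
    · rw [← h2]
      exact Finset.card_image_le.trans (card_vars_le q)

end Realization

/-! ### Path queries as sequences of conjuncts and guards -/

section Paths

variable {U B : Type}

theorem wait_iff_exists {α : Type} {T : ℕ → α → Prop} {n : ℕ} {r l : ℕ → α} {j x : ℕ}
    (hj : j ≤ n) : Wait T n r l j x ↔
      ∃ m, x ≤ m ∧ (T m (r j) ∧ Wait T n r l (j + 1) (m + 1)) ∧
        ∀ k, x ≤ k → k < m → T k (l j) := by
  constructor
  · intro H
    induction H with
    | done h => omega
    | @hit j x h1 h2 _ => exact ⟨x, le_rfl, ⟨h1, h2⟩, fun k _ _ => by omega⟩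
    | @skip j x h1 _ ih =>
      obtain ⟨m, h2, h3, h4⟩ := ih hj
      refine ⟨m, by omega, h3, fun k hk hkm => ?_⟩
      rcases hk.eq_or_lt with rfl | hk
      · exact h1
      · exact h4 k hk hkm
  · rintro ⟨m, hm, ⟨h1, h2⟩, h3⟩
    induction hm using Nat.decreasingInduction with
    | self => exact .hit h1 h2
    | of_succ x hx ih => exact .skip (h3 x le_rfl hx) (ih fun k hk => h3 k (by omega))

theorem wait_succ_iff {α : Type} {T : ℕ → α → Prop} {n : ℕ} {r l : ℕ → α} {j x : ℕ} :
    Wait T (n + 1) r l (j + 1) x ↔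
      Wait T n (fun i => r (i + 1)) (fun i => l (i + 1)) j x := by
  constructor
  · intro H
    obtain ⟨i, hi⟩ : ∃ i, i = j + 1 := ⟨_, rfl⟩
    rw [← hi] at H
    induction H generalizing j with
    | done h => exact .done (by omega)
    | hit h1 _ ih => subst hi; exact .hit h1 (ih rfl)
    | skip h1 _ ih => subst hi; exact .skip h1 (ih rfl)
  · intro H
    induction H with
    | done h => exact .done (by omega)
    | hit h1 _ ih => exact .hit h1 ih
    | skip h1 _ ih => exact .skip h1 ih

/-- The number of until operators. -/
def pathLen : UPath U B → ℕ
  | .last _ => 0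
  | .step _ _ q => pathLen q + 1

/-- The conjuncts of a path query. -/
def pathConj (O : Ontology U B) : UPath U B → ℕ → QueryOver O
  | .last a, _ => a
  | .step a _ _, 0 => a
  | .step _ _ q, j + 1 => pathConj O q j

/-- The guards of a path query, the first of them at index `1`. -/
def pathGuard (O : Ontology U B) : UPath U B → ℕ → QueryOver O
  | .last _, _ => ⊥
  | .step _ _ _, 0 => ⊥
  | .step _ l _, 1 => l
  | .step _ _ q, j + 2 => pathGuard O q (j + 1)

variable {O : Ontology U B}

theorem pathConj_zero (q : UPath U B) : pathConj O q 0 = q.head := by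
  cases q <;> rfl

/-- The strict until at `x` is the non-strict one at `x + 1`. -/
theorem trueAt_iff {D : TemporalInstance U B} {a : ℕ} (q : UPath U B) (x : ℕ) :
    q.TrueAt O D a x ↔ timeline O D a x (pathConj O q 0) ∧
      Wait (timeline O D a) (pathLen q) (pathConj O q) (pathGuard O q) 1 (x + 1) := by
  induction q generalizing x with
  | last a => exact ⟨fun h => ⟨h, .done one_pos⟩, fun h => h.1⟩
  | step b l q ih =>
    refine and_congr Iff.rfl ?_
    rw [wait_iff_exists (show 1 ≤ pathLen (.step b l q) from Nat.succ_le_succ (Nat.zero_le _))]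
    refine exists_congr fun m => and_congr Iff.rfl (and_congr ((ih m).trans ?_) Iff.rfl)
    refine and_congr Iff.rfl ?_
    rw [show pathLen (.step b l q) = pathLen q + 1 from rfl, wait_succ_iff]
    -- At index `0` the guards differ: `⊥` for `q`, but `l` for the shifted sequence. No run from a
    -- state `j ≥ 1` uses it.
    have : ∀ {j x : ℕ}, 1 ≤ j →
        (Wait (timeline O D a) (pathLen q) (pathConj O q) (pathGuard O q) j x ↔
          Wait (timeline O D a) (pathLen q) (fun i => pathConj O (.step b l q) (i + 1))
            (fun i => pathGuard O (.step b l q) (i + 1)) j x) := by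
      intro j x hj
      constructor
      · intro H
        induction H with
        | done h => exact .done h
        | hit h1 _ ih => exact .hit h1 (ih (by omega))
        | @skip j x h1 _ ih =>
          obtain ⟨j, rfl⟩ : ∃ j', j = j' + 1 := ⟨j - 1, by omega⟩
          exact .skip h1 (ih hj)
      · intro H
        induction H with
        | done h => exact .done h
        | hit h1 _ ih => exact .hit h1 (ih (by omega))
        | @skip j x h1 _ ih =>
          obtain ⟨j, rfl⟩ : ∃ j', j = j' + 1 := ⟨j - 1, by omega⟩
          exact .skip h1 (ih hj)
    exact this le_rfl

theorem pathConj_mem {𝒬 : Set (DomainQuery U B)} {q : UPath U B} (hq : q.BuiltFrom 𝒬) (j : ℕ)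
    (hj : j ≤ pathLen q) : (pathConj O q j : DomainQuery U B) ∈ 𝒬 := by
  induction q generalizing j with
  | last a => exact hq
  | step a l q ih =>
    cases j with
    | zero => exact hq.1
    | succ j => exact ih hq.2.2 j (Nat.le_of_succ_le_succ hj)

theorem pathGuard_mem {𝒬 : Set (DomainQuery U B)} (hbot : DomainQuery.bot ∈ 𝒬) {q : UPath U B}
    (hq : q.BuiltFrom 𝒬) (j : ℕ) : (pathGuard O q j : DomainQuery U B) ∈ 𝒬 := by
  induction q generalizing j with
  | last a => exact hbot
  | step a l q ih =>
    match j with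
    | 0 => exact hbot
    | 1 =>
      rcases hq.2.1 with h | h
      · exact h
      · exact h ▸ hbot
    | j + 2 => exact ih hq.2.2 (j + 1)

theorem peerless_guard {q : UPath U B} (hq : q.Peerless O) (j : ℕ) (h1 : 1 ≤ j)
    (hj : j ≤ pathLen q) : pathGuard O q j ≤ ⊥ ∨
      (¬ pathConj O q j ≤ pathGuard O q j ∧ ¬ pathGuard O q j ≤ pathConj O q j) := by
  induction q generalizing j with
  | last a => exact absurd (h1.trans hj) (by simp [pathLen])
  | step a l q ih =>
    match j with
    | 1 =>
      rcases hq.1 with h | h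
      · subst h
        exact .inl (le_refl (⊥ : QueryOver O))
      · rw [← pathConj_zero (O := O)] at h
        exact .inr h
    | j + 2 => exact ih hq.2 (j + 1) (by omega) (Nat.le_of_succ_le_succ hj)

theorem conj_not_le_bot {q : UPath U B} (hq : q.SatisfiableWrt O) (j : ℕ)
    (hj : j ≤ pathLen q) : ¬ pathConj O q j ≤ ⊥ := by
  obtain ⟨D, a, ha, hD, h⟩ := hq
  obtain ⟨h0, h1⟩ := (trueAt_iff q 0).1 (h hD)
  cases j with
  | zero => exact not_le_bot_of_timeline hD ha h0
  | succ j =>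
    obtain ⟨y, -, hy⟩ := h1.exists_conj (Nat.succ_le_succ (Nat.zero_le j)) hj
    exact not_le_bot_of_timeline hD ha hy

theorem two_le_size (z : DomainQuery U B) : 2 ≤ z.size := by
  cases z with
  | bot => exact le_rfl
  | cq q =>
    obtain ⟨α, hα, -⟩ := Finset.mem_biUnion.1 q.answer_mem
    refine le_trans ?_ (Finset.single_le_sum (fun _ _ => Nat.zero_le _) hα)
    cases α <;> simp [Atom.size]

theorem pathLen_lt_size (q : UPath U B) : pathLen q + 2 ≤ q.size := by
  induction q with
  | last a => exact two_le_size a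
  | step a l q ih => simp only [pathLen, UPath.size]; omega

theorem size_conj_le (q : UPath U B) (j : ℕ) :
    DomainQuery.size (pathConj O q j) ≤ q.size := by
  induction q generalizing j with
  | last a => exact le_rfl
  | step a l q ih =>
    cases j with
    | zero => simp only [pathConj, UPath.size]; omega
    | succ j => exact (ih j).trans (by simp only [UPath.size]; omega)

theorem size_guard_add_conj_le (q : UPath U B) (j : ℕ) (h1 : 1 ≤ j) (hj : j ≤ pathLen q) :
    DomainQuery.size (pathGuard O q j) + DomainQuery.size (pathConj O q j) ≤ q.size := by
  induction q generalizing j with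
  | last a => exact absurd (h1.trans hj) (by simp [pathLen])
  | step a l q ih =>
    match j with
    | 1 =>
      have := size_conj_le (O := O) q 0
      simp only [pathConj, pathGuard, UPath.size]
      omega
    | j + 2 =>
      exact (ih (j + 1) (by omega) (Nat.le_of_succ_le_succ hj)).trans
        (by simp only [UPath.size]; omega)

/-! ### Dropping trailing valid conjuncts -/

open Classical in
/-- The path query without its trailing valid conjuncts. -/
noncomputable def trim (O : Ontology U B) : UPath U B → UPath U B
  | .last a => .last a
  | .step a l q =>
    match trim O q with
    | .last b => if Valid O b then .last a else .step a l (.last b)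
    | .step b m p => .step a l (.step b m p)

theorem trim_step_cases (a l : DomainQuery U B) (q : UPath U B) :
    (∃ b, trim O q = .last b ∧ Valid O b ∧ trim O (.step a l q) = .last a) ∨
      (trim O (.step a l q) = .step a l (trim O q) ∧ ∀ b, trim O q = .last b → ¬ Valid O b) := by
  rw [trim]
  cases h : trim O q with
  | last b =>
    by_cases hb : Valid O b
    · exact .inl ⟨b, rfl, hb, if_pos hb⟩
    · refine .inr ⟨if_neg hb, fun b' h' => ?_⟩
      cases h'
      exact hb
  | step b m p => exact .inr ⟨rfl, fun b' h' => by cases h'⟩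

theorem head_trim (q : UPath U B) : (trim O q).head = q.head := by
  cases q with
  | last a => rfl
  | step a l q =>
    rcases trim_step_cases (O := O) a l q with ⟨b, -, -, h⟩ | ⟨h, -⟩ <;> rw [h] <;> rfl

theorem trueAt_trim {D : TemporalInstance U B} {a : ℕ} (q : UPath U B) (x : ℕ) :
    (trim O q).TrueAt O D a x ↔ q.TrueAt O D a x := by
  induction q generalizing x with
  | last a => exact Iff.rfl
  | step b l q ih =>
    rcases trim_step_cases (O := O) b l q with ⟨c, h1, h2, h⟩ | ⟨h, -⟩ <;> rw [h]
    -- A valid last conjunct is matched at the next time point, where its guard has nothing to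
    -- satisfy.
    · refine ⟨fun h3 => ⟨h3, x + 1, Nat.lt_succ_self x, ?_, fun k _ _ => by omega⟩, fun h3 => h3.1⟩
      rw [← ih, h1]
      exact h2.entails _ _
    · simp only [UPath.TrueAt, ih]

theorem trim_conj_last (q : UPath U B) : pathLen (trim O q) = 0 ∨
    ¬ Valid O (pathConj O (trim O q) (pathLen (trim O q))) := by
  induction q with
  | last a => exact .inl rfl
  | step a l q ih =>
    rcases trim_step_cases (O := O) a l q with ⟨b, -, -, h⟩ | ⟨h, h2⟩ <;> rw [h]
    · exact .inl rfl
    · right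
      cases h3 : trim O q with
      | last b => exact h2 b h3
      | step b m p =>
        rw [h3] at ih
        exact ih.resolve_left (Nat.succ_ne_zero _)

theorem builtFrom_trim {𝒬 : Set (DomainQuery U B)} {q : UPath U B} (hq : q.BuiltFrom 𝒬) :
    (trim O q).BuiltFrom 𝒬 := by
  induction q with
  | last a => exact hq
  | step a l q ih =>
    rcases trim_step_cases (O := O) a l q with ⟨b, -, -, h⟩ | ⟨h, -⟩ <;> rw [h]
    · exact hq.1
    · exact ⟨hq.1, hq.2.1, ih hq.2.2⟩

theorem peerless_trim {q : UPath U B} (hq : q.Peerless O) : (trim O q).Peerless O := by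
  induction q with
  | last a => trivial
  | step a l q ih =>
    rcases trim_step_cases (O := O) a l q with ⟨b, -, -, h⟩ | ⟨h, -⟩ <;> rw [h]
    · trivial
    · refine ⟨?_, ih hq.2⟩
      rw [head_trim]
      exact hq.1

theorem size_trim_le (q : UPath U B) : (trim O q).size ≤ q.size := by
  induction q with
  | last a => exact le_rfl
  | step a l q ih =>
    rcases trim_step_cases (O := O) a l q with ⟨b, -, -, h⟩ | ⟨h, -⟩ <;> rw [h] <;>
      simp only [UPath.size] <;> omega

theorem entailedAt_trim {D : TemporalInstance U B} {a : ℕ} (q : UPath U B) (x : ℕ) :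
    (trim O q).EntailedAt O D x a ↔ q.EntailedAt O D x a :=
  forall_congr' fun _ => trueAt_trim q x

end Paths

/-! ### Words with one letter per conjunct -/

section Words

variable {α Λ : Type} {sat : Λ → α → Prop} {n : ℕ} {r r' l : ℕ → α}

theorem Accepts.congr_conj (hr : ∀ j c, j ≤ n → sat c (r j) → sat c (r' j)) {j : ℕ} {w : List Λ}
    (H : Accepts sat n r l j w) : Accepts sat n r' l j w := by
  induction H with
  | done h => exact .done h
  | @hit j c w h1 _ ih =>
    by_cases hj : j ≤ n
    · exact .hit (hr j c hj h1) ih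
    · exact .done (by omega)
  | skip h1 _ ih => exact .skip h1 ih

theorem Wait.congr_conj {T : ℕ → α → Prop} (hr : ∀ j x, j ≤ n → T x (r j) → T x (r' j)) {j x : ℕ}
    (H : Wait T n r l j x) : Wait T n r' l j x := by
  induction H with
  | done h => exact .done h
  | @hit j x h1 _ ih =>
    by_cases hj : j ≤ n
    · exact .hit (hr j x hj h1) ih
    · exact .done (by omega)
  | skip h1 _ ih => exact .skip h1 ih

theorem Accepts.exists_sat {j i : ℕ} {w : List Λ} (H : Accepts sat n r l j w) (hj : j ≤ i)
    (hi : i ≤ n) : ∃ c, sat c (r i) := by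
  induction H with
  | done h => omega
  | @hit j c w h1 _ ih =>
    rcases hj.eq_or_lt with rfl | hj
    · exact ⟨c, h1⟩
    · exact ih hj
  | skip _ _ ih => exact ih hj

theorem accepts_map_Ico {A : ℕ → Λ} {a b : ℕ} (hab : a ≤ b) (hb : n < b)
    (hA : ∀ j, a ≤ j → j ≤ n → sat (A j) (r j)) :
    Accepts sat n r l a ((List.Ico a b).map A) := by
  induction hab using Nat.decreasingInduction with
  | self => exact .done hb
  | of_succ j hj ih =>
    by_cases hjn : j ≤ n
    · rw [List.Ico.eq_cons hj, List.map_cons]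
      exact .hit (hA j le_rfl hjn) (ih fun i hi => hA i (by omega))
    · exact .done (by omega)

theorem sat_of_accepts_map_Ico {A : ℕ → Λ} {a : ℕ} (ha : a ≤ n + 1)
    (H : Accepts sat n r l a ((List.Ico a (n + 1)).map A)) :
    ∀ j, a ≤ j → j ≤ n → sat (A j) (r j) := by
  induction ha using Nat.decreasingInduction with
  | self => intro j h1 h2; omega
  | of_succ i hi ih =>
    rw [List.Ico.eq_cons hi, List.map_cons] at H
    obtain ⟨h1, h2⟩ := H.hit_of_exact (by rw [List.length_map, List.Ico.length]; omega)
    intro j hj hjn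
    rcases hj.eq_or_lt with rfl | hj
    · exact h1
    · exact ih h2 j hj hjn

end Words

/-! ### Finite families of words -/

section Families

open Classical

variable {α Λ : Type}

/-- All words whose letters are taken from the given sets. -/
noncomputable def listsOf : List (Finset Λ) → Finset (List Λ)
  | [] => {[]}
  | X :: L => (X ×ˢ listsOf L).image fun p => p.1 :: p.2

theorem map_mem_listsOf {ι : Type} {L : List ι} {X : ι → Finset Λ} {A : ι → Λ}
    (h : ∀ i ∈ L, A i ∈ X i) : L.map A ∈ listsOf (L.map X) := by
  induction L with
  | nil => simp [listsOf]
  | cons i L ih =>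
    rw [List.map_cons, List.map_cons, listsOf, Finset.mem_image]
    exact ⟨(A i, L.map A), Finset.mem_product.2 ⟨h i List.mem_cons_self,
      ih fun j hj => h j (List.mem_cons_of_mem _ hj)⟩, rfl⟩

theorem of_mem_listsOf {L : List (Finset Λ)} {w : List Λ} (h : w ∈ listsOf L) :
    w.length = L.length ∧ ∀ c ∈ w, ∃ X ∈ L, c ∈ X := by
  induction L generalizing w with
  | nil => simp_all [listsOf]
  | cons X L ih =>
    rw [listsOf, Finset.mem_image] at h
    obtain ⟨⟨c, v⟩, hp, rfl⟩ := h
    rw [Finset.mem_product] at hp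
    obtain ⟨h1, h2⟩ := ih hp.2
    refine ⟨by simp [h1], fun d hd => ?_⟩
    rcases List.mem_cons.1 hd with rfl | hd
    · exact ⟨X, List.mem_cons_self, hp.1⟩
    · obtain ⟨Y, hY, hdY⟩ := h2 d hd
      exact ⟨Y, List.mem_cons_of_mem _ hY, hdY⟩

theorem card_listsOf_le (L : List (Finset Λ)) :
    (listsOf L).card ≤ (L.map Finset.card).prod := by
  induction L with
  | nil => simp [listsOf]
  | cons X L ih =>
    rw [listsOf, List.map_cons, List.prod_cons]
    refine Finset.card_image_le.trans ?_
    rw [Finset.card_product]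
    exact Nat.mul_le_mul_left _ ih

theorem exists_of_mem_map_Ico {ι : Type} {X : ℕ → ι} {a b : ℕ} {Y : ι}
    (h : Y ∈ (List.Ico a b).map X) : ∃ j, a ≤ j ∧ j < b ∧ X j = Y := by
  obtain ⟨j, hj, rfl⟩ := List.mem_map.1 h
  rw [List.Ico.mem] at hj
  exact ⟨j, hj.1, hj.2, rfl⟩

theorem prod_card_le {β : ℕ} {L : List (Finset Λ)} (hL : ∀ X ∈ L, X.card ≤ β) :
    (L.map Finset.card).prod ≤ β ^ L.length := by
  induction L with
  | nil => simp
  | cons X L ih =>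
    rw [List.map_cons, List.prod_cons, List.length_cons, pow_succ']
    exact Nat.mul_le_mul (hL X List.mem_cons_self) (ih fun Y hY => hL Y (List.mem_cons_of_mem _ hY))

/-- The words with one more inserted letter from `S`. -/
noncomputable def insertLetter (S : Finset Λ) (W : Finset (List Λ)) : Finset (List Λ) :=
  W.biUnion fun w => (S ×ˢ Finset.range (w.length + 1)).image
    fun p => w.take p.2 ++ p.1 :: w.drop p.2

/-- The words that arise from `w` by `k` insertions of letters from `S`. -/
noncomputable def insertions (S : Finset Λ) (w : List Λ) : ℕ → Finset (List Λ)
  | 0 => {w}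
  | k + 1 => insertLetter S (insertions S w k)

theorem Insertion.mem_insertions {S : Finset Λ} {w v : List Λ} {k : ℕ}
    (H : Insertion (S : Set Λ) w k v) : v ∈ insertions S w k := by
  induction H with
  | base => exact Finset.mem_singleton_self _
  | @ins k u v c _ hc ih =>
    refine Finset.mem_biUnion.2 ⟨u ++ v, ih, Finset.mem_image.2 ⟨(c, u.length), ?_, ?_⟩⟩
    · simpa using hc
    · simp

theorem of_mem_insertions {S : Finset Λ} {w v : List Λ} {k : ℕ} (h : v ∈ insertions S w k) :
    v.length = w.length + k ∧ ∀ c ∈ v, c ∈ S ∨ c ∈ w := by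
  induction k generalizing v with
  | zero =>
    rw [insertions, Finset.mem_singleton] at h
    subst h
    exact ⟨rfl, fun c hc => .inr hc⟩
  | succ k ih =>
    obtain ⟨u, hu, hv⟩ := Finset.mem_biUnion.1 h
    obtain ⟨⟨c, i⟩, hp, rfl⟩ := Finset.mem_image.1 hv
    obtain ⟨hc, hi⟩ := Finset.mem_product.1 hp
    obtain ⟨h1, h2⟩ := ih hu
    rw [Finset.mem_range] at hi
    refine ⟨?_, fun d hd => ?_⟩
    · simp only [List.length_append, List.length_take, List.length_cons, List.length_drop]
      omega
    · rcases List.mem_append.1 hd with hd | hd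
      · exact h2 d (List.mem_of_mem_take hd)
      · rcases List.mem_cons.1 hd with rfl | hd
        · exact .inl hc
        · exact h2 d (List.mem_of_mem_drop hd)

theorem card_insertions_le {S : Finset Λ} {w : List Λ} {k V : ℕ} (hS : S.card ≤ V)
    (hV : w.length + k ≤ V) : (insertions S w k).card ≤ (V * V) ^ k := by
  induction k with
  | zero => simp [insertions]
  | succ k ih =>
    rw [insertions, insertLetter, pow_succ]
    refine (Finset.card_biUnion_le_card_mul _ _ (V * V) fun u hu => ?_).trans
      (Nat.mul_le_mul_right _ (ih (by omega)))
    refine Finset.card_image_le.trans ?_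
    rw [Finset.card_product, Finset.card_range, (of_mem_insertions hu).1]
    exact Nat.mul_le_mul hS (by omega)

end Families

/-! ### The test words and what they determine -/

section Tests

open Classical

variable {α Λ : Type} [Preorder α] [OrderBot α]

/-- Letters that act as split-partners of `{⊥}`, `{r i}`, `{l i}` and `{l i, r i}`. -/
structure Partners (sat : Λ → α → Prop) (𝒬 : Set α) (n : ℕ) (r l : ℕ → α) (Sb : Finset Λ)
    (Sr Sl Sp : ℕ → Finset Λ) : Prop where
  bot {u : α} : u ∈ 𝒬 → ¬ u ≤ ⊥ → ∃ A ∈ Sb, sat A u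
  conj {i : ℕ} {u : α} : i ≤ n → u ∈ 𝒬 → ¬ u ≤ r i → ∃ A ∈ Sr i, sat A u
  conj_not {i : ℕ} {A : Λ} : i ≤ n → A ∈ Sr i → ¬ sat A (r i)
  guard {i : ℕ} {u : α} : 1 ≤ i → i ≤ n → u ∈ 𝒬 → ¬ u ≤ l i → ∃ A ∈ Sl i, sat A u
  guard_not {i : ℕ} {A : Λ} : 1 ≤ i → i ≤ n → A ∈ Sl i → ¬ sat A (l i)
  both {i : ℕ} {u : α} : 1 ≤ i → i ≤ n → u ∈ 𝒬 → ¬ u ≤ l i → ¬ u ≤ r i → ∃ A ∈ Sp i, sat A u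
  both_not {i : ℕ} {A : Λ} : 1 ≤ i → i ≤ n → A ∈ Sp i → ¬ sat A (l i) ∧ ¬ sat A (r i)

/-- The letters that are inserted into the canonical word of the query. -/
noncomputable def alphabet (h : α → Λ) (n : ℕ) (r l : ℕ → α) (Sp : ℕ → Finset Λ) : Finset Λ :=
  (Finset.range (n + 1)).image (fun j => h (r j)) ∪
    ((Finset.Ico 1 (n + 1)).filter fun j => ¬ l j ≤ ⊥).image (fun j => h (l j)) ∪
    (Finset.Ico 1 (n + 1)).biUnion Sp

/-- A short rejected word with the letter `A` in front of the letter of `r e`, if there is one. -/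
noncomputable def rejectedTail (sat : Λ → α → Prop) (h : α → Λ) (n : ℕ) (r l : ℕ → α) (e : ℕ)
    (A : Λ) : List Λ :=
  if H : ∃ w, GuardedWord h n r l (e + 1) w ∧ w.length ≤ (n + 2) * (n + 1) ∧
    ¬ Accepts sat n r l e (A :: h (r e) :: w) then H.choose else []

/-- The words, split into first letter and rest, that determine the query with conjuncts `r` and
guards `l`. -/
noncomputable def testWords (sat : Λ → α → Prop) (h : α → Λ) (n : ℕ) (r l : ℕ → α)
    (Sb : Finset Λ) (Sr Sl Sp : ℕ → Finset Λ) : Finset (Λ × List Λ) :=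
  ((Finset.range 4).biUnion fun k =>
      (insertions (alphabet h n r l Sp) (conjWord h r 1 (n + 1)) k).image fun w => (h (r 0), w)) ∪
    ((Finset.Ico 1 (n + 1)).biUnion fun e => (Sl e).image fun A =>
      (h (r 0), conjWord h r 1 e ++ A :: h (r e) :: rejectedTail sat h n r l e A)) ∪
    Sb ×ˢ listsOf ((List.Ico 1 n).map fun _ => Sb) ∪
    (Finset.range (n + 1)).biUnion fun i => (if 0 = i then Sr i else Sb) ×ˢ
      listsOf ((List.Ico 1 (n + 1)).map fun j => if j = i then Sr i else Sb)

/-- The two queries accept the same test words. -/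
def SameTests (sat : Λ → α → Prop) (W : Finset (Λ × List Λ)) (n : ℕ) (r l : ℕ → α) (n' : ℕ)
    (r' l' : ℕ → α) : Prop :=
  ∀ p ∈ W, (sat p.1 (r' 0) ∧ Accepts sat n' r' l' 1 p.2) ↔
    (sat p.1 (r 0) ∧ Accepts sat n r l 1 p.2)

variable {sat : Λ → α → Prop} {𝒬 : Set α} {h : α → Λ} {n n' : ℕ} {r l r' l' : ℕ → α}
  {Sb : Finset Λ} {Sr Sl Sp : ℕ → Finset Λ}

theorem SameTests.insertion {k : ℕ} {w : List Λ}
    (HW : SameTests sat (testWords sat h n r l Sb Sr Sl Sp) n r l n' r' l') (hk : k ≤ 3)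
    (hw : Insertion (alphabet h n r l Sp : Set Λ) (conjWord h r 1 (n + 1)) k w) :
    (sat (h (r 0)) (r' 0) ∧ Accepts sat n' r' l' 1 w) ↔
      (sat (h (r 0)) (r 0) ∧ Accepts sat n r l 1 w) := by
  refine HW (h (r 0), w) ?_
  refine Finset.mem_union_left _ (Finset.mem_union_left _ (Finset.mem_union_left _ ?_))
  exact Finset.mem_biUnion.2 ⟨k, Finset.mem_range.2 (by omega),
    Finset.mem_image_of_mem _ hw.mem_insertions⟩

/-- Acceptance of the canonical word gives `n' ≤ n`. If `n' < n`, some word of `n` letters from `Sb`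
satisfies the rival but is too short for the query. With equal lengths the canonical word is matched
without skips, so `r j ≤ r' j`. If `r' i ≤ r i` fails, a word with its `i`-th letter in `Sr i` and
the others in `Sb` is accepted by the rival only. -/
theorem SameTests.conj (H : Setting sat h n r l) (HP : Partners sat 𝒬 n r l Sb Sr Sl Sp)
    (hcons : ∀ {c z}, sat c z → ¬ z ≤ ⊥) (hr' : ∀ j, j ≤ n' → r' j ∈ 𝒬) (hr0 : r 0 ∈ 𝒬)
    (HW : SameTests sat (testWords sat h n r l Sb Sr Sl Sp) n r l n' r' l') :
    n' = n ∧ ∀ j, j ≤ n → r' j ≤ r j ∧ r j ≤ r' j := by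
  obtain ⟨h0, h1⟩ := (HW.insertion (k := 0) (by omega) .base).2
    ⟨(H.sat_r (Nat.zero_le n)).2 le_rfl, H.accepts_conjWord (by omega)⟩
  have hle : n' ≤ n := by
    have := h1.length_le
    rw [length_conjWord] at this
    omega
  have hbot : ∀ j, j ≤ n' → ¬ r' j ≤ ⊥ := by
    intro j hj
    rcases Nat.eq_zero_or_pos j with rfl | hj0
    · exact hcons h0
    · obtain ⟨c, hc⟩ := h1.exists_sat hj0 hj
      exact hcons hc
  have hA : ∀ j, ∃ A ∈ Sb, j ≤ n' → sat A (r' j) := by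
    intro j
    by_cases hj : j ≤ n'
    · obtain ⟨A, h2, h3⟩ := HP.bot (hr' j hj) (hbot j hj)
      exact ⟨A, h2, fun _ => h3⟩
    -- Positions beyond `n'` are filled with any letter of `Sb`, which is non-empty because `r 0` is
    -- satisfiable.
    · obtain ⟨A, h2, -⟩ := HP.bot hr0 (H.r_sat (Nat.zero_le n))
      exact ⟨A, h2, fun h' => absurd h' hj⟩
  choose A hAS hA using hA
  have hn : n' = n := by
    by_contra hne
    have h2 := ((HW (A 0, (List.Ico 1 n).map A) ?_).1
      ⟨hA 0 (Nat.zero_le _), accepts_map_Ico (by omega) (by omega) fun j _ hj => hA j hj⟩).2.length_le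
    · simp only [List.length_map, List.Ico.length] at h2
      omega
    · refine Finset.mem_union_left _ (Finset.mem_union_right _ (Finset.mem_product.2 ⟨hAS 0, ?_⟩))
      exact map_mem_listsOf fun j _ => hAS j
  subst hn
  refine ⟨rfl, fun i hi => ⟨?_, ?_⟩⟩
  · by_contra hne
    obtain ⟨C, hC, hCs⟩ := HP.conj hi (hr' i hi) hne
    have hmem : ∀ j, (if j = i then C else A j) ∈ (if j = i then Sr i else Sb) := by
      intro j
      split_ifs
      · exact hC
      · exact hAS j
    have hsat : ∀ j, j ≤ n' → sat (if j = i then C else A j) (r' j) := by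
      intro j hj
      split_ifs with hji
      · exact hji ▸ hCs
      · exact hA j hj
    obtain ⟨h2, h3⟩ := (HW (if 0 = i then C else A 0,
      (List.Ico 1 (n' + 1)).map fun j => if j = i then C else A j)
        (Finset.mem_union_right _ (Finset.mem_biUnion.2 ⟨i, Finset.mem_range.2 (by omega),
          Finset.mem_product.2 ⟨hmem 0, map_mem_listsOf fun j _ => hmem j⟩⟩))).1
      ⟨hsat 0 (Nat.zero_le _), accepts_map_Ico (by omega) (by omega) fun j _ hj => hsat j hj⟩
    refine HP.conj_not hi hC ?_
    rcases Nat.eq_zero_or_pos i with rfl | hi0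
    · simpa using h2
    · simpa using sat_of_accepts_map_Ico (by omega) h3 i hi0 hi
  · rcases Nat.eq_zero_or_pos i with rfl | hi0
    · exact (H.sat_r hi).1 h0
    · exact (H.sat_r hi).1 (sat_of_accepts_map_Ico (by omega) h1 i hi0 hi)

theorem SameTests.wait_iff (H : Setting sat h n r l) (HP : Partners sat 𝒬 n r l Sb Sr Sl Sp)
    (hr : ∀ j, j ≤ n → r j ∈ 𝒬) (hl' : ∀ j, l' j ∈ 𝒬)
    (hrr : ∀ j, j ≤ n → r' j ≤ r j ∧ r j ≤ r' j)
    (HW : SameTests sat (testWords sat h n r l Sb Sr Sl Sp) n r l n r' l') {T : ℕ → α → Prop}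
    (hT : ∀ {x z z'}, T x z → z ≤ z' → T x z') (hbot : ∀ x, ¬ T x ⊥) {x : ℕ} :
    Wait T n r' l' 1 x ↔ Wait T n r l 1 x := by
  have hsat0 : sat (h (r 0)) (r 0) := (H.sat_r (Nat.zero_le n)).2 le_rfl
  have hsat0' : sat (h (r 0)) (r' 0) := H.mono hsat0 (hrr 0 (Nat.zero_le n)).2
  have hacc : ∀ {w}, Accepts sat n r' l' 1 w ↔ Accepts sat n r l' 1 w := fun {w} =>
    ⟨fun h => h.congr_conj fun j c hj hc => H.mono hc (hrr j hj).1,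
      fun h => h.congr_conj fun j c hj hc => H.mono hc (hrr j hj).2⟩
  have hR : Rival sat h n r l l' (alphabet h n r l Sp : Set Λ) := by
    have hSp : ∀ {i A}, 1 ≤ i → i ≤ n → A ∈ Sp i → A ∈ (alphabet h n r l Sp : Set Λ) :=
      fun {i A} h1 h2 hA => Finset.mem_coe.2 (Finset.mem_union_right _
        (Finset.mem_biUnion.2 ⟨i, Finset.mem_Ico.2 ⟨h1, by omega⟩, hA⟩))
    refine { H with agree := ?_, r_mem := ?_, l_mem := ?_, split_r := ?_, split_l := ?_ }
    · intro k w hk hw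
      have := HW.insertion hk hw
      rwa [hacc, and_iff_right hsat0', and_iff_right hsat0] at this
    · intro j hj
      exact Finset.mem_coe.2 (Finset.mem_union_left _ (Finset.mem_union_left _
        (Finset.mem_image_of_mem (fun j => h (r j)) (Finset.mem_range.2 (by omega)))))
    · intro j h1 hj hlj
      exact Finset.mem_coe.2 (Finset.mem_union_left _ (Finset.mem_union_right _
        (Finset.mem_image_of_mem (fun j => h (l j))
          (Finset.mem_filter.2 ⟨Finset.mem_Ico.2 ⟨h1, by omega⟩, hlj⟩))))
    · intro i j h1 hi hj h2 h3
      obtain ⟨A, hA, hAs⟩ := HP.both h1 hi (hr j hj) h2 h3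
      exact ⟨A, hSp h1 hi hA, hAs, HP.both_not h1 hi hA⟩
    · intro i h1 hi h2 h3
      obtain ⟨A, hA, hAs⟩ := HP.both h1 hi (hl' i) h2 h3
      exact ⟨A, hSp h1 hi hA, hAs, HP.both_not h1 hi hA⟩
  have hW : Wait T n r' l' 1 x ↔ Wait T n r l' 1 x :=
    ⟨fun h => h.congr_conj fun j c hj hc => hT hc (hrr j hj).1,
      fun h => h.congr_conj fun j c hj hc => hT hc (hrr j hj).2⟩
  rw [hW]
  refine hR.wait_iff (T := T) (fun e h1 hn he => ?_) hT hbot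
  obtain ⟨A, hA, hAs⟩ := HP.guard h1 hn (hl' e) he
  refine ⟨A, hAs, HP.guard_not h1 hn hA, fun ⟨w, hw1, hw2⟩ => ?_⟩
  -- A rejected tail can be shortened, so the tail chosen in `rejectedTail` is a genuine one. That
  -- choice does not involve the rival.
  have hex : ∃ w, GuardedWord h n r l (e + 1) w ∧ w.length ≤ (n + 2) * (n + 1) ∧
      ¬ Accepts sat n r l e (A :: h (r e) :: w) := by
    obtain ⟨w', h2, h3, h4⟩ := hw1.exists_short (sat := sat)
    refine ⟨w', h2, h3.trans (Nat.mul_le_mul_left _ (by omega)), fun h5 => hw2 ?_⟩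
    exact Accepts.append_congr (u := [A, h (r e)]) h4 h5
  have hrej : rejectedTail sat h n r l e A = hex.choose := dif_pos hex
  refine ⟨hex.choose, hex.choose_spec.1, hex.choose_spec.2.2, fun h2 => ?_⟩
  have h3 := HW (h (r 0), conjWord h r 1 e ++ A :: h (r e) :: rejectedTail sat h n r l e A) (by
    refine Finset.mem_union_left _ (Finset.mem_union_left _ (Finset.mem_union_right _ ?_))
    exact Finset.mem_biUnion.2 ⟨e, Finset.mem_Ico.2 ⟨h1, by omega⟩,
      Finset.mem_image.2 ⟨A, hA, rfl⟩⟩)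
  rw [hrej, hacc] at h3
  exact (h3.1 ⟨hsat0', h2⟩).2

end Tests

/-! ### Number and length of the test words -/

section Counting

open Classical

variable {α Λ : Type} [Preorder α] [OrderBot α]
variable {sat : Λ → α → Prop} {h : α → Λ} {n : ℕ} {r l : ℕ → α}
  {Sb : Finset Λ} {Sr Sl Sp : ℕ → Finset Λ}

theorem card_alphabet_le {D : ℕ} (hSp : ∀ i, 1 ≤ i → i ≤ n → (Sp i).card ≤ D) :
    (alphabet h n r l Sp).card ≤ (n + 1) + n + n * D := by
  refine (Finset.card_union_le _ _).trans (Nat.add_le_add ((Finset.card_union_le _ _).trans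
    (Nat.add_le_add ?_ ?_)) ?_)
  · exact Finset.card_image_le.trans (Finset.card_range _).le
  · exact Finset.card_image_le.trans ((Finset.card_filter_le _ _).trans (by simp))
  · refine (Finset.card_biUnion_le_card_mul _ _ D fun i hi => ?_).trans (by simp)
    rw [Finset.mem_Ico] at hi
    exact hSp i hi.1 (by omega)

/-- Since `i` occurs at most once, `V` enters the product at most once; for `β = 1` the number of
words stays polynomial. -/
theorem prod_ite_le {i V β : ℕ} (hV : 1 ≤ V) {L : List ℕ} (hL : L.Nodup) :
    (L.map fun j => if j = i then V else β).prod ≤ V * β ^ L.length ∨ β = 0 := by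
  rcases Nat.eq_zero_or_pos β with rfl | hβ
  · exact .inr rfl
  left
  have hne : ∀ {L : List ℕ}, i ∉ L →
      (L.map fun j => if j = i then V else β).prod = β ^ L.length := by
    intro L hi
    induction L with
    | nil => rfl
    | cons j L ih =>
      rw [List.mem_cons, not_or] at hi
      rw [List.map_cons, List.prod_cons, ih hi.2, if_neg (Ne.symm hi.1), List.length_cons,
        pow_succ']
  induction L with
  | nil => simpa using hV
  | cons j L ih =>
    rw [List.nodup_cons] at hL
    rw [List.map_cons, List.prod_cons, List.length_cons]
    split_ifs with hji
    · subst hji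
      rw [hne hL.1]
      exact Nat.mul_le_mul_left _ (Nat.pow_le_pow_right hβ (Nat.le_succ _))
    · rw [pow_succ', Nat.mul_left_comm]
      exact Nat.mul_le_mul_left _ (ih hL.2)

/-- Three insertions, each with at most `V` letters and `V` places, give `V ^ 6`. The factor `β ^ (n
+ 1)` is due to the words over `Sb` alone. The coefficient is `4 + 1 + 1 + 1`, one summand for each
family of test words, with `k < 4` insertions in the first. -/
theorem card_testWords_le {V β : ℕ} (hn : n + 5 ≤ V) (hβ : 1 ≤ β)
    (hal : (alphabet h n r l Sp).card ≤ V) (hSb : Sb.card ≤ β)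
    (hSr : ∀ i, i ≤ n → (Sr i).card ≤ V) (hSl : ∀ i, 1 ≤ i → i ≤ n → (Sl i).card ≤ V) :
    (testWords sat h n r l Sb Sr Sl Sp).card ≤ 7 * V ^ 6 * β ^ (n + 1) := by
  have hβ' : 1 ≤ β ^ (n + 1) := Nat.one_le_pow _ _ hβ
  have hV : 1 ≤ V := by omega
  have h1 : ((Finset.range 4).biUnion fun k =>
      (insertions (alphabet h n r l Sp) (conjWord h r 1 (n + 1)) k).image
        fun w => (h (r 0), w)).card ≤ 4 * V ^ 6 := by
    refine (Finset.card_biUnion_le_card_mul _ _ (V ^ 6) fun k hk => ?_).trans (by simp)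
    rw [Finset.mem_range] at hk
    refine Finset.card_image_le.trans ((card_insertions_le hal ?_).trans ?_)
    · rw [length_conjWord]
      omega
    · rw [← pow_two, ← pow_mul]
      exact Nat.pow_le_pow_right hV (by omega)
  have h2 : ((Finset.Ico 1 (n + 1)).biUnion fun e => (Sl e).image fun A =>
      (h (r 0), conjWord h r 1 e ++ A :: h (r e) :: rejectedTail sat h n r l e A)).card ≤
      V ^ 6 := by
    refine (Finset.card_biUnion_le_card_mul _ _ V fun e he => ?_).trans ?_
    · rw [Finset.mem_Ico] at he
      exact Finset.card_image_le.trans (hSl e he.1 (by omega))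
    · rw [Nat.card_Ico]
      calc (n + 1 - 1) * V ≤ V * V := Nat.mul_le_mul_right _ (by omega)
        _ = V ^ 2 := (pow_two V).symm
        _ ≤ V ^ 6 := Nat.pow_le_pow_right hV (by omega)
  have h3 : (Sb ×ˢ listsOf ((List.Ico 1 n).map fun _ => Sb)).card ≤ β ^ (n + 1) := by
    rw [Finset.card_product]
    have h4 : (listsOf ((List.Ico 1 n).map fun _ => Sb)).card ≤ β ^ (n - 1) := by
      refine (card_listsOf_le _).trans ((prod_card_le (β := β) ?_).trans (by simp))
      intro X hX
      obtain ⟨-, -, -, rfl⟩ := exists_of_mem_map_Ico hX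
      exact hSb
    refine (Nat.mul_le_mul hSb h4).trans ?_
    rw [← pow_succ']
    exact Nat.pow_le_pow_right hβ (by omega)
  have h5 : ((Finset.range (n + 1)).biUnion fun i => (if 0 = i then Sr i else Sb) ×ˢ
      listsOf ((List.Ico 1 (n + 1)).map fun j => if j = i then Sr i else Sb)).card ≤
      V ^ 6 * β ^ (n + 1) := by
    refine (Finset.card_biUnion_le_card_mul _ _ (V ^ 2 * β ^ (n + 1)) fun i hi => ?_).trans ?_
    · have hi' : i ≤ n := by rw [Finset.mem_range] at hi; omega
      rw [Finset.card_product]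
      have h6 : (if 0 = i then Sr i else Sb).card ≤ V * β := by
        split_ifs
        · exact (hSr i hi').trans (Nat.le_mul_of_pos_right _ hβ)
        · exact hSb.trans (Nat.le_mul_of_pos_left _ hV)
      have h7 : (listsOf ((List.Ico 1 (n + 1)).map fun j => if j = i then Sr i else Sb)).card ≤
          V * β ^ n := by
        refine (card_listsOf_le _).trans ?_
        rw [List.map_map]
        refine le_trans (List.prod_le_prod' (g := fun j => if j = i then V else β) ?_) ?_
        · intro j _
          simp only [Function.comp_apply]
          split_ifs
          · exact hSr i hi'
          · exact hSb
        · have := (prod_ite_le (i := i) (β := β) hV (List.Ico.nodup 1 (n + 1))).resolve_right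
            (by omega)
          simpa using this
      refine (Nat.mul_le_mul h6 h7).trans (le_of_eq ?_)
      rw [pow_succ]
      ring
    · rw [Finset.card_range]
      calc (n + 1) * (V ^ 2 * β ^ (n + 1)) ≤ V * (V ^ 2 * β ^ (n + 1)) :=
            Nat.mul_le_mul_right _ (by omega)
        _ = V ^ 3 * β ^ (n + 1) := by ring
        _ ≤ V ^ 6 * β ^ (n + 1) :=
            Nat.mul_le_mul_right _ (Nat.pow_le_pow_right hV (by omega))
  have h8 : 1 ≤ V ^ 6 := Nat.one_le_pow _ _ hV
  refine (Finset.card_union_le _ _).trans ((Nat.add_le_add ((Finset.card_union_le _ _).trans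
    (Nat.add_le_add ((Finset.card_union_le _ _).trans (Nat.add_le_add h1 h2)) h3)) h5).trans ?_)
  nlinarith [Nat.mul_le_mul_left (V ^ 6) hβ', Nat.mul_le_mul_right (β ^ (n + 1)) h8]

/-- The quadratic length is caused by the rejected tails; the other test words have linear length.
-/
theorem of_mem_testWords {G : Λ → Prop} {V : ℕ} (hn : n + 5 ≤ V)
    (hr : ∀ j, j ≤ n → G (h (r j))) (hl : ∀ j, 1 ≤ j → j ≤ n → ¬ l j ≤ ⊥ → G (h (l j)))
    (hSb : ∀ A ∈ Sb, G A) (hSr : ∀ i, i ≤ n → ∀ A ∈ Sr i, G A)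
    (hSl : ∀ i, 1 ≤ i → i ≤ n → ∀ A ∈ Sl i, G A) (hSp : ∀ i, 1 ≤ i → i ≤ n → ∀ A ∈ Sp i, G A)
    {p : Λ × List Λ} (hp : p ∈ testWords sat h n r l Sb Sr Sl Sp) :
    p.2.length + 1 ≤ V ^ 2 ∧ ∀ c ∈ p.1 :: p.2, G c := by
  have hV2 : (n + 5) ^ 2 ≤ V ^ 2 := Nat.pow_le_pow_left hn 2
  have hconj : ∀ {a b : ℕ}, b ≤ n + 1 → ∀ c ∈ conjWord h r a b, G c := by
    intro a b hb c hc
    obtain ⟨j, -, hj, rfl⟩ := exists_of_mem_map_Ico hc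
    exact hr j (by omega)
  simp only [testWords, Finset.mem_union, or_assoc] at hp
  rcases hp with hp | hp | hp | hp
  · obtain ⟨k, hk, hp⟩ := Finset.mem_biUnion.1 hp
    obtain ⟨w, hw, rfl⟩ := Finset.mem_image.1 hp
    obtain ⟨h1, h2⟩ := of_mem_insertions hw
    rw [Finset.mem_range] at hk
    rw [length_conjWord] at h1
    refine ⟨?_, fun c hc => ?_⟩
    · simp only [h1, Nat.add_sub_cancel]
      nlinarith
    rcases List.mem_cons.1 hc with rfl | hc
    · exact hr 0 (Nat.zero_le n)
    rcases h2 c hc with hc | hc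
    · simp only [alphabet, Finset.mem_union, Finset.mem_image, Finset.mem_range, Finset.mem_filter,
        Finset.mem_Ico, Finset.mem_biUnion] at hc
      rcases hc with (⟨j, hj, rfl⟩ | ⟨j, ⟨hj, hlj⟩, rfl⟩) | ⟨j, hj, hc⟩
      · exact hr j (by omega)
      · exact hl j hj.1 (by omega) hlj
      · exact hSp j hj.1 (by omega) c hc
    · exact hconj le_rfl c hc
  · obtain ⟨e, he, hp⟩ := Finset.mem_biUnion.1 hp
    obtain ⟨A, hA, rfl⟩ := Finset.mem_image.1 hp
    rw [Finset.mem_Ico] at he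
    have hrej : (rejectedTail sat h n r l e A).length ≤ (n + 2) * (n + 1) ∧
        ∀ c ∈ rejectedTail sat h n r l e A, G c := by
      rw [rejectedTail]
      split_ifs with H
      · refine ⟨H.choose_spec.2.1, fun c hc => ?_⟩
        rcases H.choose_spec.1.letters c hc with ⟨i, -, hi, rfl⟩ | ⟨i, hi1, hi, hli, rfl⟩
        · exact hr i hi
        · exact hl i (by omega) hi hli
      · simp
    refine ⟨?_, fun c hc => ?_⟩
    · simp only [List.length_append, List.length_cons, length_conjWord]
      have := hrej.1
      have h3 : e - 1 ≤ n := by omega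
      nlinarith
    simp only [List.mem_cons, List.mem_append] at hc
    rcases hc with rfl | hc | rfl | rfl | hc
    · exact hr 0 (Nat.zero_le n)
    · exact hconj (by omega) c hc
    · exact hSl e he.1 (by omega) _ hA
    · exact hr e (by omega)
    · exact hrej.2 c hc
  · obtain ⟨hp1, hp2⟩ := Finset.mem_product.1 hp
    obtain ⟨h1, h2⟩ := of_mem_listsOf hp2
    refine ⟨?_, fun c hc => ?_⟩
    · rw [h1, List.length_map, List.Ico.length]
      have : n - 1 ≤ n := Nat.sub_le _ _
      nlinarith
    rcases List.mem_cons.1 hc with rfl | hc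
    · exact hSb _ hp1
    · obtain ⟨X, hX, hcX⟩ := h2 c hc
      obtain ⟨-, -, -, rfl⟩ := exists_of_mem_map_Ico hX
      exact hSb _ hcX
  · obtain ⟨i, hi, hp⟩ := Finset.mem_biUnion.1 hp
    obtain ⟨hp1, hp2⟩ := Finset.mem_product.1 hp
    obtain ⟨h1, h2⟩ := of_mem_listsOf hp2
    rw [Finset.mem_range] at hi
    refine ⟨?_, fun c hc => ?_⟩
    · rw [h1, List.length_map, List.Ico.length]
      simp only [Nat.add_sub_cancel]
      nlinarith
    have hite : ∀ {j : ℕ}, c ∈ (if j = i then Sr i else Sb) → G c := by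
      intro j hc
      split_ifs at hc
      · exact hSr i (by omega) c hc
      · exact hSb c hc
    rcases List.mem_cons.1 hc with rfl | hc
    · exact hite hp1
    · obtain ⟨X, hX, hcX⟩ := h2 c hc
      obtain ⟨j, -, -, rfl⟩ := exists_of_mem_map_Ico hX
      exact hite hcX

end Counting

/-! ### Example sets from words -/

section Examples

open Classical

variable {U B : Type} {O : Ontology U B}

/-- The pointed temporal data instance of a word. -/
noncomputable def realizePt (p : Letter O × List (Letter O)) : PointedTemporal U B :=
  ⟨realize p.1 p.2, 0, zero_mem_realize _ _⟩

/-- The words of `W`, classified by `q`. -/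
noncomputable def classify (W : Finset (Letter O × List (Letter O))) (q : UPath U B) :
    ExampleSet U B where
  pos := (W.filter fun p => q.EntailedAt O (realize p.1 p.2) 0 0).image realizePt
  neg := (W.filter fun p => ¬ q.EntailedAt O (realize p.1 p.2) 0 0).image realizePt

theorem fits_classify_self (W : Finset (Letter O × List (Letter O))) (q : UPath U B) :
    (classify W q).Fits O q := by
  constructor
  · intro e he
    obtain ⟨p, hp, rfl⟩ := Finset.mem_image.1 he
    exact (Finset.mem_filter.1 hp).2
  · intro e he
    obtain ⟨p, hp, rfl⟩ := Finset.mem_image.1 he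
    exact (Finset.mem_filter.1 hp).2

theorem entailedAt_iff_of_fits {W : Finset (Letter O × List (Letter O))} {q q' : UPath U B}
    (h : (classify W q).Fits O q') {p : Letter O × List (Letter O)} (hp : p ∈ W) :
    q'.EntailedAt O (realize p.1 p.2) 0 0 ↔ q.EntailedAt O (realize p.1 p.2) 0 0 := by
  by_cases hq : q.EntailedAt O (realize p.1 p.2) 0 0
  · exact iff_of_true (h.1 (realizePt p)
      (Finset.mem_image_of_mem _ (Finset.mem_filter.2 ⟨hp, hq⟩))) hq
  · exact iff_of_false (h.2 (realizePt p)
      (Finset.mem_image_of_mem _ (Finset.mem_filter.2 ⟨hp, hq⟩))) hq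

theorem size_classify_le {W : Finset (Letter O × List (Letter O))} {q : UPath U B} {K : ℕ}
    (hK : ∀ p ∈ W, (realize p.1 p.2).size ≤ K) : (classify W q).size ≤ W.card * K := by
  have key : ∀ (P : Letter O × List (Letter O) → Prop) [DecidablePred P],
      ∑ e ∈ (W.filter P).image realizePt, e.inst.size ≤ (W.filter P).card * K := by
    intro P _
    refine (Finset.sum_le_card_nsmul _ _ K fun e he => ?_).trans
      (Nat.mul_le_mul_right _ Finset.card_image_le)
    obtain ⟨p, hp, rfl⟩ := Finset.mem_image.1 he
    exact hK p (Finset.mem_filter.1 hp).1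
  rw [ExampleSet.size, classify]
  refine (Nat.add_le_add (key _) (key _)).trans (le_of_eq ?_)
  rw [← Nat.add_mul, Finset.card_filter_add_card_filter_not]

/-- Trimming removes the obstruction of `wait_realize_iff`, so the equivalence is available for
every query, in particular for every rival. -/
theorem entailedAt_realize_iff {q : UPath U B} {p : Letter O × List (Letter O)} :
    q.EntailedAt O (realize p.1 p.2) 0 0 ↔ p.1.Sat (pathConj O (trim O q) 0) ∧
      Accepts Letter.Sat (pathLen (trim O q)) (pathConj O (trim O q)) (pathGuard O (trim O q))
        1 p.2 := by
  rw [← entailedAt_trim, UPath.EntailedAt, imp_iff_right (satisfiable_realize _ _), trueAt_iff,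
    wait_realize_iff (trim_conj_last q)]
  refine and_congr ?_ Iff.rfl
  exact timeline_realize_of_lt (Nat.succ_pos _)

theorem one_le_size (A : DataInstance U B) : 1 ≤ A.size :=
  (Nat.succ_le_of_lt (Finset.card_pos.2 A.ind_nonempty)).trans (card_ind_le A)

/-- Members of a split-partner are satisfiable with `O`: an inconsistent one entails `⊥`, which is
contained in every member of the non-empty `Q`. -/
theorem exists_letters {𝒬 : Set (DomainQuery U B)} (hbot : DomainQuery.bot ∈ 𝒬)
    {Q : Finset (DomainQuery U B)} (hQ : Q.Nonempty) {S : Finset (PointedInstance U B)}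
    (hS : IsSplitPartner O 𝒬 Q S) : ∃ S' : Finset (Letter O), S'.card ≤ S.card ∧
      S'.card ≤ pointedSize S ∧ (∀ A ∈ S', A.1.inst.size ≤ pointedSize S) ∧
      ∀ u : QueryOver O, u ∈ 𝒬 → ((∃ A ∈ S', A.Sat u) ↔ ∀ z ∈ Q, ¬ Contained O u z) := by
  have hsat : ∀ p ∈ S, InstSatisfiable O p.inst := by
    intro p hp
    by_contra hne
    obtain ⟨z, hz⟩ := hQ
    exact (hS _ hbot).1 ⟨p, hp, fun I hI => hne ⟨I, hI⟩⟩ z hz (bot_le (α := QueryOver O) (a := z))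
  have hle : (S.subtype fun p => InstSatisfiable O p.inst).card ≤ S.card := by
    rw [Finset.card_subtype]
    exact Finset.card_filter_le _ _
  refine ⟨S.subtype fun p => InstSatisfiable O p.inst, hle, hle.trans ?_, fun A hA => ?_,
    fun u hu => Iff.trans ?_ (hS u hu)⟩
  · rw [Finset.card_eq_sum_ones]
    exact Finset.sum_le_sum fun p _ => one_le_size p.inst
  · exact Finset.single_le_sum (f := fun p : PointedInstance U B => p.inst.size)
      (fun _ _ => Nat.zero_le _) (Finset.mem_subtype.1 hA)
  · constructor
    · rintro ⟨A, hA, h⟩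
      exact ⟨A.1, Finset.mem_subtype.1 hA, h⟩
    · rintro ⟨p, hp, h⟩
      exact ⟨⟨p, hsat p hp⟩, Finset.mem_subtype.2 hp, h⟩

end Examples

/-! ### Assembling the characterisation and its size -/

section Characterisation

variable {U B : Type} {O : Ontology U B} {𝒬 : Set (DomainQuery U B)}

theorem queriesSize_singleton (a : DomainQuery U B) : queriesSize {a} = a.size :=
  Finset.sum_singleton _ _

open Classical in
theorem queriesSize_pair_le (a b : DomainQuery U B) : queriesSize {a, b} ≤ a.size + b.size := by
  rw [queriesSize]
  by_cases h : a = b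
  · simp [h]
  · rw [Finset.sum_pair h]

open Classical in
/-- The conjuncts and guards of `q`. -/
noncomputable def labels (O : Ontology U B) (q : UPath U B) : Finset (DomainQuery U B) :=
  (Finset.range (pathLen q + 1)).image (fun j => (pathConj O q j : DomainQuery U B)) ∪
    (Finset.range (pathLen q + 1)).image (fun j => (pathGuard O q j : DomainQuery U B))

open Classical in
theorem conj_mem_labels {q : UPath U B} {j : ℕ} (hj : j ≤ pathLen q) :
    (pathConj O q j : DomainQuery U B) ∈ labels O q :=
  Finset.mem_union_left _ (Finset.mem_image_of_mem _ (Finset.mem_range.2 (by omega)))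

open Classical in
theorem guard_mem_labels {q : UPath U B} {j : ℕ} (hj : j ≤ pathLen q) :
    (pathGuard O q j : DomainQuery U B) ∈ labels O q :=
  Finset.mem_union_right _ (Finset.mem_image_of_mem _ (Finset.mem_range.2 (by omega)))

open Classical in
theorem mem_of_mem_labels (hbot : DomainQuery.bot ∈ 𝒬) {q : UPath U B} (hq : q.BuiltFrom 𝒬)
    {z : DomainQuery U B} (hz : z ∈ labels O q) : z ∈ 𝒬 := by
  rcases Finset.mem_union.1 hz with hz | hz <;> obtain ⟨j, hj, rfl⟩ := Finset.mem_image.1 hz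
  · exact pathConj_mem hq j (by rw [Finset.mem_range] at hj; omega)
  · exact pathGuard_mem hbot hq j

theorem setting_of_peerless {q : UPath U B} (hq : q.Peerless O) (hsat : q.SatisfiableWrt O)
    {h : QueryOver O → Letter O}
    (hh : ∀ z u : QueryOver O, ¬ z ≤ ⊥ → ((h z).Sat u ↔ z ≤ u)) :
    Setting Letter.Sat h (pathLen q) (pathConj O q) (pathGuard O q) where
  mono := Letter.Sat.mono
  hat := hh _ _
  r_sat := conj_not_le_bot hsat _
  peer := peerless_guard hq _

theorem exists_partner {F : Finset (DomainQuery U B)} {N D : ℕ} (hbot : DomainQuery.bot ∈ 𝒬)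
    (hS : ∀ Q ⊆ F, Q.Nonempty → queriesSize Q ≤ N →
      ∃ S, IsSplitPartner O 𝒬 Q S ∧ pointedSize S ≤ D)
    {Q : Finset (DomainQuery U B)} (hQ : Q ⊆ F) (hne : Q.Nonempty) (hN : queriesSize Q ≤ N) :
    ∃ S' : Finset (Letter O), S'.card ≤ D ∧ (∀ A ∈ S', A.1.inst.size ≤ D) ∧
      ∀ u : QueryOver O, u ∈ 𝒬 → ((∃ A ∈ S', A.Sat u) ↔ ∀ z ∈ Q, ¬ Contained O u z) := by
  obtain ⟨S, h1, h2⟩ := hS Q hQ hne hN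
  obtain ⟨S', -, h3, h4, h5⟩ := exists_letters hbot hne h1
  exact ⟨S', h3.trans h2, fun A hA => (h4 A hA).trans h2, h5⟩

theorem equivWrt_of_sameTests {q q' : UPath U B} {h : QueryOver O → Letter O}
    {Sb : Finset (Letter O)} {Sr Sl Sp : ℕ → Finset (Letter O)}
    (hbot : DomainQuery.bot ∈ 𝒬) (hq : q.BuiltFrom 𝒬) (hq' : q'.BuiltFrom 𝒬)
    (H : Setting Letter.Sat h (pathLen q) (pathConj O q) (pathGuard O q))
    (HP : Partners Letter.Sat {u : QueryOver O | u ∈ 𝒬} (pathLen q) (pathConj O q)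
      (pathGuard O q) Sb Sr Sl Sp)
    (HW : SameTests Letter.Sat
      (testWords Letter.Sat h (pathLen q) (pathConj O q) (pathGuard O q) Sb Sr Sl Sp)
      (pathLen q) (pathConj O q) (pathGuard O q) (pathLen q') (pathConj O q') (pathGuard O q')) :
    q'.EquivWrt O q := by
  obtain ⟨hn, hrr⟩ := HW.conj H HP (fun {c _} hz => not_le_bot_of_entails c.2 c.1.pt_mem hz)
    (pathConj_mem hq') (pathConj_mem hq 0 (Nat.zero_le _))
  rw [hn] at HW
  intro D a ha
  refine forall_congr' fun hD => ?_
  rw [trueAt_iff, trueAt_iff, hn]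
  refine and_congr ⟨fun h0 => timeline_mono ha h0 (hrr 0 (Nat.zero_le _)).1,
    fun h0 => timeline_mono ha h0 (hrr 0 (Nat.zero_le _)).2⟩ ?_
  exact HW.wait_iff (T := timeline O D a) H HP (pathConj_mem hq) (pathGuard_mem hbot hq') hrr
    (fun h0 h1 => timeline_mono ha h0 h1) (timeline_bot hD)

-- Split-partners are required only for subsets of the labels of the trimmed query, so that a bound
-- `D` exists even without a uniform bound. The single number `V` dominates the alphabet, the
-- partners, the canonical letters and `n + 5`.
open Classical in
theorem exists_characterisation_of_le [Fintype U] [Fintype B] (hbot : DomainQuery.bot ∈ 𝒬)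
    (hcr : AdmitsContainmentReduction O) {q : UPath U B} (hq : q ∈ peerlessQueries O 𝒬)
    (hsat : q.SatisfiableWrt O) {D β V : ℕ} (hβ : 1 ≤ β)
    (hS : ∀ Q ⊆ labels O (trim O q), Q.Nonempty → queriesSize Q ≤ q.size →
      ∃ S, IsSplitPartner O 𝒬 Q S ∧ pointedSize S ≤ D)
    {Sbot : Finset (PointedInstance U B)} (hSbot : IsSplitPartner O 𝒬 {DomainQuery.bot} Sbot)
    (hSβ : Sbot.card ≤ β) (hSD : pointedSize Sbot ≤ D)
    (hV : q.size * D + 3 * q.size + 5 + D + 3 * (q.size + Fintype.card U * q.size +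
      Fintype.card B * (q.size * q.size)) ≤ V) :
    ∃ E : ExampleSet U B, E.UniquelyCharacterises O (untilPathQueries 𝒬) q ∧
      E.size ≤ 21 * V ^ 11 * β ^ q.size := by
  obtain ⟨q₀, hq₀⟩ : ∃ q₀, q₀ = trim O q := ⟨_, rfl⟩
  rw [← hq₀] at hS
  have hsize : q₀.size ≤ q.size := hq₀ ▸ size_trim_le q
  have hbuilt : q₀.BuiltFrom 𝒬 := hq₀ ▸ builtFrom_trim hq.1
  have hpeer : q₀.Peerless O := hq₀ ▸ peerless_trim hq.2
  have hsat₀ : q₀.SatisfiableWrt O := by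
    obtain ⟨D', a, ha, hD', h⟩ := hsat
    exact ⟨D', a, ha, hD', hq₀ ▸ (entailedAt_trim q 0).2 h⟩
  have hn : pathLen q₀ + 2 ≤ q.size := (pathLen_lt_size q₀).trans hsize
  -- canonical letters
  have hhat : ∀ z : QueryOver O, ∃ c : Letter O, ¬ z ≤ ⊥ → ((∀ u : QueryOver O, c.Sat u ↔ z ≤ u) ∧
      c.1.inst.size ≤ 3 * (DomainQuery.size z + Fintype.card U * DomainQuery.size z +
        Fintype.card B * (DomainQuery.size z * DomainQuery.size z))) := by
    intro z
    by_cases hz : z ≤ ⊥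
    -- Queries below `⊥` receive an arbitrary letter, which no test word uses.
    · obtain ⟨c, -⟩ := exists_hat hcr _ (conj_not_le_bot hsat₀ 0 (Nat.zero_le _))
      exact ⟨c, fun h => absurd hz h⟩
    · obtain ⟨c, hc⟩ := exists_hat hcr z hz
      exact ⟨c, fun _ => hc⟩
  choose h hh using hhat
  have hhV : ∀ z : QueryOver O, ¬ z ≤ ⊥ → DomainQuery.size z ≤ q.size →
      (h z).1.inst.size ≤ V := by
    intro z hz hs
    refine ((hh z hz).2.trans (Nat.mul_le_mul_left 3 ?_)).trans ((Nat.le_add_left _ _).trans hV)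
    gcongr
  have H : Setting Letter.Sat h (pathLen q₀) (pathConj O q₀) (pathGuard O q₀) :=
    setting_of_peerless hpeer hsat₀ fun z u hz => (hh z hz).1 u
  -- split-partners
  obtain ⟨Sb, hb1, -, hb2, hb3⟩ := exists_letters hbot (Finset.singleton_nonempty _) hSbot
  have hr : ∀ i, ∃ S' : Finset (Letter O), i ≤ pathLen q₀ → S'.card ≤ D ∧
      (∀ A ∈ S', A.1.inst.size ≤ D) ∧ ∀ u : QueryOver O, u ∈ 𝒬 → ((∃ A ∈ S', A.Sat u) ↔
        ∀ z ∈ ({pathConj O q₀ i} : Finset (DomainQuery U B)), ¬ Contained O u z) := by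
    intro i
    by_cases hi : i ≤ pathLen q₀
    · obtain ⟨S', h'⟩ := exists_partner hbot hS
        (Finset.singleton_subset_iff.2 (conj_mem_labels hi)) (Finset.singleton_nonempty _)
        ((queriesSize_singleton _).trans_le ((size_conj_le q₀ i).trans hsize))
      exact ⟨S', fun _ => h'⟩
    · exact ⟨∅, fun h => absurd h hi⟩
  have hl : ∀ i, ∃ S' : Finset (Letter O), 1 ≤ i → i ≤ pathLen q₀ → S'.card ≤ D ∧
      (∀ A ∈ S', A.1.inst.size ≤ D) ∧ ∀ u : QueryOver O, u ∈ 𝒬 → ((∃ A ∈ S', A.Sat u) ↔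
        ∀ z ∈ ({pathGuard O q₀ i} : Finset (DomainQuery U B)), ¬ Contained O u z) := by
    intro i
    by_cases hi : 1 ≤ i ∧ i ≤ pathLen q₀
    · obtain ⟨S', h'⟩ := exists_partner hbot hS
        (Finset.singleton_subset_iff.2 (guard_mem_labels hi.2)) (Finset.singleton_nonempty _)
        ((queriesSize_singleton _).trans_le
          ((Nat.le_of_add_right_le (size_guard_add_conj_le q₀ i hi.1 hi.2)).trans hsize))
      exact ⟨S', fun _ _ => h'⟩
    · exact ⟨∅, fun h1 h2 => absurd ⟨h1, h2⟩ hi⟩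
  have hp : ∀ i, ∃ S' : Finset (Letter O), 1 ≤ i → i ≤ pathLen q₀ → S'.card ≤ D ∧
      (∀ A ∈ S', A.1.inst.size ≤ D) ∧ ∀ u : QueryOver O, u ∈ 𝒬 → ((∃ A ∈ S', A.Sat u) ↔
        ∀ z ∈ ({pathGuard O q₀ i, pathConj O q₀ i} : Finset (DomainQuery U B)),
          ¬ Contained O u z) := by
    intro i
    by_cases hi : 1 ≤ i ∧ i ≤ pathLen q₀
    · obtain ⟨S', h'⟩ := exists_partner hbot hS (Q := {pathGuard O q₀ i, pathConj O q₀ i})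
        (Finset.insert_subset (guard_mem_labels hi.2)
          (Finset.singleton_subset_iff.2 (conj_mem_labels hi.2))) (Finset.insert_nonempty _ _)
        (((queriesSize_pair_le _ _).trans (size_guard_add_conj_le q₀ i hi.1 hi.2)).trans hsize)
      exact ⟨S', fun _ _ => h'⟩
    · exact ⟨∅, fun h1 h2 => absurd ⟨h1, h2⟩ hi⟩
  choose Sr hSr using hr
  choose Sl hSl using hl
  choose Sp hSp using hp
  have hrm : ∀ {i}, i ≤ pathLen q₀ → (pathConj O q₀ i : DomainQuery U B) ∈ 𝒬 :=
    fun {i} hi => pathConj_mem hbuilt i hi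
  have hlm : ∀ {i}, (pathGuard O q₀ i : DomainQuery U B) ∈ 𝒬 :=
    fun {i} => pathGuard_mem hbot hbuilt i
  have HP : Partners Letter.Sat {u : QueryOver O | u ∈ 𝒬} (pathLen q₀) (pathConj O q₀)
      (pathGuard O q₀) Sb Sr Sl Sp :=
    { bot := fun {u} hu hz => (hb3 u hu).2 fun z hz' => by
        rw [Finset.mem_singleton.1 hz']
        exact hz
      conj := fun {i u} hi hu hz => ((hSr i hi).2.2 u hu).2 fun z hz' => by
        rw [Finset.mem_singleton.1 hz']
        exact hz
      conj_not := fun {i A} hi hA hz => ((hSr i hi).2.2 _ (hrm hi)).1 ⟨A, hA, hz⟩ _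
        (Finset.mem_singleton_self _) (le_refl (pathConj O q₀ i))
      guard := fun {i u} h1 hi hu hz => ((hSl i h1 hi).2.2 u hu).2 fun z hz' => by
        rw [Finset.mem_singleton.1 hz']
        exact hz
      guard_not := fun {i A} h1 hi hA hz => ((hSl i h1 hi).2.2 _ hlm).1 ⟨A, hA, hz⟩ _
        (Finset.mem_singleton_self _) (le_refl (pathGuard O q₀ i))
      both := fun {i u} h1 hi hu hz1 hz2 => ((hSp i h1 hi).2.2 u hu).2 fun z hz' => by
        rcases Finset.mem_insert.1 hz' with rfl | hz'
        · exact hz1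
        · rw [Finset.mem_singleton.1 hz']
          exact hz2
      both_not := fun {i A} h1 hi hA =>
        ⟨fun hz => ((hSp i h1 hi).2.2 _ hlm).1 ⟨A, hA, hz⟩ _ (Finset.mem_insert_self _ _)
          (le_refl (pathGuard O q₀ i)),
        fun hz => ((hSp i h1 hi).2.2 _ (hrm hi)).1 ⟨A, hA, hz⟩ _
          (Finset.mem_insert_of_mem (Finset.mem_singleton_self _))
          (le_refl (pathConj O q₀ i))⟩ }
  obtain ⟨W, hW⟩ : ∃ W, W = testWords Letter.Sat h (pathLen q₀) (pathConj O q₀)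
    (pathGuard O q₀) Sb Sr Sl Sp := ⟨_, rfl⟩
  refine ⟨classify W q, ⟨fits_classify_self W q, fun q' hq' hfit => ?_⟩, ?_⟩
  · have key : (trim O q').EquivWrt O q₀ := by
      refine equivWrt_of_sameTests hbot hbuilt (builtFrom_trim hq') H HP fun p hpW => ?_
      rw [hq₀, ← entailedAt_realize_iff, ← entailedAt_realize_iff]
      exact entailedAt_iff_of_fits hfit (hW ▸ hpW)
    intro D' a ha
    have := key D' a ha
    rwa [hq₀, entailedAt_trim, entailedAt_trim] at this
  -- size
  have hDV : D ≤ V := le_trans (by omega) hV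
  have hnV : pathLen q₀ + 5 ≤ V := le_trans (by omega) hV
  have hV1 : 1 ≤ V := by omega
  have hal : (alphabet h (pathLen q₀) (pathConj O q₀) (pathGuard O q₀) Sp).card ≤ V := by
    refine (card_alphabet_le (D := D) fun i h1 hi => (hSp i h1 hi).1).trans (le_trans ?_ hV)
    have : pathLen q₀ * D ≤ q.size * D := Nat.mul_le_mul_right _ (by omega)
    omega
  have hcard : W.card ≤ 7 * V ^ 6 * β ^ q.size := by
    rw [hW]
    refine (card_testWords_le hnV hβ hal (hb1.trans hSβ) (fun i hi => (hSr i hi).1.trans hDV)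
      fun i h1 hi => (hSl i h1 hi).1.trans hDV).trans (Nat.mul_le_mul_left _ ?_)
    exact Nat.pow_le_pow_right hβ (by omega)
  have hword : ∀ p ∈ W, (realize p.1 p.2).size ≤ V ^ 2 * (V + 2 * (V ^ 2 * V)) := by
    intro p hpW
    rw [hW] at hpW
    obtain ⟨h1, h2⟩ := of_mem_testWords (G := fun c : Letter O => c.1.inst.size ≤ V) hnV
      (fun j hj => hhV _ (H.r_sat hj) ((size_conj_le q₀ j).trans hsize))
      (fun j h1 hj hj' => hhV _ hj'
        ((Nat.le_of_add_right_le (size_guard_add_conj_le q₀ j h1 hj)).trans hsize))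
      (fun A hA => (hb2 A hA).trans (hSD.trans hDV))
      (fun i hi A hA => ((hSr i hi).2.1 A hA).trans hDV)
      (fun i h1 hi A hA => ((hSl i h1 hi).2.1 A hA).trans hDV)
      (fun i h1 hi A hA => ((hSp i h1 hi).2.1 A hA).trans hDV) hpW
    exact size_realize_le h1 h2
  -- This makes the size of one example at most `3 * V ^ 5`, whence `21 = 7 * 3` and the exponent
  -- `11 = 6 + 5`.
  have hV3 : V ≤ V ^ 3 := Nat.le_self_pow (by omega) V
  calc (classify W q).size ≤ W.card * (V ^ 2 * (V + 2 * (V ^ 2 * V))) := size_classify_le hword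
    _ ≤ 7 * V ^ 6 * β ^ q.size * (V ^ 2 * (V ^ 3 + 2 * (V ^ 2 * V))) := by gcongr
    _ = 21 * V ^ 11 * β ^ q.size := by ring

/-- A product form of the bound, polynomial in the query size and `D`, from which both the
exponential and the polynomial estimate can be read off. -/
theorem exists_characterisation [Fintype U] [Fintype B] (hbot : DomainQuery.bot ∈ 𝒬)
    (hcr : AdmitsContainmentReduction O) {q : UPath U B} (hq : q ∈ peerlessQueries O 𝒬)
    (hsat : q.SatisfiableWrt O) {D β : ℕ} (hβ : 1 ≤ β)
    (hS : ∀ Q ⊆ labels O (trim O q), Q.Nonempty → queriesSize Q ≤ q.size →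
      ∃ S, IsSplitPartner O 𝒬 Q S ∧ pointedSize S ≤ D)
    {Sbot : Finset (PointedInstance U B)} (hSbot : IsSplitPartner O 𝒬 {DomainQuery.bot} Sbot)
    (hSβ : Sbot.card ≤ β) (hSD : pointedSize Sbot ≤ D) :
    ∃ E : ExampleSet U B, E.UniquelyCharacterises O (untilPathQueries 𝒬) q ∧
      E.size ≤ 21 * ((6 * (Fintype.card U + Fintype.card B + 1)) * (q.size + 1) ^ 2 *
        (D + 1)) ^ 11 * β ^ q.size := by
  refine exists_characterisation_of_le hbot hcr hq hsat hβ hS hSbot hSβ hSD ?_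
  generalize Fintype.card U = u
  generalize Fintype.card B = b
  generalize q.size = N
  have : (6 * (u + b + 1)) * (N + 1) ^ 2 * (D + 1) =
      N * D + 3 * N + 5 + D + 3 * (N + u * N + b * (N * N)) +
      (6 * (u + b) * (N + 1) ^ 2 * D + 6 * N ^ 2 * D + 11 * N * D + 5 * D + 6 * N ^ 2 + 6 * N + 1 +
        6 * u * N ^ 2 + 9 * u * N + 6 * u + 3 * b * N ^ 2 + 12 * b * N + 6 * b) := by ring
  rw [this]
  exact Nat.le_add_right _ _

theorem card_le_pointedSize (S : Finset (PointedInstance U B)) : S.card ≤ pointedSize S := by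
  rw [Finset.card_eq_sum_ones]
  exact Finset.sum_le_sum fun p _ => one_le_size p.inst

-- A finite set of labels has finitely many subsets, so for one fixed query the chosen
-- split-partners are bounded.
open Classical in
theorem exists_uniform_bound {F : Finset (DomainQuery U B)}
    (h : ∀ Q ⊆ F, Q.Nonempty → ∃ S, IsSplitPartner O 𝒬 Q S) :
    ∃ D, ∀ Q ⊆ F, Q.Nonempty → ∃ S, IsSplitPartner O 𝒬 Q S ∧ pointedSize S ≤ D := by
  have : ∀ Q, ∃ S, Q ⊆ F → Q.Nonempty → IsSplitPartner O 𝒬 Q S := by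
    intro Q
    by_cases hQ : Q ⊆ F ∧ Q.Nonempty
    · obtain ⟨S, hS⟩ := h Q hQ.1 hQ.2
      exact ⟨S, fun _ _ => hS⟩
    · exact ⟨∅, fun h1 h2 => absurd ⟨h1, h2⟩ hQ⟩
  choose S hS using this
  exact ⟨F.powerset.sup fun Q => pointedSize (S Q), fun Q h1 h2 => ⟨S Q, hS Q h1 h2,
    Finset.le_sup (f := fun Q => pointedSize (S Q)) (Finset.mem_powerset.2 h1)⟩⟩

theorem eval_mono (f : Polynomial ℕ) {m n : ℕ} (h : m ≤ n) : f.eval m ≤ f.eval n := by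
  rw [Polynomial.eval_eq_sum, Polynomial.eval_eq_sum]
  exact Finset.sum_le_sum fun i _ => Nat.mul_le_mul_left _ (Nat.pow_le_pow_left h i)

theorem mul_pow_le_two_pow (C N d c : ℕ) :
    21 * (C * (N + 1) ^ 2 * (2 ^ d + 1)) ^ 11 * (2 ^ c) ^ N ≤
      2 ^ (21 + 11 * (C + 2 * (N + 1) + (d + 1)) + c * N) := by
  have h1 : C ≤ 2 ^ C := Nat.lt_two_pow_self.le
  have h2 : N + 1 ≤ 2 ^ (N + 1) := Nat.lt_two_pow_self.le
  have h3 : 2 ^ d + 1 ≤ 2 ^ (d + 1) := by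
    have := Nat.one_le_two_pow (n := d)
    rw [pow_succ]
    omega
  have h4 : 21 ≤ 2 ^ 21 := Nat.lt_two_pow_self.le
  calc 21 * (C * (N + 1) ^ 2 * (2 ^ d + 1)) ^ 11 * (2 ^ c) ^ N
      ≤ 2 ^ 21 * (2 ^ C * (2 ^ (N + 1)) ^ 2 * 2 ^ (d + 1)) ^ 11 * (2 ^ c) ^ N := by gcongr
    _ = 2 ^ (21 + 11 * (C + 2 * (N + 1) + (d + 1)) + c * N) := by
      simp only [← pow_mul, ← pow_add]
      congr 1
      ring

end Characterisation

end UntilWords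

/-! ### The theorem -/

open UntilWords in
theorem mainTheorem2 {U B : Type} [Finite U] [Finite B] [Nonempty (U ⊕ B)]
    (𝒬 : Set (DomainQuery U B)) (hbot : DomainQuery.bot ∈ 𝒬)
    (ℒ : Set (Ontology U B)) (hℒ : HasGeneralSplitPartners ℒ 𝒬)
    (O : Ontology U B) (hO : O ∈ ℒ) (hcr : AdmitsContainmentReduction O) :
    -- unique characterisability
    (∀ q ∈ peerlessQueries O 𝒬, q.SatisfiableWrt O →
      ∃ E : ExampleSet U B, E.UniquelyCharacterises O (untilPathQueries 𝒬) q) ∧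
    -- exponential size
    ((∃ f : Polynomial ℕ, SplitPartnersBounded O 𝒬 (fun n => 2 ^ f.eval n)) →
      ∃ g : Polynomial ℕ, ∀ q ∈ peerlessQueries O 𝒬, q.SatisfiableWrt O →
        ∃ E : ExampleSet U B, E.UniquelyCharacterises O (untilPathQueries 𝒬) q ∧
          E.size ≤ 2 ^ g.eval q.size) ∧
    -- polynomial size
    ((∃ f : Polynomial ℕ, SplitPartnersBounded O 𝒬 (fun n => f.eval n)) →
      (∃ p : PointedInstance U B, IsSplitPartner O 𝒬 {DomainQuery.bot} {p}) →
      ∃ g : Polynomial ℕ, ∀ q ∈ peerlessQueries O 𝒬, q.SatisfiableWrt O →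
        ∃ E : ExampleSet U B, E.UniquelyCharacterises O (untilPathQueries 𝒬) q ∧
          E.size ≤ g.eval q.size) := by
  have := Fintype.ofFinite U
  have := Fintype.ofFinite B
  have hbot' : ∀ z ∈ ({DomainQuery.bot} : Finset (DomainQuery U B)), z ∈ 𝒬 :=
    fun z hz => Finset.mem_singleton.1 hz ▸ hbot
  have hmem : ∀ {q}, q ∈ peerlessQueries O 𝒬 → ∀ {Q}, Q ⊆ labels O (trim O q) →
      ∀ z ∈ Q, z ∈ 𝒬 :=
    fun hq _ hQ _ hz => mem_of_mem_labels hbot (builtFrom_trim hq.1) (hQ hz)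
  refine ⟨fun q hq hsat => ?_, ?_, ?_⟩
  · obtain ⟨D, hD⟩ := exists_uniform_bound (F := labels O (trim O q))
      fun Q hQ hne => hℒ O hO Q hne (hmem hq hQ)
    obtain ⟨S, hS⟩ := hℒ O hO {DomainQuery.bot} (Finset.singleton_nonempty _) hbot'
    obtain ⟨E, hE, -⟩ := exists_characterisation (D := D + pointedSize S) (β := S.card + 1)
      hbot hcr hq hsat (Nat.le_add_left _ _)
      (fun Q hQ hne _ => (hD Q hQ hne).imp fun T hT => ⟨hT.1, hT.2.trans (Nat.le_add_right _ _)⟩)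
      hS (Nat.le_succ _) (Nat.le_add_left _ _)
    exact ⟨E, hE⟩
  · rintro ⟨f, hf⟩
    obtain ⟨S, hS, hSle⟩ := hf {DomainQuery.bot} (Finset.singleton_nonempty _) hbot'
    replace hSle : pointedSize S ≤ 2 ^ f.eval 2 := hSle
    refine ⟨21 + 11 * (Polynomial.C (6 * (Fintype.card U + Fintype.card B + 1)) +
      2 * (Polynomial.X + 1) + (f + Polynomial.C (f.eval 2) + 1)) +
        Polynomial.C (f.eval 2) * Polynomial.X, fun q hq hsat => ?_⟩
    -- The query `⊥` has size `2`, so `2 ^ f.eval 2` bounds the partner of `{⊥}` independently of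
    -- `q`, and `β ^ q.size` is only singly exponential.
    obtain ⟨E, hE, hle⟩ := exists_characterisation (D := 2 ^ (f.eval q.size + f.eval 2))
      (β := 2 ^ f.eval 2) hbot hcr hq hsat Nat.one_le_two_pow
      (fun Q hQ hne hs => (hf Q hne (hmem hq hQ)).imp fun T hT => ⟨hT.1, hT.2.trans
        (Nat.pow_le_pow_right two_pos ((eval_mono f hs).trans (Nat.le_add_right _ _)))⟩)
      hS ((card_le_pointedSize S).trans hSle)
      (hSle.trans (Nat.pow_le_pow_right two_pos (Nat.le_add_left _ _)))
    refine ⟨E, hE, (hle.trans (mul_pow_le_two_pow _ _ _ _)).trans (le_of_eq ?_)⟩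
    simp
  · rintro ⟨f, hf⟩ ⟨p, hp⟩
    refine ⟨21 * (Polynomial.C (6 * (Fintype.card U + Fintype.card B + 1)) *
      (Polynomial.X + 1) ^ 2 * (f + Polynomial.C p.inst.size + 1)) ^ 11, fun q hq hsat => ?_⟩
    -- A singleton partner of `{⊥}` allows `β = 1`, which removes the exponential factor.
    obtain ⟨E, hE, hle⟩ := exists_characterisation (D := f.eval q.size + p.inst.size)
      (β := 1) hbot hcr hq hsat le_rfl
      (fun Q hQ hne hs => (hf Q hne (hmem hq hQ)).imp fun T hT => ⟨hT.1, hT.2.trans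
        ((eval_mono f hs).trans (Nat.le_add_right _ _))⟩)
      hp (Finset.card_singleton p).le
      (by rw [pointedSize, Finset.sum_singleton]; exact Nat.le_add_left _ _)
    refine ⟨E, hE, hle.trans (le_of_eq ?_)⟩
    simp
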